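/- **Setting.** Let $(E,\|\cdot\|)$ be a real separable Banach space and let $(\Omega,\mathcal F,(\mathcal F_t)_{t\ge0},\mathbb P)$ be a filtered probability space. For $p\ge1$, $\gamma\in(0,1]$ let $\mathcal C_{p,\gamma}$ be the set of measurable $f:E\to\mathbb R$ with $$\sup_{u}\frac{|f(u)|}{1+\|u\|^{p/2}}+\sup_{u_1\ne u_2}\frac{|f(u_1)-f(u_2)|}{(1\wedge\|u_1-u_2\|^\gamma)(1+\|u_1\|^p+\|u_2\|^p)^{1/2}}<\infty .$$ Let $X$ be an $E$-valued time-homogeneous $(\mathcal F_t)$-Markov process, $X^x_{s,t}$ $(s\le t)$ its value at time $t$ when started from $x$ at time $s$, $X^x_t=X^x_{0,t}$, and $P_tf(x)=\mathbb E f(X^x_t)$. Let $\tau_0=0$, $\tau_k>0$ for $k\ge1$, $\tau_k\to0$, $t_n=\sum_{k=0}^n\tau_k\to\infty$. Let $Y$ be a (non-homogeneous) Markov chain with respect to $(\mathcal F_{t_n})_n$, with $Y^{x,\tau}_{t_m,t_n}$ $(m\le n)$ its value at $t_n$ when started from $x$ at $t_m$, and $Y^{x,\tau}_{t_n}=Y^{x,\tau}_{t_0,t_n}$.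 **Assumption on $X$.** There are $r\ge2$, $\tilde r\ge1$, $\gamma_1\in(0,1]$, $\beta\in[0,r-1]$, $l\in[0,r]$, $\tilde l\in(0,1]$, $L_1,L_2,L_3>0$ and a continuous $\rho:[0,\infty)\to[0,\infty)$ with $\int_0^\infty\rho^{\gamma_1}dt<\infty$ and $\sum_{k\ge1}\rho(k)^{\gamma_1}<\infty$ such that for all $x,y\in E$, $t\ge0$: $\mathbb E\|X_t^x\|^r\le L_1(1+\|x\|^{\tilde rr})$; $(\mathbb E\|X^x_t-X^y_t\|^2)^{1/2}\le L_2\|x-y\|(1+\|x\|^\beta+\|y\|^\beta)\rho(t)$; $(\mathbb E\|X^x_t-x\|^2)^{1/2}\le L_3(1+\|x\|^l)t^{\tilde l}$. **Assumption on $Y$.** There are $q\ge2$, $\tilde q\ge1$, $\kappa\in[0,q-1]$, $L_4,L_5>0$ and $\rho^\tau:[0,\infty)\to[0,\infty)$ such that for all $x,y\in E$ and $n\ge m\ge0$: $\mathbb E\|Y^{x,\tau}_{t_m,t_n}\|^q\le L_4(1+\|x\|^{\tilde qq})$; $(\mathbb E\|Y^{x,\tau}_{t_m,t_n}-Y^{y,\tau}_{t_m,t_n}\|^2)^{1/2}\le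 L_5\|x-y\|(1+\|x\|^\kappa+\|y\|^\kappa)\rho^\tau(t_n-t_m)$. **Strong error assumption.** There are $\alpha,L_6>0$ such that for all $x\in E$ and $n\ge m\ge1$: $(\mathbb E\|X^x_{t_m,t_n}-Y^{x,\tau}_{t_m,t_n}\|^2)^{1/2}\le L_6(1+\|x\|^{\tilde r\vee\tilde q})\tau_n^\alpha$. **Exponents.** Put $\tilde d=(1+\beta)\vee\tilde r\vee\tilde q$. Suppose that there are an integer $c\ge2$, $p\in[1,r\wedge q]$ and $\gamma\in[\gamma_1,1]$ such that, with $\tilde p_F=\frac p2+\frac{p\tilde q}2+\gamma(\tilde d\vee\kappa)$: $\frac p2(1+\tilde r)+(1+\beta)\gamma_1\le r$; $4c(\frac{p\tilde q}2+\tilde d\gamma)\le q$; $\frac p2+\big([(\frac p2+\gamma)(\tilde r\vee\tilde q)]\vee[(\frac p2+l\gamma)\tilde r]\big)\le r$; $\tilde p_F\le r\wedge q$; $2c(\frac{\tilde p_F\tilde q}2+\tilde d\gamma)\le q$. **Step sizes.** Suppose that (i) $\sum_{k\ge1}\tau_k^{1+\gamma\alpha}<\infty$; (ii) $\sup_k\sum_{i\ge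 k}\tau_i\rho(t_i-t_k)^\gamma<\infty$; (iii) $\sup_k\sum_{i\ge k}\tau_i\rho^\tau(t_i-t_k)^\gamma<\infty$; (iv) $\big(\sum_{k=1}^n\tau_k\big)^{-1}\sum_{k=1}^n\tau_{k-1}\big(\sum_{i\ge k-1}\tau_i^{\gamma\alpha}\tau_{i+1}+\sum_{i\ge k}\tau_i^{1+\tilde l\gamma}\big)\to0$. **Notation.** Let $n_{(k)}$ be the index with $t_{n_{(k)}}\le k<t_{n_{(k)}+1}$ and $\tilde t_k=t_{n_{(k)}}$. For a probability measure $\mu$, $f\in\mathcal C_{p,\gamma}$ and $x\in E$ let $$\mathscr M^{x,\tau}_k=\sum_{i\ge0}\tau_i\big(\mathbb E[f(Y^{x,\tau}_{t_i})|\mathcal F_{t_k}]-\mu(f)\big)-\sum_{i\ge0}\tau_i\big(\mathbb E[f(Y^{x,\tau}_{t_i})|\mathcal F_{0}]-\mu(f)\big),$$ $\tilde{\mathcal Z}^{x,\tau}_k=\mathscr M^{x,\tau}_{n_{(k)}}-\mathscr M^{x,\tau}_{n_{(k-1)}}$ for $k\ge1$, and $v=\sqrt{2\mu\big((f-\mu(f))\int_0^\infty(P_tf-\mu(f))\,dt\big)}$.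 **Statement.** $X$ has a unique invariant probability measure $\mu$. With this $\mu$, for every $f\in\mathcal C_{p,\gamma}$ the constant $v$ is well defined (all integrals exist and the radicand is nonnegative), and for every $x\in E$ the variables $f(Y^{x,\tau}_{t_i})$ are integrable, the series defining $\mathscr M^{x,\tau}_k$ converge absolutely almost surely for each $k\ge 0$, and $$\lim_{N\to\infty}\frac1{\tilde t_N}\sum_{k=1}^N\big|\tilde{\mathcal Z}^{x,\tau}_k\big|^2=v^2\qquad\text{almost surely.}$$ -/

import Mathlib

open MeasureTheory ProbabilityTheory Filter Topology
open scoped NNReal ENNReal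

noncomputable section

namespace NumLIL

/-! ### The class of test functions -/

section TestFunctions

variable {E : Type*} [NormedAddCommGroup E]

/-- The quasi-metric `d_{p,γ}(u₁,u₂) = (1 ∧ ‖u₁-u₂‖^γ) (1 + ‖u₁‖^p + ‖u₂‖^p)^{1/2}`. -/
def quasiDist (p γ : ℝ) (u₁ u₂ : E) : ℝ :=
  min 1 (‖u₁ - u₂‖ ^ γ) * (1 + ‖u₁‖ ^ p + ‖u₂‖ ^ p) ^ (1 / 2 : ℝ)

/-- `f ∈ 𝒞_{p,γ}`: `f` is Borel measurable and both suprema in the norm `‖f‖_{p,γ}`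
are finite. -/
structure MemC [MeasurableSpace E] (p γ : ℝ) (f : E → ℝ) : Prop where
  measurable : Measurable f
  growth : BddAbove (Set.range fun u : E => |f u| / (1 + ‖u‖ ^ (p / 2)))
  holder : BddAbove ((fun q : E × E => |f q.1 - f q.2| / quasiDist p γ q.1 q.2) ''
    {q : E × E | q.1 ≠ q.2})

end TestFunctions

/-! ### The Markov process and its invariant measure -/

section MarkovFamily

variable {Ω E : Type*} {mΩ : MeasurableSpace Ω} [MeasurableSpace E]

/-- `X s t x` is the value `X^x_{s,t}` at time `t ≥ s` of the process started from `x` at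
time `s`; all of them live on one filtered probability space and form a time-homogeneous
Markov process with respect to the filtration. -/
structure IsMarkovProcess (P : Measure Ω) (ℱ : Filtration ℝ≥0 mΩ)
    (X : ℝ≥0 → ℝ≥0 → E → Ω → E) : Prop where
  initial : ∀ s x, X s s x =ᵐ[P] fun _ => x
  adapted : ∀ s t x, s ≤ t → Measurable[ℱ t] (X s t x)
  homogeneous : ∀ s t x, s ≤ t → P.map (X s t x) = P.map (X 0 (t - s) x)
  measurable_transition : ∀ s t (A : Set E), s ≤ t → MeasurableSet A →
    Measurable fun x => P (X s t x ⁻¹' A)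
  markov : ∀ s u t x, s ≤ u → u ≤ t → ∀ f : E → ℝ, Measurable f → (∃ C, ∀ y, |f y| ≤ C) →
    P[fun ω => f (X s t x ω) | ℱ u] =ᵐ[P] fun ω => ∫ ω', f (X u t (X s u x ω) ω') ∂P

/-- The transition operator `P_t f (x) = 𝔼[f(X^x_t)]`. -/
def semigroup (P : Measure Ω) (X : ℝ≥0 → ℝ≥0 → E → Ω → E) (t : ℝ≥0) (f : E → ℝ) (x : E) : ℝ :=
  ∫ ω, f (X 0 t x ω) ∂P

/-- `μ` is an invariant probability measure: `μ(P_t f) = μ(f)` for bounded Borel `f`. -/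
structure IsInvariantProb (P : Measure Ω) (X : ℝ≥0 → ℝ≥0 → E → Ω → E) (μ : Measure E) :
    Prop where
  prob : IsProbabilityMeasure μ
  invariant : ∀ (t : ℝ≥0) (f : E → ℝ), Measurable f → (∃ C, ∀ y, |f y| ≤ C) →
    ∫ x, semigroup P X t f x ∂μ = ∫ x, f x ∂μ

/-- `∫₀^∞ (P_t f (u) - μ(f)) dt`. -/
def corrector (P : Measure Ω) (X : ℝ≥0 → ℝ≥0 → E → Ω → E) (μ : Measure E) (f : E → ℝ)
    (u : E) : ℝ :=
  ∫ t in Set.Ioi (0 : ℝ), (semigroup P X t.toNNReal f u - ∫ y, f y ∂μ)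

/-- `2 μ((f - μ(f)) ∫₀^∞ (P_t f - μ(f)) dt)`, the radicand in the definition of `v`. -/
def radicand (P : Measure Ω) (X : ℝ≥0 → ℝ≥0 → E → Ω → E) (μ : Measure E) (f : E → ℝ) : ℝ :=
  2 * ∫ u, (f u - ∫ y, f y ∂μ) * corrector P X μ f u ∂μ

/-- The limit constant `v`. -/
def limitConst (P : Measure Ω) (X : ℝ≥0 → ℝ≥0 → E → Ω → E) (μ : Measure E) (f : E → ℝ) : ℝ :=
  Real.sqrt (radicand P X μ f)

end MarkovFamily

/-! ### The time grid -/

section Grid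

/-- `t_n = ∑_{k=0}^n τ_k`. -/
def grid (τ : ℕ → ℝ≥0) (n : ℕ) : ℝ≥0 := ∑ k ∈ Finset.range (n + 1), τ k

/-- The standing conditions on the step sizes. -/
structure IsStepSequence (τ : ℕ → ℝ≥0) : Prop where
  zero : τ 0 = 0
  pos : ∀ k, 1 ≤ k → 0 < τ k
  tendsto_zero : Tendsto τ atTop (𝓝 0)
  tendsto_grid : Tendsto (grid τ) atTop atTop

/-- `n_{(k)}`, the index with `t_{n_{(k)}} ≤ k < t_{n_{(k)}+1}`. -/
def coarseIndex (τ : ℕ → ℝ≥0) (k : ℕ) : ℕ := sSup {n : ℕ | grid τ n ≤ (k : ℝ≥0)}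

theorem coarseIndex_spec {τ : ℕ → ℝ≥0} (hτ : IsStepSequence τ) (k : ℕ) :
    grid τ (coarseIndex τ k) ≤ k ∧ (k : ℝ≥0) < grid τ (coarseIndex τ k + 1) := by
  have hne : {n : ℕ | grid τ n ≤ (k : ℝ≥0)}.Nonempty := ⟨0, by simp [grid, hτ.zero]⟩
  have hbdd : BddAbove {n : ℕ | grid τ n ≤ (k : ℝ≥0)} := by
    obtain ⟨n₀, hn₀⟩ := eventually_atTop.1 (hτ.tendsto_grid.eventually_gt_atTop (k : ℝ≥0))
    refine ⟨n₀, fun n hn => ?_⟩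
    by_contra h
    exact absurd (hn₀ n (not_le.1 h).le) (not_lt.2 hn)
  refine ⟨Nat.sSup_mem hne hbdd, ?_⟩
  by_contra h
  have : coarseIndex τ k + 1 ≤ coarseIndex τ k := le_csSup hbdd (not_lt.1 h)
  omega

/-- `t̃_k = t_{n_{(k)}}`. -/
def coarseGrid (τ : ℕ → ℝ≥0) (k : ℕ) : ℝ≥0 := grid τ (coarseIndex τ k)

/-- Conditions (i)-(iv) on the step sizes. Sums of nonnegative terms are taken in `[0,∞]`
in (ii)-(iv), so that finiteness is part of the conditions; the `k`-th summand of (iv)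
is written with `k = j + 1`. -/
structure StepConditions (τ : ℕ → ℝ≥0) (ρ ρτ : ℝ≥0 → ℝ≥0) (γ α l' : ℝ) : Prop where
  summable_pow : Summable fun k : ℕ => (τ (k + 1) : ℝ) ^ (1 + γ * α)
  sup_rho : ⨆ k : ℕ, ∑' j : ℕ,
    ((τ (k + j) * ρ (grid τ (k + j) - grid τ k) ^ γ : ℝ≥0) : ℝ≥0∞) < ∞
  sup_rhoτ : ⨆ k : ℕ, ∑' j : ℕ,
    ((τ (k + j) * ρτ (grid τ (k + j) - grid τ k) ^ γ : ℝ≥0) : ℝ≥0∞) < ∞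
  average : Tendsto (fun n : ℕ =>
      (∑ j ∈ Finset.range n, (τ j : ℝ≥0∞) *
        ((∑' i : ℕ, ((τ (j + i) ^ (γ * α) * τ (j + i + 1) : ℝ≥0) : ℝ≥0∞)) +
          ∑' i : ℕ, ((τ (j + 1 + i) ^ (1 + l' * γ) : ℝ≥0) : ℝ≥0∞))) /
        ((∑ k ∈ Finset.Icc 1 n, τ k : ℝ≥0) : ℝ≥0∞)) atTop (𝓝 0)

end Grid

/-! ### The numerical approximation -/

section Approximation

variable {Ω E : Type*} {mΩ : MeasurableSpace Ω} [MeasurableSpace E]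

/-- `Y m n x` is the value `Y^{x,τ}_{t_m,t_n}` at grid time `t_n ≥ t_m` of the approximation
started from `x` at time `t_m`; together they form a (non-homogeneous) Markov chain with
respect to `(ℱ_{t_n})`. -/
structure IsMarkovChain (P : Measure Ω) (ℱ : Filtration ℝ≥0 mΩ) (τ : ℕ → ℝ≥0)
    (Y : ℕ → ℕ → E → Ω → E) : Prop where
  initial : ∀ m x, Y m m x =ᵐ[P] fun _ => x
  adapted : ∀ m n x, m ≤ n → Measurable[ℱ (grid τ n)] (Y m n x)
  measurable_transition : ∀ m n (A : Set E), m ≤ n → MeasurableSet A →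
    Measurable fun x => P (Y m n x ⁻¹' A)
  markov : ∀ m k n x, m ≤ k → k ≤ n → ∀ f : E → ℝ, Measurable f → (∃ C, ∀ y, |f y| ≤ C) →
    P[fun ω => f (Y m n x ω) | ℱ (grid τ k)] =ᵐ[P]
      fun ω => ∫ ω', f (Y k n (Y m k x ω) ω') ∂P

/-- The `i`-th term `τ_i (𝔼[f(Y^{x,τ}_{t_i}) | ℱ_{t_k}] - μ(f))`. -/
def martTerm (P : Measure Ω) (ℱ : Filtration ℝ≥0 mΩ) (τ : ℕ → ℝ≥0) (Y : ℕ → ℕ → E → Ω → E)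
    (μ : Measure E) (f : E → ℝ) (x : E) (k i : ℕ) (ω : Ω) : ℝ :=
  (τ i : ℝ) * ((P[fun ω' => f (Y 0 i x ω') | ℱ (grid τ k)]) ω - ∫ y, f y ∂μ)

/-- The martingale `𝓜^{x,τ}_k`. -/
def mart (P : Measure Ω) (ℱ : Filtration ℝ≥0 mΩ) (τ : ℕ → ℝ≥0) (Y : ℕ → ℕ → E → Ω → E)
    (μ : Measure E) (f : E → ℝ) (x : E) (k : ℕ) (ω : Ω) : ℝ :=
  ∑' i, martTerm P ℱ τ Y μ f x k i ω - ∑' i, martTerm P ℱ τ Y μ f x 0 i ω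

/-- The predominant martingale `𝓜̃^{x,τ}_N = 𝓜^{x,τ}_{n_{(N)}}`. -/
def coarseMart (P : Measure Ω) (ℱ : Filtration ℝ≥0 mΩ) (τ : ℕ → ℝ≥0) (Y : ℕ → ℕ → E → Ω → E)
    (μ : Measure E) (f : E → ℝ) (x : E) (N : ℕ) (ω : Ω) : ℝ :=
  mart P ℱ τ Y μ f x (coarseIndex τ N) ω

/-- The martingale differences `𝓩̃^{x,τ}_k = 𝓜̃^{x,τ}_k - 𝓜̃^{x,τ}_{k-1}`, `𝓩̃^{x,τ}_0 = 0`. -/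
def coarseDiff (P : Measure Ω) (ℱ : Filtration ℝ≥0 mΩ) (τ : ℕ → ℝ≥0) (Y : ℕ → ℕ → E → Ω → E)
    (μ : Measure E) (f : E → ℝ) (x : E) : ℕ → Ω → ℝ
  | 0 => fun _ => 0
  | k + 1 => fun ω => coarseMart P ℱ τ Y μ f x (k + 1) ω - coarseMart P ℱ τ Y μ f x k ω

end Approximation

/-! ### The three assumptions -/

section Assumptions

variable {Ω E : Type*} {mΩ : MeasurableSpace Ω} [NormedAddCommGroup E]

/-- Moment boundedness, attractiveness and time regularity of the Markov process.
Here `r'` is `r̃`, `l'` is `l̃`, and `eLpNorm Z 2 P` is `(𝔼 ‖Z‖²)^{1/2}`. -/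
structure ProcessAssumption (P : Measure Ω) (X : ℝ≥0 → ℝ≥0 → E → Ω → E)
    (r r' L₁ γ₁ β L₂ : ℝ) (ρ : ℝ≥0 → ℝ≥0) (l l' L₃ : ℝ) : Prop where
  two_le_r : 2 ≤ r
  one_le_r' : 1 ≤ r'
  L₁_pos : 0 < L₁
  moment : ∀ (x : E) (t : ℝ≥0),
    ∫⁻ ω, ‖X 0 t x ω‖ₑ ^ r ∂P ≤ ENNReal.ofReal (L₁ * (1 + ‖x‖ ^ (r' * r)))
  γ₁_pos : 0 < γ₁
  γ₁_le_one : γ₁ ≤ 1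
  β_nonneg : 0 ≤ β
  β_le : β ≤ r - 1
  L₂_pos : 0 < L₂
  ρ_continuous : Continuous ρ
  ρ_integrable : IntegrableOn (fun t : ℝ => (ρ t.toNNReal : ℝ) ^ γ₁) (Set.Ioi 0)
  ρ_summable : Summable fun k : ℕ => (ρ ((k + 1 : ℕ) : ℝ≥0) : ℝ) ^ γ₁
  attractive : ∀ (x y : E) (t : ℝ≥0),
    eLpNorm (fun ω => X 0 t x ω - X 0 t y ω) 2 P ≤
      ENNReal.ofReal (L₂ * ‖x - y‖ * (1 + ‖x‖ ^ β + ‖y‖ ^ β) * ρ t)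
  l_nonneg : 0 ≤ l
  l_le : l ≤ r
  l'_pos : 0 < l'
  l'_le_one : l' ≤ 1
  L₃_pos : 0 < L₃
  regular : ∀ (x : E) (t : ℝ≥0),
    eLpNorm (fun ω => X 0 t x ω - x) 2 P ≤ ENNReal.ofReal (L₃ * (1 + ‖x‖ ^ l) * (t : ℝ) ^ l')

/-- Moment boundedness and attractiveness of the approximation. Here `q'` is `q̃`. -/
structure SchemeAssumption (P : Measure Ω) (τ : ℕ → ℝ≥0) (Y : ℕ → ℕ → E → Ω → E)
    (q q' L₄ κ L₅ : ℝ) (ρτ : ℝ≥0 → ℝ≥0) : Prop where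
  two_le_q : 2 ≤ q
  one_le_q' : 1 ≤ q'
  L₄_pos : 0 < L₄
  moment : ∀ (x : E) (m k : ℕ), m ≤ k →
    ∫⁻ ω, ‖Y m k x ω‖ₑ ^ q ∂P ≤ ENNReal.ofReal (L₄ * (1 + ‖x‖ ^ (q' * q)))
  κ_nonneg : 0 ≤ κ
  κ_le : κ ≤ q - 1
  L₅_pos : 0 < L₅
  attractive : ∀ (x y : E) (m n : ℕ), m ≤ n →
    eLpNorm (fun ω => Y m n x ω - Y m n y ω) 2 P ≤
      ENNReal.ofReal (L₅ * ‖x - y‖ * (1 + ‖x‖ ^ κ + ‖y‖ ^ κ) * ρτ (grid τ n - grid τ m))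

/-- Strong convergence of the approximation. -/
structure ErrorAssumption (P : Measure Ω) (X : ℝ≥0 → ℝ≥0 → E → Ω → E) (τ : ℕ → ℝ≥0)
    (Y : ℕ → ℕ → E → Ω → E) (r' q' α L₆ : ℝ) : Prop where
  α_pos : 0 < α
  L₆_pos : 0 < L₆
  error : ∀ (x : E) (m n : ℕ), 1 ≤ m → m ≤ n →
    eLpNorm (fun ω => X (grid τ m) (grid τ n) x ω - Y m n x ω) 2 P ≤
      ENNReal.ofReal (L₆ * (1 + ‖x‖ ^ max r' q') * (τ n : ℝ) ^ α)

end Assumptions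

end NumLIL

end

noncomputable section

namespace NumLIL

/-! ### A strong law of large numbers for martingales -/

section MartingaleSLLN

/-! Write `F = f - μ(f)`, let `Q_{k,i}` be the transition kernels of the scheme and `P_t` the
semigroup of `X`.

Poisson equation. The corrector `φ_k = ∑_{i≥k} τ_i Q_{k,i} F` solves `φ_k = τ_k F + Q_{k,k+1}
φ_{k+1}`. Hence `M_k = ∑_{j<k} τ_j F(Y_j) + φ_k(Y_k)` is a martingale. It differs from `𝓜_k` by a
random variable that does not depend on `k`, so the `𝓩̃_k` are the increments of `M` over blocks of
roughly unit time.

Quadratic variation. The process `M_n² - φ_n(Y_n)²` has predictable drift `τ_n g_n(Y_n)` with `g_n =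
2 F φ_n - τ_n F²`. The functions `g_n` lie in one weighted Hölder class, so they have a corrector
`ψ_n` of their own, which replaces `g_n(Y_n)` by the number `m_n = μ(g_n)`. Expanding squares, the
sum of squared increments up to block `N` equals `V_N + φ² - ψ + ∑ τ_j m_j`, the last three terms
taken at the index `n_(N)`, where `V` is a martingale. Its increments are bounded in `L^s` with `s =
1 + p/q`, and such a martingale satisfies `V_N / N → 0`. The terms `φ²` and `ψ` are `o(N)` because
their `s`-th moments are bounded. What remains is the weighted average of the `m_j`
(`ae_tendsto_average_sq_increments`).

The limit of `m_n`. Up to a vanishing term, `m_n` is `2 μ(F φ_n) = 2 ∑_{i≥n} τ_i μ(F Q_{n,i} F)`.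
Replacing `Q_{n,i}` by `P_{t_i - t_n}` costs `τ_i^{γα}` per term, and passing from the Riemann sum
to the integral costs `τ_i^{l'γ}` per unit of time. Both errors have vanishing tails, so `m_n → 2
∫₀^∞ μ(F P_t F) dt`, which is the radicand by Fubini (`tendsto_integral_mul_tailSum`). The radicand
is nonnegative because it is a limit of averages of squares.

Mixing. The correctors exist because `Q_{k,i} G - μ(G)` is small uniformly in `k`. Attractiveness of
`Y` brings `Q_{k,i} G(y)` close to `∫ Q_{k,i} G dμ`, the strong error compares this with `∫ P_t G
dμ`, and invariance makes the latter `μ(G)` (`exists_mixingBound`). Each corrector costs growth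
exponent, and the inequalities on the exponents pay for two of them. The measure `μ` is the weak
limit of the laws of `X_k^x`. Its moments up to order `r` come from `X`, and those up to order `q`
from the scheme. -/

theorem tendsto_sum_div_of_tendsto_sum_div {d : ℕ → ℝ} {w : ℝ}
    (h : Tendsto (fun N => ∑ k ∈ Finset.range N, ((k : ℝ) + 1)⁻¹ * d k) atTop (𝓝 w)) :
    Tendsto (fun N : ℕ => (N : ℝ)⁻¹ * ∑ k ∈ Finset.range N, d k) atTop (𝓝 0) := by
  set S : ℕ → ℝ := fun N => ∑ k ∈ Finset.range N, ((k : ℝ) + 1)⁻¹ * d k with hS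
  -- Abel summation. After division by `N` this is `S N` minus the Cesàro mean of `S`, and both tend
  -- to `w`.
  have key : ∀ N : ℕ, ∑ k ∈ Finset.range N, d k = N * S N - ∑ k ∈ Finset.range N, S k := by
    intro N
    induction N with
    | zero => simp
    | succ N ih =>
      rw [Finset.sum_range_succ, ih, Finset.sum_range_succ _ N]
      have h1 : S (N + 1) = S N + ((N : ℝ) + 1)⁻¹ * d N := by
        simp only [hS, Finset.sum_range_succ]
      have h2 : ((N : ℝ) + 1) ≠ 0 := by positivity
      rw [h1]
      push_cast
      field_simp
      ring
  have h3 : Tendsto (fun N : ℕ => S N - (N : ℝ)⁻¹ * ∑ k ∈ Finset.range N, S k) atTop (𝓝 0) := by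
    simpa using h.sub h.cesaro
  refine h3.congr' ?_
  filter_upwards [eventually_gt_atTop 0] with N hN
  have : (N : ℝ) ≠ 0 := by exact_mod_cast hN.ne'
  rw [key]
  field_simp

/-- Up to the factor `s` this is the derivative of `|x|^s`. For arguments of equal sign, Hölder
continuity is subadditivity of `t ↦ t^(s-1)`. For opposite signs each modulus is at most `|x - y|`,
which produces the factor 2. -/
theorem abs_abs_rpow_mul_self_sub_le {s : ℝ} (h1 : 1 < s) (h2 : s ≤ 2) (x y : ℝ) :
    |(|x| ^ (s - 2) * x) - |y| ^ (s - 2) * y| ≤ 2 * |x - y| ^ (s - 1) := by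
  have hpos : ∀ x : ℝ, 0 ≤ x → |x| ^ (s - 2) * x = x ^ (s - 1) := by
    intro x hx
    rcases hx.eq_or_lt with rfl | hx
    · simp [Real.zero_rpow (by linarith : s - 1 ≠ 0)]
    · rw [abs_of_pos hx, ← Real.rpow_add_one hx.ne']
      congr 1
      ring
  have hneg : ∀ x : ℝ, x ≤ 0 → |x| ^ (s - 2) * x = -((-x) ^ (s - 1)) := by
    intro x hx
    have := hpos (-x) (by linarith)
    rw [abs_neg] at this
    linarith
  have hsub : ∀ x y : ℝ, 0 ≤ y → y ≤ x → x ^ (s - 1) - y ^ (s - 1) ≤ (x - y) ^ (s - 1) := by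
    intro x y hy hyx
    have := Real.rpow_add_le_add_rpow hy (sub_nonneg.2 hyx) (by linarith : 0 ≤ s - 1)
      (by linarith : s - 1 ≤ 1)
    rw [add_sub_cancel] at this
    linarith
  have hmono : ∀ x y : ℝ, 0 ≤ y → y ≤ x → y ^ (s - 1) ≤ x ^ (s - 1) := fun x y hy hyx =>
    Real.rpow_le_rpow hy hyx (by linarith)
  have hnn : ∀ x : ℝ, 0 ≤ x → 0 ≤ x ^ (s - 1) := fun x hx => Real.rpow_nonneg hx _
  wlog hxy : y ≤ x generalizing x y
  · rw [abs_sub_comm, abs_sub_comm x y]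
    exact this y x (le_of_not_ge hxy)
  rw [abs_of_nonneg (sub_nonneg.2 hxy)]
  have hd := hnn (x - y) (sub_nonneg.2 hxy)
  rcases le_total 0 y with hy | hy
  · rw [hpos y hy, hpos x (hy.trans hxy), abs_of_nonneg (sub_nonneg.2 (hmono _ _ hy hxy))]
    linarith [hsub x y hy hxy]
  · rcases le_total 0 x with hx | hx
    · rw [hpos x hx, hneg y hy, abs_of_nonneg (by linarith [hnn x hx, hnn (-y) (by linarith)])]
      linarith [hmono (x - y) x hx (by linarith), hmono (x - y) (-y) (by linarith) (by linarith)]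
    · rw [hneg x hx, hneg y hy,
        abs_of_nonneg (by linarith [hmono (-y) (-x) (by linarith) (by linarith)])]
      have := hsub (-y) (-x) (by linarith) (by linarith)
      rw [show -y - -x = x - y by ring] at this
      linarith

/-- First-order expansion with the remainder controlled by the Hölder bound on the derivative. It
plays the role of `(a + b)² = a² + 2ab + b²`: for a martingale increment `b` the middle term has
mean zero. -/
theorem abs_add_rpow_le {s : ℝ} (h1 : 1 < s) (h2 : s ≤ 2) (a b : ℝ) :
    |a + b| ^ s ≤ |a| ^ s + s * ((|a| ^ (s - 2) * a) * b) + 2 * s * |b| ^ s := by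
  have hder : ∀ θ : ℝ, HasDerivAt (fun θ : ℝ => |a + θ * b| ^ s)
      (s * |a + θ * b| ^ (s - 2) * (a + θ * b) * b) θ := by
    intro θ
    have hlin : HasDerivAt (fun θ : ℝ => a + θ * b) b θ := by
      simpa using ((hasDerivAt_id θ).mul_const b).const_add a
    exact (hasDerivAt_abs_rpow (a + θ * b) h1).comp θ hlin
  obtain ⟨θ, hθ, hslope⟩ := exists_hasDerivAt_eq_slope (fun θ : ℝ => |a + θ * b| ^ s)
    (fun θ => s * |a + θ * b| ^ (s - 2) * (a + θ * b) * b) zero_lt_one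
    (fun θ _ => (hder θ).continuousAt.continuousWithinAt) (fun θ _ => hder θ)
  simp only [one_mul, zero_mul, add_zero, sub_zero, div_one] at hslope
  have hH := abs_abs_rpow_mul_self_sub_le h1 h2 (a + θ * b) a
  rw [add_sub_cancel_left] at hH
  have hθb : |θ * b| ^ (s - 1) ≤ |b| ^ (s - 1) := by
    refine Real.rpow_le_rpow (abs_nonneg _) ?_ (by linarith)
    rw [abs_mul, abs_of_pos hθ.1]
    nlinarith [abs_nonneg b, hθ.2]
  have hb : |b| ^ (s - 1) * |b| = |b| ^ s := by
    rcases (abs_nonneg b).eq_or_lt with h | h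
    · rw [← h, Real.zero_rpow (by linarith), Real.zero_rpow (by linarith)]; simp
    · rw [← Real.rpow_add_one h.ne']; congr 1; ring
  have h3 : (|a + θ * b| ^ (s - 2) * (a + θ * b) - |a| ^ (s - 2) * a) * b ≤ 2 * |b| ^ s := by
    calc _ ≤ |(|a + θ * b| ^ (s - 2) * (a + θ * b) - |a| ^ (s - 2) * a) * b| := le_abs_self _
      _ = |(|a + θ * b| ^ (s - 2) * (a + θ * b) - |a| ^ (s - 2) * a)| * |b| := abs_mul _ _
      _ ≤ (2 * |b| ^ (s - 1)) * |b| := by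
        gcongr
        linarith
      _ = 2 * |b| ^ s := by rw [mul_assoc, hb]
  nlinarith [mul_le_mul_of_nonneg_left h3 (by linarith : 0 ≤ s)]

theorem abs_rpow_mul_le {s : ℝ} (h1 : 1 < s) (a b : ℝ) :
    |(|a| ^ (s - 2) * a) * b| ≤ |a| ^ s + |b| ^ s := by
  have h0 : |(|a| ^ (s - 2) * a)| = |a| ^ (s - 1) := by
    rw [abs_mul, abs_of_nonneg (Real.rpow_nonneg (abs_nonneg a) _)]
    rcases (abs_nonneg a).eq_or_lt with h | h
    · rw [← h, Real.zero_rpow (by linarith : s - 1 ≠ 0), mul_zero]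
    · rw [← Real.rpow_add_one h.ne']; congr 1; ring
  have hmul : ∀ x : ℝ, 0 ≤ x → x ^ (s - 1) * x = x ^ s := by
    intro x hx
    rcases hx.eq_or_lt with rfl | h
    · rw [Real.zero_rpow (by linarith : s ≠ 0), mul_zero]
    · rw [← Real.rpow_add_one h.ne']; congr 1; ring
  rw [abs_mul, h0]
  have ha := abs_nonneg a
  have hb := abs_nonneg b
  rcases le_total |a| |b| with h | h
  · calc |a| ^ (s - 1) * |b| ≤ |b| ^ (s - 1) * |b| := by
          gcongr
      _ = |b| ^ s := hmul _ hb
      _ ≤ _ := by linarith [Real.rpow_nonneg ha s]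
  · calc |a| ^ (s - 1) * |b| ≤ |a| ^ (s - 1) * |a| := by gcongr
      _ = |a| ^ s := hmul _ ha
      _ ≤ _ := by linarith [Real.rpow_nonneg hb s]

variable {Ω : Type*} {mΩ : MeasurableSpace Ω} {P : Measure Ω} [IsProbabilityMeasure P]

/-- The weighted sums `S_N = ∑ d_k / (k+1)` of the increments form a martingale bounded in `L^s`,
since `∑ k^(-s)` converges. Doob's theorem gives almost sure convergence of `S`, and Kronecker's
lemma turns this into `V_N / N → 0`. Using `s` close to 1 matters later, where second moments of the
increments may be missing. -/
theorem ae_tendsto_div_of_martingale {𝒢 : Filtration ℕ mΩ} {V : ℕ → Ω → ℝ}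
    (hV : Martingale V 𝒢 P) {s : ℝ} (h1 : 1 < s) (h2 : s ≤ 2) {C : ℝ}
    (hint : ∀ n, Integrable (fun ω => |V (n + 1) ω - V n ω| ^ s) P)
    (hC : ∀ n, ∫ ω, |V (n + 1) ω - V n ω| ^ s ∂P ≤ C) :
    ∀ᵐ ω ∂P, Tendsto (fun N : ℕ => (N : ℝ)⁻¹ * V N ω) atTop (𝓝 0) := by
  set d : ℕ → Ω → ℝ := fun n ω => V (n + 1) ω - V n ω with hd
  set S : ℕ → Ω → ℝ := fun N ω => ∑ k ∈ Finset.range N, ((k : ℝ) + 1)⁻¹ * d k ω with hS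
  have hSsucc : ∀ N ω, S (N + 1) ω = S N ω + ((N : ℝ) + 1)⁻¹ * d N ω := fun N ω => by
    simp only [hS, Finset.sum_range_succ]
  have hdm : ∀ n, StronglyMeasurable[𝒢 (n + 1)] (d n) := fun n =>
    (hV.stronglyMeasurable (n + 1)).sub ((hV.stronglyMeasurable n).mono (𝒢.mono n.le_succ))
  have hdi : ∀ n, Integrable (d n) P := fun n => (hV.integrable _).sub (hV.integrable _)
  have hd0 : ∀ n, P[d n | 𝒢 n] =ᵐ[P] 0 := by
    intro n
    have e1 := condExp_sub (hV.integrable (n + 1)) (hV.integrable n) (𝒢 n)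
    filter_upwards [e1, hV.condExp_ae_eq n.le_succ, hV.condExp_ae_eq (le_refl n)] with ω ha hb hc
    have : (P[d n | 𝒢 n]) ω = (P[V (n + 1) | 𝒢 n] - P[V n | 𝒢 n]) ω := ha
    rw [this, Pi.sub_apply, hb, hc]
    simp
  have hSm : StronglyAdapted 𝒢 S := by
    intro N
    refine Finset.stronglyMeasurable_fun_sum _ fun k hk => ?_
    exact ((hdm k).mono (𝒢.mono (Finset.mem_range.1 hk))).const_mul _
  have hSi : ∀ N, Integrable (S N) P := fun N =>
    integrable_finsetSum _ fun k _ => (hdi k).const_mul _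
  have hSmart : Martingale S 𝒢 P := by
    refine martingale_nat hSm hSi fun N => ?_
    have e1 : S (N + 1) = S N + ((N : ℝ) + 1)⁻¹ • d N := by
      ext ω; simp [hSsucc]
    rw [e1]
    have e2 := condExp_add (hSi N) ((hdi N).smul ((N : ℝ) + 1)⁻¹) (𝒢 N)
    have e3 := condExp_smul (μ := P) ((N : ℝ) + 1)⁻¹ (d N) (𝒢 N)
    rw [condExp_of_stronglyMeasurable (𝒢.le N) (hSm N) (hSi N)] at e2
    filter_upwards [e2, e3, hd0 N] with ω ha hb hc
    rw [ha, Pi.add_apply, hb, Pi.smul_apply, hc]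
    simp
  have hSmeas : ∀ N, AEStronglyMeasurable (S N) P := fun N => (hSi N).1
  have hcross : ∀ N, Integrable (fun ω => (|S N ω| ^ (s - 2) * S N ω) * d N ω) P →
      ∫ ω, (|S N ω| ^ (s - 2) * S N ω) * d N ω ∂P = 0 := by
    intro N hi
    have hm : StronglyMeasurable[𝒢 N] fun ω => |S N ω| ^ (s - 2) * S N ω := by
      have hm' : Measurable[𝒢 N] (S N) := (hSm N).measurable
      have : Measurable[𝒢 N] fun ω => |S N ω| ^ (s - 2) * S N ω :=
        (Measurable.pow_const (by fun_prop) _).mul hm'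
      exact this.stronglyMeasurable
    have e := condExp_mul_of_stronglyMeasurable_left (μ := P) hm hi (hdi N)
    rw [← integral_condExp (𝒢.le N)]
    refine integral_eq_zero_of_ae ?_
    filter_upwards [e, hd0 N] with ω ha hb
    have : (P[fun ω => (|S N ω| ^ (s - 2) * S N ω) * d N ω | 𝒢 N]) ω
      = (|S N ω| ^ (s - 2) * S N ω) * (P[d N | 𝒢 N]) ω := ha
    rw [this, hb]
    simp
  -- Inequality of von Bahr–Esseen type. Integrability of `|S N|^s` is carried through the induction
  -- because it is what makes the cross term integrable, hence of mean zero.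
  have hbound : ∀ N, Integrable (fun ω => |S N ω| ^ s) P ∧
      ∫ ω, |S N ω| ^ s ∂P ≤ 2 * s * C * ∑ k ∈ Finset.range N, (((k : ℝ) + 1)⁻¹) ^ s := by
    intro N
    induction N with
    | zero => simp [hS, Real.zero_rpow (by linarith : s ≠ 0)]
    | succ N ih =>
      obtain ⟨ih1, ih2⟩ := ih
      set c : ℝ := ((N : ℝ) + 1)⁻¹ with hc
      have hcpos : 0 < c := by positivity
      have hcr : Integrable (fun ω => (|S N ω| ^ (s - 2) * S N ω) * d N ω) P := by
        refine (ih1.add (hint N)).mono' ?_ (ae_of_all _ fun ω => abs_rpow_mul_le h1 _ _)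
        exact ((((hSmeas N).aemeasurable.abs.pow_const _).mul
          (hSmeas N).aemeasurable).mul (hdi N).1.aemeasurable).aestronglyMeasurable
      have hpt : ∀ ω, |S (N + 1) ω| ^ s ≤ |S N ω| ^ s +
          s * c * ((|S N ω| ^ (s - 2) * S N ω) * d N ω) + 2 * s * c ^ s * |d N ω| ^ s := by
        intro ω
        rw [hSsucc]
        refine (abs_add_rpow_le h1 h2 _ _).trans (le_of_eq ?_)
        rw [abs_mul, abs_of_pos hcpos, Real.mul_rpow hcpos.le (abs_nonneg _)]
        ring
      have hRi : Integrable (fun ω => |S N ω| ^ s +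
          s * c * ((|S N ω| ^ (s - 2) * S N ω) * d N ω) + 2 * s * c ^ s * |d N ω| ^ s) P :=
        (ih1.add (hcr.const_mul _)).add ((hint N).const_mul _)
      have hi1 : Integrable (fun ω => |S (N + 1) ω| ^ s) P := by
        refine hRi.mono' ?_ (ae_of_all _ fun ω => ?_)
        · exact ((hSmeas (N + 1)).aemeasurable.abs.pow_const _).aestronglyMeasurable
        · rw [Real.norm_of_nonneg (Real.rpow_nonneg (abs_nonneg _) _)]
          exact hpt ω
      refine ⟨hi1, ?_⟩
      calc ∫ ω, |S (N + 1) ω| ^ s ∂P ≤ ∫ ω, (|S N ω| ^ s +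
          s * c * ((|S N ω| ^ (s - 2) * S N ω) * d N ω) + 2 * s * c ^ s * |d N ω| ^ s) ∂P :=
            integral_mono hi1 hRi hpt
        _ = ∫ ω, |S N ω| ^ s ∂P + 2 * s * c ^ s * ∫ ω, |d N ω| ^ s ∂P := by
            have i1 : Integrable (fun ω => |S N ω| ^ s +
              s * c * ((|S N ω| ^ (s - 2) * S N ω) * d N ω)) P := ih1.add (hcr.const_mul _)
            have i2 : Integrable (fun ω => 2 * s * c ^ s * |d N ω| ^ s) P :=
              (hint N).const_mul _
            rw [integral_add i1 i2, integral_add ih1 (hcr.const_mul _), integral_const_mul,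
              integral_const_mul, hcross N hcr]
            ring
        _ ≤ _ := by
            rw [Finset.sum_range_succ, mul_add]
            have hcs : 0 ≤ 2 * s * c ^ s := by positivity
            have := mul_le_mul_of_nonneg_left (hC N) hcs
            simp only [hd] at *
            nlinarith
  have hsum : Summable fun k : ℕ => (((k : ℝ) + 1)⁻¹) ^ s := by
    have h := (summable_nat_add_iff 1).2 (Real.summable_nat_rpow_inv.2 h1)
    refine h.congr fun k => ?_
    push_cast
    rw [Real.inv_rpow (by positivity)]
  have hC0 : 0 ≤ C := (integral_nonneg fun ω => Real.rpow_nonneg (abs_nonneg _) _).trans (hC 0)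
  set R : ℝ := 1 + 2 * s * C * ∑' k : ℕ, (((k : ℝ) + 1)⁻¹) ^ s with hR
  have hL1 : ∀ N, eLpNorm (S N) 1 P ≤ (R.toNNReal : ℝ≥0∞) := by
    intro N
    obtain ⟨hi, hb⟩ := hbound N
    rw [eLpNorm_one_eq_lintegral_enorm, ← ofReal_integral_norm_eq_lintegral_enorm (hSi N)]
    refine ENNReal.ofReal_le_ofReal ?_
    calc ∫ ω, ‖S N ω‖ ∂P ≤ ∫ ω, (1 + |S N ω| ^ s) ∂P := by
          refine integral_mono (hSi N).norm ((integrable_const 1).add hi) fun ω => ?_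
          simp only [Real.norm_eq_abs]
          rcases le_total |S N ω| 1 with h | h
          · linarith [Real.rpow_nonneg (abs_nonneg (S N ω)) s]
          · linarith [Real.self_le_rpow_of_one_le h h1.le]
      _ = 1 + ∫ ω, |S N ω| ^ s ∂P := by
          rw [integral_add (integrable_const 1) hi]; simp
      _ ≤ R := by
          have := hsum.sum_le_tsum (Finset.range N) fun k _ => by positivity
          have h3 : 0 ≤ 2 * s * C := by positivity
          have := mul_le_mul_of_nonneg_left this h3
          linarith
  filter_upwards [hSmart.submartingale.exists_ae_tendsto_of_bdd hL1] with ω ⟨w, hw⟩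
  have h3 := tendsto_sum_div_of_tendsto_sum_div hw
  have h4 : Tendsto (fun N : ℕ => (N : ℝ)⁻¹ * V 0 ω) atTop (𝓝 0) := by
    simpa using tendsto_inv_atTop_nhds_zero_nat.mul_const (V 0 ω)
  have h5 := h3.add h4
  rw [add_zero] at h5
  refine h5.congr fun N => ?_
  rw [Finset.sum_range_sub (fun n => V n ω) N]
  ring

end MartingaleSLLN

/-! ### Quadratic variation of a martingale given by a corrector -/

section GridLemmas

variable {τ : ℕ → ℝ≥0}

theorem grid_succ (τ : ℕ → ℝ≥0) (n : ℕ) : grid τ (n + 1) = grid τ n + τ (n + 1) := by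
  simp [grid, Finset.sum_range_succ]

theorem grid_mono (τ : ℕ → ℝ≥0) : Monotone (grid τ) :=
  monotone_nat_of_le_succ fun n => by simp [grid_succ]

theorem coarseIndex_mono (hτ : IsStepSequence τ) : Monotone (coarseIndex τ) := by
  intro k k' h
  by_contra hlt
  have h1 := grid_mono τ (Nat.succ_le_of_lt (not_le.1 hlt))
  have h2 := (coarseIndex_spec hτ k').2
  have h3 := (coarseIndex_spec hτ k).1
  have h4 : (k : ℝ≥0) ≤ k' := by exact_mod_cast h
  exact absurd (h2.trans_le (h1.trans (h3.trans h4))) (lt_irrefl _)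

theorem tendsto_coarseIndex (hτ : IsStepSequence τ) : Tendsto (coarseIndex τ) atTop atTop := by
  refine tendsto_atTop_mono' atTop (f₁ := fun k => coarseIndex τ k) (Eventually.of_forall
    fun k => le_rfl) ?_
  refine (coarseIndex_mono hτ).tendsto_atTop_atTop fun n => ?_
  obtain ⟨k, hk⟩ := exists_nat_ge (grid τ n)
  refine ⟨k, ?_⟩
  by_contra hlt
  have h1 := grid_mono τ (Nat.succ_le_of_lt (not_le.1 hlt))
  exact absurd ((coarseIndex_spec hτ k).2.trans_le (h1.trans hk)) (lt_irrefl _)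

theorem exists_step_le (hτ : IsStepSequence τ) : ∃ T : ℝ, 0 ≤ T ∧ ∀ n, (τ n : ℝ) ≤ T := by
  obtain ⟨T, hT⟩ := (NNReal.tendsto_coe.2 hτ.tendsto_zero).bddAbove_range
  exact ⟨T, (NNReal.coe_nonneg _).trans (hT ⟨0, rfl⟩), fun n => hT ⟨n, rfl⟩⟩

theorem sum_range_step (τ : ℕ → ℝ≥0) (n : ℕ) :
    ∑ j ∈ Finset.range n, (τ j : ℝ) = grid τ n - τ n := by
  simp [grid, Finset.sum_range_succ]

theorem tendsto_coarseGrid_div (hτ : IsStepSequence τ) :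
    Tendsto (fun N : ℕ => (N : ℝ)⁻¹ * (coarseGrid τ N : ℝ)) atTop (𝓝 1) := by
  have h0 : Tendsto (fun N : ℕ => (τ (coarseIndex τ N + 1) : ℝ)) atTop (𝓝 0) :=
    NNReal.tendsto_coe.2 (hτ.tendsto_zero.comp
      ((tendsto_add_atTop_nat 1).comp (tendsto_coarseIndex hτ)))
  have h1 : Tendsto (fun N : ℕ => 1 - (N : ℝ)⁻¹ * (τ (coarseIndex τ N + 1) : ℝ)) atTop (𝓝 1) := by
    simpa using (tendsto_inv_atTop_nhds_zero_nat (𝕜 := ℝ)).mul h0 |>.const_sub 1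
  refine tendsto_of_tendsto_of_tendsto_of_le_of_le' h1 tendsto_const_nhds ?_ ?_
  · filter_upwards [eventually_gt_atTop 0] with N hN
    have h2 := (coarseIndex_spec hτ N).2
    rw [grid_succ, ← NNReal.coe_lt_coe] at h2
    push_cast at h2
    have h3 : (0 : ℝ) < N := by exact_mod_cast hN
    have h4 : (N : ℝ)⁻¹ * N ≤ (N : ℝ)⁻¹ * (grid τ (coarseIndex τ N) + τ (coarseIndex τ N + 1)) := by
      gcongr
    rw [inv_mul_cancel₀ h3.ne', mul_add] at h4
    simp only [coarseGrid]
    linarith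
  · filter_upwards [eventually_gt_atTop 0] with N hN
    have h2 := (coarseIndex_spec hτ N).1
    rw [← NNReal.coe_le_coe] at h2
    push_cast at h2
    have h3 : (0 : ℝ) < N := by exact_mod_cast hN
    rw [inv_mul_le_iff₀ h3, mul_one]
    exact h2

/-- The endpoints satisfy `t ≤ N + 1` on the right and `t > N - τ` on the left. One `T` covers this
overshoot, the other the shift in `sum_range_step`, whose sum stops one step early. -/
theorem sum_Ico_coarseIndex_le (hτ : IsStepSequence τ) {T : ℝ} (hT : ∀ n, (τ n : ℝ) ≤ T) (N : ℕ) :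
    ∑ j ∈ Finset.Ico (coarseIndex τ N) (coarseIndex τ (N + 1)), (τ j : ℝ) ≤ 1 + 2 * T := by
  rw [Finset.sum_Ico_eq_sub _ (coarseIndex_mono hτ N.le_succ), sum_range_step, sum_range_step]
  have h1 := (coarseIndex_spec hτ (N + 1)).1
  have h2 := (coarseIndex_spec hτ N).2
  rw [grid_succ] at h2
  rw [← NNReal.coe_le_coe] at h1
  rw [← NNReal.coe_lt_coe] at h2
  push_cast at h1 h2
  have h3 := hT (coarseIndex τ N)
  have h4 := hT (coarseIndex τ N + 1)
  have h5 := (τ (coarseIndex τ (N + 1))).coe_nonneg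
  linarith

/-- Toeplitz averaging: the weights `τ_j` have divergent sum, and the sum over the first
`coarseIndex τ N` of them is asymptotic to `N`. -/
theorem tendsto_weighted_average (hτ : IsStepSequence τ) {m : ℕ → ℝ} {L : ℝ}
    (hm : Tendsto m atTop (𝓝 L)) :
    Tendsto (fun N : ℕ => (N : ℝ)⁻¹ * ∑ j ∈ Finset.range (coarseIndex τ N), (τ j : ℝ) * m j)
      atTop (𝓝 L) := by
  have hsum : Tendsto (fun n => ∑ j ∈ Finset.range n, (τ j : ℝ)) atTop atTop := by
    have h1 : Tendsto (fun n => (grid τ n : ℝ) + -(τ n : ℝ)) atTop atTop :=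
      (NNReal.tendsto_coe_atTop.2 hτ.tendsto_grid).atTop_add
        (NNReal.tendsto_coe.2 hτ.tendsto_zero).neg
    refine h1.congr fun n => ?_
    rw [sum_range_step]; ring
  have h2 : (fun j => (τ j : ℝ) * (m j - L)) =o[atTop] fun j => (τ j : ℝ) := by
    have h3 : (fun j => m j - L) =o[atTop] fun _ : ℕ => (1 : ℝ) := by
      rw [Asymptotics.isLittleO_one_iff]
      simpa using hm.sub_const L
    simpa using (Asymptotics.isBigO_refl (fun j => (τ j : ℝ)) atTop).mul_isLittleO h3
  have h3 := (h2.sum_range (fun j => (τ j).coe_nonneg) hsum).comp_tendsto (tendsto_coarseIndex hτ)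
  have h4 : Tendsto (fun N : ℕ => (N : ℝ)⁻¹ * ∑ j ∈ Finset.range (coarseIndex τ N), (τ j : ℝ))
      atTop (𝓝 1) := by
    have h5 : Tendsto (fun N : ℕ => (τ (coarseIndex τ N) : ℝ)) atTop (𝓝 0) :=
      NNReal.tendsto_coe.2 (hτ.tendsto_zero.comp (tendsto_coarseIndex hτ))
    have h6 := (tendsto_coarseGrid_div hτ).sub
      ((tendsto_inv_atTop_nhds_zero_nat (𝕜 := ℝ)).mul h5)
    simp only [mul_zero, sub_zero] at h6
    refine h6.congr fun N => ?_
    rw [sum_range_step, coarseGrid]; ring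
  have h5 : Tendsto (fun N : ℕ => (N : ℝ)⁻¹ *
      ∑ j ∈ Finset.range (coarseIndex τ N), (τ j : ℝ) * (m j - L)) atTop (𝓝 0) := by
    have h6 : (fun N : ℕ => (N : ℝ)⁻¹ *
        ∑ j ∈ Finset.range (coarseIndex τ N), (τ j : ℝ) * (m j - L)) =o[atTop]
        fun N : ℕ => (N : ℝ)⁻¹ * ∑ j ∈ Finset.range (coarseIndex τ N), (τ j : ℝ) :=
      (Asymptotics.isBigO_refl (fun N : ℕ => (N : ℝ)⁻¹) atTop).mul_isLittleO h3
    exact (Asymptotics.isLittleO_one_iff ℝ).1 (h6.trans_isBigO (h4.isBigO_one ℝ))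
  have h6 := h5.add (h4.mul_const L)
  rw [zero_add, one_mul] at h6
  refine h6.congr fun N => ?_
  rw [mul_assoc, ← mul_add, Finset.sum_mul, ← Finset.sum_add_distrib]
  congr 1
  exact Finset.sum_congr rfl fun j _ => by ring

end GridLemmas

section QuadraticVariation

variable {Ω : Type*} {mΩ : MeasurableSpace Ω} {P : Measure Ω} [IsProbabilityMeasure P]

/-- `∑_{j<n} τ_j a_j + b_n`, a martingale when `b` is a corrector for `a`. -/
def accum (τ : ℕ → ℝ) (a b : ℕ → Ω → ℝ) (n : ℕ) (ω : Ω) : ℝ :=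
  ∑ j ∈ Finset.range n, τ j * a j ω + b n ω

variable {𝓕 : Filtration ℕ mΩ} {τ : ℕ → ℝ} {a b h : ℕ → Ω → ℝ} {m : ℕ → ℝ}

theorem stronglyMeasurable_sum_range (ha : StronglyAdapted 𝓕 a) (n k : ℕ) (hk : n ≤ k + 1) :
    StronglyMeasurable[𝓕 k] fun ω => ∑ j ∈ Finset.range n, τ j * a j ω :=
  Finset.stronglyMeasurable_fun_sum _ fun j hj => ((ha j).mono (𝓕.mono (by
    have := Finset.mem_range.1 hj; omega))).const_mul _

theorem memLp_accum (ha2 : ∀ n, MemLp (a n) 2 P) (hb2 : ∀ n, MemLp (b n) 2 P) (n : ℕ) :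
    MemLp (accum τ a b n) 2 P :=
  (memLp_finsetSum _ fun j _ => (ha2 j).const_mul (τ j)).add (hb2 n)

theorem condExp_add_of_stronglyMeasurable {𝒢 : MeasurableSpace Ω} (h𝒢 : 𝒢 ≤ mΩ) {c B B' : Ω → ℝ}
    (hc : StronglyMeasurable[𝒢] c) (hci : Integrable c P) (hB : Integrable B P)
    (hB' : P[B | 𝒢] =ᵐ[P] B') :
    P[fun ω => c ω + B ω | 𝒢] =ᵐ[P] fun ω => c ω + B' ω := by
  have e := condExp_add (m := 𝒢) hci hB
  rw [condExp_of_stronglyMeasurable h𝒢 hc hci] at e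
  filter_upwards [e, hB'] with ω h1 h2
  have : (P[fun ω => c ω + B ω | 𝒢]) ω = (P[c + B | 𝒢]) ω := rfl
  rw [this, h1, Pi.add_apply, h2]

theorem martingale_accum (ha : StronglyAdapted 𝓕 a) (hb : StronglyAdapted 𝓕 b)
    (ha2 : ∀ n, MemLp (a n) 2 P) (hb2 : ∀ n, MemLp (b n) 2 P)
    (hab : ∀ n, P[b (n + 1) | 𝓕 n] =ᵐ[P] fun ω => b n ω - τ n * a n ω) :
    Martingale (accum τ a b) 𝓕 P := by
  have hi : ∀ n, Integrable (accum τ a b n) P := fun n =>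
    (memLp_accum ha2 hb2 n).integrable one_le_two
  refine martingale_nat (fun n => ?_) hi fun n => ?_
  · exact (stronglyMeasurable_sum_range ha n n n.le_succ).add (hb n)
  · have e := condExp_add_of_stronglyMeasurable (P := P) (𝓕.le n)
      (stronglyMeasurable_sum_range (τ := τ) ha (n + 1) n le_rfl)
      (integrable_finsetSum _ fun j _ => ((ha2 j).integrable one_le_two).const_mul _)
      ((hb2 (n + 1)).integrable one_le_two) (hab n)
    refine (e.trans (ae_of_all _ fun ω => ?_)).symm
    simp only [accum, Finset.sum_range_succ]
    ring

/-- With `c = ∑_{j≤n} τ_j a_j`, which is known at time `n`, one has `M_{n+1}² - b_{n+1}² = c² + 2 c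
b_{n+1}`. Subtracting `b²` thus leaves an expression linear in `b_{n+1}`, whose conditional
expectation is known, and the drift is `τ_n (2 a_n b_n - τ_n a_n²)`. The process `h` exchanges this
drift for the deterministic `τ_n m_n`. -/
theorem martingale_accum_sq (ha : StronglyAdapted 𝓕 a) (hb : StronglyAdapted 𝓕 b)
    (hh : StronglyAdapted 𝓕 h)
    (ha2 : ∀ n, MemLp (a n) 2 P) (hb2 : ∀ n, MemLp (b n) 2 P) (hhi : ∀ n, Integrable (h n) P)
    (hab : ∀ n, P[b (n + 1) | 𝓕 n] =ᵐ[P] fun ω => b n ω - τ n * a n ω)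
    (hhm : ∀ n, P[h (n + 1) | 𝓕 n] =ᵐ[P] fun ω =>
      h n ω - τ n * (2 * a n ω * b n ω - τ n * a n ω ^ 2 - m n)) :
    Martingale (fun n ω => accum τ a b n ω ^ 2 - b n ω ^ 2 + h n ω -
      ∑ j ∈ Finset.range n, τ j * m j) 𝓕 P := by
  have hM := martingale_accum ha hb ha2 hb2 hab
  refine martingale_nat (fun n => ?_) (fun n => ?_) fun n => ?_
  · exact ((((hM.stronglyMeasurable n).pow 2).sub ((hb n).pow 2)).add (hh n)).sub
      stronglyMeasurable_const
  · exact (((memLp_accum ha2 hb2 n).integrable_sq.sub (hb2 n).integrable_sq).add (hhi n)).sub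
      (integrable_const _)
  · set c : Ω → ℝ := fun ω => ∑ j ∈ Finset.range (n + 1), τ j * a j ω with hc
    have hcm : StronglyMeasurable[𝓕 n] c := stronglyMeasurable_sum_range ha (n + 1) n le_rfl
    have hc2 : MemLp c 2 P := memLp_finsetSum _ fun j _ => (ha2 j).const_mul (τ j)
    have hcb : Integrable ((fun ω => 2 * c ω) * b (n + 1)) P :=
      (hc2.const_mul 2).integrable_mul (hb2 (n + 1))
    have e1 := condExp_mul_of_stronglyMeasurable_left (hcm.const_mul 2) hcb
      ((hb2 (n + 1)).integrable one_le_two)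
    have e2 := condExp_add (m := 𝓕 n) hcb (hhi (n + 1))
    have e3 : P[(fun ω => 2 * c ω) * b (n + 1) + h (n + 1) | 𝓕 n] =ᵐ[P] fun ω =>
        2 * c ω * (b n ω - τ n * a n ω) +
        (h n ω - τ n * (2 * a n ω * b n ω - τ n * a n ω ^ 2 - m n)) := by
      filter_upwards [e1, e2, hab n, hhm n] with ω h1 h2 h3 h4
      rw [h2, Pi.add_apply, h1, Pi.mul_apply, h3, h4]
    have e4 := condExp_add_of_stronglyMeasurable (P := P) (𝓕.le n)
      (c := fun ω => c ω ^ 2 - ∑ j ∈ Finset.range (n + 1), τ j * m j)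
      ((hcm.pow 2).sub stronglyMeasurable_const) (hc2.integrable_sq.sub (integrable_const _))
      (hcb.add (hhi (n + 1))) e3
    have e5 : (fun ω => accum τ a b (n + 1) ω ^ 2 - b (n + 1) ω ^ 2 + h (n + 1) ω -
        ∑ j ∈ Finset.range (n + 1), τ j * m j) = fun ω =>
        (c ω ^ 2 - ∑ j ∈ Finset.range (n + 1), τ j * m j) +
        ((fun ω => 2 * c ω) * b (n + 1) + h (n + 1)) ω := by
      funext ω
      simp only [accum, Pi.add_apply, Pi.mul_apply]
      change (c ω + b (n + 1) ω) ^ 2 - _ + _ - _ = _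
      ring
    rw [e5]
    refine (e4.trans (ae_of_all _ fun ω => ?_)).symm
    simp only [hc, accum, Finset.sum_range_succ]
    ring

/-- A filtration observed along a monotone sequence of indices. -/
def subFiltration (𝓕 : Filtration ℕ mΩ) {σ : ℕ → ℕ} (hσ : Monotone σ) : Filtration ℕ mΩ where
  seq N := 𝓕 (σ N)
  mono' _ _ hij := 𝓕.mono (hσ hij)
  le' N := 𝓕.le (σ N)

/-- Since `(M' - M)² - M'² + M² = 2M² - 2MM'`, the sum of squares minus `M²` is a martingale. Adding
`U` preserves this. When `U` itself contains `M²`, the squares of `M` cancel and no growth bound on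
`M` is needed. -/
theorem martingale_sum_sq_increments {σ : ℕ → ℕ} (hσ : Monotone σ) {M U : ℕ → Ω → ℝ}
    (hM : Martingale M 𝓕 P) (hM2 : ∀ n, MemLp (M n) 2 P) (hU : Martingale U 𝓕 P) :
    Martingale (fun N ω => ∑ k ∈ Finset.range N, (M (σ (k + 1)) ω - M (σ k) ω) ^ 2 +
      U (σ N) ω - M (σ N) ω ^ 2) (subFiltration 𝓕 hσ) P := by
  have hinc : ∀ N, MemLp (fun ω => M (σ (N + 1)) ω - M (σ N) ω) 2 P := fun N =>
    (hM2 _).sub (hM2 _)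
  refine martingale_nat (fun N => ?_) (fun N => ?_) fun N => ?_
  · refine StronglyMeasurable.sub (StronglyMeasurable.add ?_ (hU.stronglyMeasurable (σ N)))
      ((hM.stronglyMeasurable (σ N)).pow 2)
    refine Finset.stronglyMeasurable_fun_sum _ fun k hk => StronglyMeasurable.pow ?_ 2
    have hk' := Finset.mem_range.1 hk
    exact ((hM.stronglyMeasurable (σ (k + 1))).mono (𝓕.mono (hσ hk'))).sub
      ((hM.stronglyMeasurable (σ k)).mono (𝓕.mono (hσ hk'.le)))
  · exact ((integrable_finsetSum _ fun k _ => (hinc k).integrable_sq).add (hU.integrable _)).sub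
      (hM2 _).integrable_sq
  · change _ =ᵐ[P] P[_ | 𝓕 (σ N)]
    have hle := hσ N.le_succ
    have hcm : StronglyMeasurable[𝓕 (σ N)] fun ω => -2 * M (σ N) ω :=
      (hM.stronglyMeasurable (σ N)).const_mul _
    have hcb : Integrable ((fun ω => -2 * M (σ N) ω) * M (σ (N + 1))) P :=
      ((hM2 _).const_mul (-2)).integrable_mul (hM2 _)
    have e1 := condExp_mul_of_stronglyMeasurable_left hcm hcb (hM.integrable _)
    have e2 := condExp_add (m := 𝓕 (σ N)) hcb (hU.integrable (σ (N + 1)))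
    have e3 : P[(fun ω => -2 * M (σ N) ω) * M (σ (N + 1)) + U (σ (N + 1)) | 𝓕 (σ N)] =ᵐ[P]
        fun ω => -2 * M (σ N) ω * M (σ N) ω + U (σ N) ω := by
      filter_upwards [e1, e2, hM.condExp_ae_eq hle, hU.condExp_ae_eq hle] with ω h1 h2 h3 h4
      rw [h2, Pi.add_apply, h1, Pi.mul_apply, h3, h4]
    have e4 := condExp_add_of_stronglyMeasurable (P := P) (𝓕.le (σ N))
      (c := fun ω => ∑ k ∈ Finset.range N, (M (σ (k + 1)) ω - M (σ k) ω) ^ 2 + M (σ N) ω ^ 2)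
      (StronglyMeasurable.add (Finset.stronglyMeasurable_fun_sum _ fun k hk => by
        have hk' := Finset.mem_range.1 hk
        exact StronglyMeasurable.pow
          (((hM.stronglyMeasurable (σ (k + 1))).mono (𝓕.mono (hσ hk'))).sub
          ((hM.stronglyMeasurable (σ k)).mono (𝓕.mono (hσ hk'.le)))) 2)
        ((hM.stronglyMeasurable (σ N)).pow 2))
      ((integrable_finsetSum _ fun k _ => (hinc k).integrable_sq).add (hM2 _).integrable_sq)
      (hcb.add (hU.integrable _)) e3
    have e5 : (fun ω => ∑ k ∈ Finset.range (N + 1), (M (σ (k + 1)) ω - M (σ k) ω) ^ 2 +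
        U (σ (N + 1)) ω - M (σ (N + 1)) ω ^ 2) = fun ω =>
        (∑ k ∈ Finset.range N, (M (σ (k + 1)) ω - M (σ k) ω) ^ 2 + M (σ N) ω ^ 2) +
        ((fun ω => -2 * M (σ N) ω) * M (σ (N + 1)) + U (σ (N + 1))) ω := by
      funext ω
      simp only [Finset.sum_range_succ, Pi.add_apply, Pi.mul_apply]
      ring
    rw [e5]
    refine (e4.trans (ae_of_all _ fun ω => ?_)).symm
    ring

/-- The series `∑ N^(-s) 𝔼|w_N|^s` converges, so `∑ (|w_N| / N)^s` is almost surely finite and its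
terms vanish. -/
theorem ae_tendsto_div_of_eLpNorm_le {w : ℕ → Ω → ℝ} {s D : ℝ} (h1 : 1 < s)
    (hwm : ∀ n, AEStronglyMeasurable (w n) P)
    (hw : ∀ n, eLpNorm (w n) (ENNReal.ofReal s) P ≤ ENNReal.ofReal D) :
    ∀ᵐ ω ∂P, Tendsto (fun N : ℕ => (N : ℝ)⁻¹ * w N ω) atTop (𝓝 0) := by
  have hs0 : ENNReal.ofReal s ≠ 0 := by simp; linarith
  have hst : (ENNReal.ofReal s).toReal = s := ENNReal.toReal_ofReal (by linarith)
  have hint : ∀ n, ∫⁻ ω, ‖w n ω‖ₑ ^ s ∂P ≤ ENNReal.ofReal D ^ s := by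
    intro n
    have := hw n
    rw [eLpNorm_eq_lintegral_rpow_enorm_toReal hs0 ENNReal.ofReal_ne_top, hst, one_div,
      ENNReal.rpow_inv_le_iff (by linarith)] at this
    exact this
  set c : ℕ → ℝ≥0∞ := fun N => ENNReal.ofReal ((((N : ℝ) ^ s)⁻¹)) with hc
  have hcsum : ∑' N, c N ≠ ∞ := (Real.summable_nat_rpow_inv.2 h1).tsum_ofReal_ne_top
  have hmeas : ∀ n, AEMeasurable (fun ω => c n * ‖w n ω‖ₑ ^ s) P := fun n =>
    ((hwm n).enorm.pow_const s).const_mul _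
  have htot : ∫⁻ ω, ∑' n, c n * ‖w n ω‖ₑ ^ s ∂P ≠ ∞ := by
    rw [lintegral_tsum hmeas]
    refine ne_top_of_le_ne_top (b := (∑' n, c n) * ENNReal.ofReal D ^ s)
      (ENNReal.mul_ne_top hcsum (ENNReal.rpow_ne_top_of_nonneg (by linarith)
        ENNReal.ofReal_ne_top)) ?_
    rw [← ENNReal.tsum_mul_right]
    refine ENNReal.tsum_le_tsum fun n => ?_
    rw [lintegral_const_mul'' _ ((hwm n).enorm.pow_const s)]
    gcongr
    exact hint n
  filter_upwards [ae_lt_top' (AEMeasurable.tsum hmeas) htot] with ω hω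
  have h2 := ENNReal.tendsto_atTop_zero_of_tsum_ne_top hω.ne
  have h3 := (ENNReal.continuous_rpow_const (y := s⁻¹)).tendsto 0 |>.comp h2
  rw [ENNReal.zero_rpow_of_pos (by positivity)] at h3
  rw [tendsto_zero_iff_enorm_tendsto_zero]
  refine h3.congr' ?_
  filter_upwards [eventually_gt_atTop 0] with N hN
  have hN' : (0 : ℝ) < N := by exact_mod_cast hN
  have hs' : 0 < s := by linarith
  have hs : s ≠ 0 := hs'.ne'
  simp only [Function.comp_apply, hc]
  rw [ENNReal.mul_rpow_of_nonneg _ _ (by positivity), ← ENNReal.rpow_mul, mul_inv_cancel₀ hs,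
    ENNReal.rpow_one, enorm_mul, ENNReal.ofReal_rpow_of_pos (by positivity), ← Real.inv_rpow hN'.le,
    ← Real.rpow_mul (by positivity), mul_inv_cancel₀ hs, Real.rpow_one,
    Real.enorm_of_nonneg (by positivity : (0 : ℝ) ≤ (N : ℝ)⁻¹)]

theorem integral_abs_rpow_le_of_eLpNorm_le {f : Ω → ℝ} {s D : ℝ} (h1 : 1 < s) (hD : 0 ≤ D)
    (hfm : AEStronglyMeasurable f P)
    (hf : eLpNorm f (ENNReal.ofReal s) P ≤ ENNReal.ofReal D) :
    Integrable (fun ω => |f ω| ^ s) P ∧ ∫ ω, |f ω| ^ s ∂P ≤ D ^ s := by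
  have hs' : 0 < s := by linarith
  have hs0 : ENNReal.ofReal s ≠ 0 := by simp [hs']
  have hst : (ENNReal.ofReal s).toReal = s := ENNReal.toReal_ofReal hs'.le
  have hmem : MemLp f (ENNReal.ofReal s) P := ⟨hfm, hf.trans_lt ENNReal.ofReal_lt_top⟩
  have hi := hmem.integrable_norm_rpow hs0 ENNReal.ofReal_ne_top
  rw [hmem.eLpNorm_eq_integral_rpow_norm hs0 ENNReal.ofReal_ne_top,
    ENNReal.ofReal_le_ofReal_iff hD] at hf
  rw [hst] at hf hi
  have h0 : 0 ≤ ∫ ω, ‖f ω‖ ^ s ∂P := integral_nonneg fun ω => by positivity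
  exact ⟨hi, (Real.rpow_inv_le_iff_of_pos h0 hD hs').1 hf⟩

/-- Abstract form of the limit theorem: `b` is a corrector of `a`, `h` is a corrector of the drift
of `M² - b²`, and one envelope `w`, bounded in `L^s`, dominates `a²`, `b²` and `|h|`. The sum of
squares is `V + b² - h + ∑ τ_j m_j` with `V` a martingale. -/
theorem ae_tendsto_average_sq_increments {τ : ℕ → ℝ≥0} (hτ : IsStepSequence τ)
    (ha : StronglyAdapted 𝓕 a) (hb : StronglyAdapted 𝓕 b) (hh : StronglyAdapted 𝓕 h)
    (hab : ∀ n, P[b (n + 1) | 𝓕 n] =ᵐ[P] fun ω => b n ω - τ n * a n ω)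
    (hhm : ∀ n, P[h (n + 1) | 𝓕 n] =ᵐ[P] fun ω =>
      h n ω - τ n * (2 * a n ω * b n ω - τ n * a n ω ^ 2 - m n))
    {L : ℝ} (hm : Tendsto m atTop (𝓝 L)) {w : ℕ → Ω → ℝ} {s C D : ℝ} (h1 : 1 < s) (h2 : s ≤ 2)
    (hC : 0 ≤ C) (hD : 0 ≤ D) (hwm : ∀ n, AEStronglyMeasurable (w n) P)
    (hw : ∀ n, eLpNorm (w n) (ENNReal.ofReal s) P ≤ ENNReal.ofReal D)
    (haw : ∀ n, ∀ᵐ ω ∂P, a n ω ^ 2 ≤ C * w n ω) (hbw : ∀ n, ∀ᵐ ω ∂P, b n ω ^ 2 ≤ C * w n ω)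
    (hhw : ∀ n, ∀ᵐ ω ∂P, |h n ω| ≤ C * w n ω) :
    ∀ᵐ ω ∂P, Tendsto (fun N : ℕ => 1 / (coarseGrid τ N : ℝ) * ∑ k ∈ Finset.range N,
      (accum (fun j => (τ j : ℝ)) a b (coarseIndex τ (k + 1)) ω -
        accum (fun j => (τ j : ℝ)) a b (coarseIndex τ k) ω) ^ 2) atTop (𝓝 L) := by
  have hs1 : 1 ≤ ENNReal.ofReal s := by
    rw [← ENNReal.ofReal_one]; exact ENNReal.ofReal_le_ofReal h1.le
  have hwi : ∀ n, Integrable (w n) P := fun n =>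
    (show MemLp (w n) (ENNReal.ofReal s) P from
      ⟨hwm n, (hw n).trans_lt ENNReal.ofReal_lt_top⟩).integrable hs1
  have hsq : ∀ {g : ℕ → Ω → ℝ}, StronglyAdapted 𝓕 g → (∀ n, ∀ᵐ ω ∂P, g n ω ^ 2 ≤ C * w n ω) →
      ∀ n, MemLp (g n) 2 P := by
    intro g hg hgw n
    have hgm : AEStronglyMeasurable (g n) P := ((hg n).mono (𝓕.le n)).aestronglyMeasurable
    refine (memLp_two_iff_integrable_sq hgm).2 (((hwi n).const_mul C).mono' (hgm.pow 2) ?_)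
    filter_upwards [hgw n] with ω hω
    rwa [Real.norm_of_nonneg (sq_nonneg _)]
  have ha2 := hsq ha haw
  have hb2 := hsq hb hbw
  have hhi : ∀ n, Integrable (h n) P := fun n =>
    ((hwi n).const_mul C).mono' ((hh n).mono (𝓕.le n)).aestronglyMeasurable (hhw n)
  have hM := martingale_accum ha hb ha2 hb2 hab
  have hU := martingale_accum_sq ha hb hh ha2 hb2 hhi hab hhm
  set M := accum (fun j => (τ j : ℝ)) a b with hMdef
  have hσ := coarseIndex_mono hτ
  set σ := coarseIndex τ with hσdef
  have hV := martingale_sum_sq_increments hσ hM (memLp_accum ha2 hb2) hU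
  set V : ℕ → Ω → ℝ := fun N ω => ∑ k ∈ Finset.range N, (M (σ (k + 1)) ω - M (σ k) ω) ^ 2 +
      (M (σ N) ω ^ 2 - b (σ N) ω ^ 2 + h (σ N) ω -
        ∑ j ∈ Finset.range (σ N), (τ j : ℝ) * m j) - M (σ N) ω ^ 2 with hVdef
  obtain ⟨T₀, hT₀, hT₀'⟩ := exists_step_le hτ
  set T : ℝ := 1 + 2 * T₀ with hTdef
  have hTpos : 0 ≤ T := by positivity
  have hblock : ∀ N, ∑ j ∈ Finset.Ico (σ N) (σ (N + 1)), (τ j : ℝ) ≤ T :=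
    sum_Ico_coarseIndex_le hτ hT₀'
  obtain ⟨B, hB⟩ : ∃ B, ∀ n, |m n| ≤ B := by
    obtain ⟨B, hB⟩ := hm.abs.bddAbove_range
    exact ⟨B, fun n => hB ⟨n, rfl⟩⟩
  have hB0 : 0 ≤ B := (abs_nonneg _).trans (hB 0)
  -- Envelope of the increments of `V`. The square of a sum of three terms gives the factor 3. In `5
  -- * C` the summands are 3 from that square, 1 from `b²` and 1 from `h`. The constant `T * B`
  -- bounds the deterministic part.
  set R : ℕ → Ω → ℝ := fun N => (∑ j ∈ Finset.Ico (σ N) (σ (N + 1)), (3 * T * C * τ j) • w j) +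
    ((5 * C) • w (σ (N + 1)) + ((5 * C) • w (σ N) + fun _ => T * B)) with hRdef
  have hVR : ∀ N, ∀ᵐ ω ∂P, ‖V (N + 1) ω - V N ω‖ ≤ R N ω := by
    intro N
    have hall := ae_all_iff.2 haw
    filter_upwards [hall, hbw (σ (N + 1)), hbw (σ N), hhw (σ (N + 1)), hhw (σ N)]
      with ω e1 e2 e3 e4 e5
    have hle := hσ N.le_succ
    set A := ∑ j ∈ Finset.Ico (σ N) (σ (N + 1)), (τ j : ℝ) * a j ω with hA
    set Q := ∑ j ∈ Finset.Ico (σ N) (σ (N + 1)), (τ j : ℝ) * w j ω with hQ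
    have hdiff : M (σ (N + 1)) ω - M (σ N) ω = A + b (σ (N + 1)) ω - b (σ N) ω := by
      rw [hA, Finset.sum_Ico_eq_sub _ hle, hMdef, accum, accum]
      ring
    -- Cauchy–Schwarz with weights `τ_j`, split as `√τ_j · (√τ_j a_j)`. The total weight of a block
    -- is at most `T`.
    have hA2 : A ^ 2 ≤ T * (C * Q) := by
      have hcs := Finset.sum_mul_sq_le_sq_mul_sq (Finset.Ico (σ N) (σ (N + 1)))
        (fun j => Real.sqrt (τ j)) (fun j => Real.sqrt (τ j) * a j ω)
      have h3 : ∀ j, Real.sqrt (τ j) * (Real.sqrt (τ j) * a j ω) = τ j * a j ω := fun j => by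
        rw [← mul_assoc, Real.mul_self_sqrt (τ j).coe_nonneg]
      simp only [h3, mul_pow, Real.sq_sqrt (NNReal.coe_nonneg _)] at hcs
      refine hcs.trans (mul_le_mul (hblock N) ?_ (Finset.sum_nonneg fun j _ => by positivity) hTpos)
      rw [hQ, Finset.mul_sum]
      refine Finset.sum_le_sum fun j _ => ?_
      have := mul_le_mul_of_nonneg_left (e1 j) (τ j).coe_nonneg
      linarith
    have hdet : |∑ j ∈ Finset.Ico (σ N) (σ (N + 1)), (τ j : ℝ) * m j| ≤ T * B := by
      refine (Finset.abs_sum_le_sum_abs _ _).trans ?_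
      refine (Finset.sum_le_sum fun j _ => ?_).trans
        ((Finset.sum_mul _ _ B).symm.le.trans (mul_le_mul_of_nonneg_right (hblock N) hB0))
      rw [abs_mul, abs_of_nonneg (τ j).coe_nonneg]
      exact mul_le_mul_of_nonneg_left (hB j) (τ j).coe_nonneg
    have hVd : V (N + 1) ω - V N ω = (A + b (σ (N + 1)) ω - b (σ N) ω) ^ 2 - b (σ (N + 1)) ω ^ 2
        + b (σ N) ω ^ 2 + h (σ (N + 1)) ω - h (σ N) ω -
        ∑ j ∈ Finset.Ico (σ N) (σ (N + 1)), (τ j : ℝ) * m j := by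
      rw [Finset.sum_Ico_eq_sub _ hle, ← hdiff]
      simp only [hVdef, Finset.sum_range_succ]
      ring
    have hRω : R N ω = 3 * T * C * Q + (5 * C * w (σ (N + 1)) ω + (5 * C * w (σ N) ω + T * B)) := by
      simp only [hRdef, Pi.add_apply, Finset.sum_apply, Pi.smul_apply, smul_eq_mul, hQ,
        Finset.mul_sum, mul_assoc]
    rw [hVd, hRω, Real.norm_eq_abs]
    have h3 : (A + b (σ (N + 1)) ω - b (σ N) ω) ^ 2 ≤
        3 * (A ^ 2 + b (σ (N + 1)) ω ^ 2 + b (σ N) ω ^ 2) := by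
      nlinarith [sq_nonneg (A - b (σ (N + 1)) ω), sq_nonneg (A + b (σ N) ω),
        sq_nonneg (b (σ (N + 1)) ω + b (σ N) ω)]
    rw [abs_le] at e4 e5 hdet ⊢
    constructor <;> nlinarith [sq_nonneg (A + b (σ (N + 1)) ω - b (σ N) ω), sq_nonneg A,
      sq_nonneg (b (σ (N + 1)) ω), sq_nonneg (b (σ N) ω)]
  set D' : ℝ := 3 * T * C * T * D + (5 * C * D + (5 * C * D + T * B)) with hD'
  have hsm : ∀ (c : ℝ) (n : ℕ), 0 ≤ c →
      eLpNorm (c • w n) (ENNReal.ofReal s) P ≤ ENNReal.ofReal (c * D) := by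
    intro c n hc
    refine eLpNorm_const_smul_le.trans ?_
    rw [Real.enorm_of_nonneg hc, ENNReal.ofReal_mul hc]
    gcongr
    exact hw n
  have hRD : ∀ N, eLpNorm (R N) (ENNReal.ofReal s) P ≤ ENNReal.ofReal D' := by
    intro N
    have hcm : ∀ (c : ℝ) (n : ℕ), AEStronglyMeasurable (c • w n) P := fun c n =>
      (hwm n).const_smul c
    have hsumm : AEStronglyMeasurable (∑ j ∈ Finset.Ico (σ N) (σ (N + 1)),
        (3 * T * C * τ j) • w j) P := Finset.aestronglyMeasurable_sum _ fun j _ => hcm _ j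
    have h5 : 0 ≤ 5 * C := by positivity
    have hconst : eLpNorm (fun _ : Ω => T * B) (ENNReal.ofReal s) P ≤ ENNReal.ofReal (T * B) := by
      rw [eLpNorm_const _ (by simp; linarith) (IsProbabilityMeasure.ne_zero P), measure_univ,
        ENNReal.one_rpow, mul_one, Real.enorm_of_nonneg (by positivity)]
    have hsum : eLpNorm (∑ j ∈ Finset.Ico (σ N) (σ (N + 1)), (3 * T * C * τ j) • w j)
        (ENNReal.ofReal s) P ≤ ENNReal.ofReal (3 * T * C * T * D) := by
      refine (eLpNorm_sum_le (fun j _ => hcm _ j) hs1).trans ?_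
      refine (Finset.sum_le_sum fun j _ => hsm _ j (by positivity)).trans ?_
      rw [← ENNReal.ofReal_sum_of_nonneg fun j _ => by positivity]
      refine ENNReal.ofReal_le_ofReal ?_
      rw [← Finset.sum_mul, ← Finset.mul_sum]
      gcongr
      exact hblock N
    refine (eLpNorm_add_le hsumm ((hcm _ _).add ((hcm _ _).add aestronglyMeasurable_const))
      hs1).trans ?_
    rw [hD', ENNReal.ofReal_add (by positivity) (by positivity)]
    refine add_le_add hsum ?_
    refine (eLpNorm_add_le (hcm _ _) ((hcm _ _).add aestronglyMeasurable_const) hs1).trans ?_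
    rw [ENNReal.ofReal_add (by positivity) (by positivity)]
    refine add_le_add (hsm _ _ h5) ?_
    refine (eLpNorm_add_le (hcm _ _) aestronglyMeasurable_const hs1).trans ?_
    rw [ENNReal.ofReal_add (by positivity) (by positivity)]
    exact add_le_add (hsm _ _ h5) hconst
  have hVm : ∀ N, AEStronglyMeasurable (fun ω => V (N + 1) ω - V N ω) P := fun N =>
    ((hV.integrable (N + 1)).sub (hV.integrable N)).1
  have hVb : ∀ N, eLpNorm (fun ω => V (N + 1) ω - V N ω) (ENNReal.ofReal s) P ≤
      ENNReal.ofReal D' := fun N => (eLpNorm_mono_ae_real (hVR N)).trans (hRD N)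
  have hD'0 : 0 ≤ D' := by positivity
  have hmom := fun N => integral_abs_rpow_le_of_eLpNorm_le h1 hD'0 (hVm N) (hVb N)
  have hslln := ae_tendsto_div_of_martingale hV h1 h2 (fun n => (hmom n).1) (fun n => (hmom n).2)
  have hw0 := ae_tendsto_div_of_eLpNorm_le h1 (fun N => hwm (σ N)) (fun N => hw (σ N))
  filter_upwards [hslln, hw0, ae_all_iff.2 hbw, ae_all_iff.2 hhw] with ω e1 e2 e3 e4
  have e2C : Tendsto (fun N : ℕ => C * ((N : ℝ)⁻¹ * w (σ N) ω)) atTop (𝓝 0) := by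
    simpa using e2.const_mul C
  have e5 : Tendsto (fun N : ℕ => (N : ℝ)⁻¹ * b (σ N) ω ^ 2) atTop (𝓝 0) := by
    refine squeeze_zero (fun N => by positivity) (fun N => ?_) e2C
    calc (N : ℝ)⁻¹ * b (σ N) ω ^ 2 ≤ (N : ℝ)⁻¹ * (C * w (σ N) ω) := by
          gcongr; exact e3 _
      _ = _ := by ring
  have e6 : Tendsto (fun N : ℕ => (N : ℝ)⁻¹ * h (σ N) ω) atTop (𝓝 0) := by
    refine squeeze_zero_norm (fun N => ?_) e2C
    rw [norm_mul, Real.norm_of_nonneg (by positivity : (0 : ℝ) ≤ (N : ℝ)⁻¹), Real.norm_eq_abs]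
    calc (N : ℝ)⁻¹ * |h (σ N) ω| ≤ (N : ℝ)⁻¹ * (C * w (σ N) ω) := by
          gcongr; exact e4 _
      _ = _ := by ring
  -- This is the identity for the sum of squares, divided by `N`. The normalisation by `t̃_N`
  -- follows from `t̃_N / N → 1`.
  have e7 := ((e1.add e5).sub e6).add (tendsto_weighted_average hτ hm)
  have e8 := ((tendsto_coarseGrid_div hτ).inv₀ one_ne_zero).mul e7
  simp only [zero_add, sub_zero, inv_one, one_mul] at e8
  refine e8.congr' ?_
  filter_upwards [eventually_gt_atTop 0] with N hN
  have hN' : (N : ℝ) ≠ 0 := by exact_mod_cast hN.ne'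
  simp only [hVdef, mul_inv, inv_inv, one_div]
  field_simp
  ring

end QuadraticVariation

/-! ### Transition kernels -/

section MarkovProperty

variable {Ω E : Type*} {𝒢 mΩ : MeasurableSpace Ω} [MeasurableSpace E] {P : Measure Ω}
  [IsProbabilityMeasure P] {U V : Ω → E} {K : Kernel E E}

theorem integral_comp_measure {μ : Measure E} {g : E → ℝ} (hg : Integrable g (K ∘ₘ μ)) :
    ∫ y, g y ∂(K ∘ₘ μ) = ∫ x, ∫ y, g y ∂(K x) ∂μ := by
  rw [Measure.comp_eq_comp_const_apply] at hg ⊢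
  rw [Kernel.integral_comp hg, Kernel.const_apply]

/-- Testing the conditional expectations on indicators and integrating over `A` gives an identity of
measures. In this form the Markov property, assumed for bounded functions only, extends to every
integrable function. -/
theorem map_restrict_eq_comp_of_condExp [IsMarkovKernel K] (h𝒢 : 𝒢 ≤ mΩ)
    (hU : Measurable[𝒢] U) (hV : Measurable V)
    (h : ∀ f : E → ℝ, Measurable f → (∃ C, ∀ y, |f y| ≤ C) →
      P[fun ω => f (V ω) | 𝒢] =ᵐ[P] fun ω => ∫ y, f y ∂(K (U ω)))
    {A : Set Ω} (hA : MeasurableSet[𝒢] A) :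
    (P.restrict A).map V = K ∘ₘ (P.restrict A).map U := by
  have hU' : Measurable U := hU.mono h𝒢 le_rfl
  ext B hB
  rw [Measure.bind_apply hB K.aemeasurable, lintegral_map (K.measurable_coe hB) hU',
    Measure.map_apply hV hB]
  have hf := h (B.indicator 1) (measurable_one.indicator hB) ⟨1, fun y => by
    by_cases hy : y ∈ B <;> simp [hy]⟩
  have hfi : Integrable (fun ω => B.indicator (1 : E → ℝ) (V ω)) P := by
    refine (integrable_const (1 : ℝ)).mono'
      ((measurable_one.indicator hB).comp hV).aestronglyMeasurable (ae_of_all _ fun ω => ?_)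
    by_cases hy : V ω ∈ B <;> simp [hy]
  have e1 := setIntegral_condExp h𝒢 hfi hA
  have e2 : ∀ y, ∫ z, B.indicator (1 : E → ℝ) z ∂(K y) = (K y B).toReal := fun y => by
    rw [integral_indicator_one hB]; rfl
  rw [setIntegral_congr_ae (g := fun ω => (K (U ω) B).toReal) (h𝒢 _ hA)
    (hf.mono fun ω hω _ => hω.trans (e2 _))] at e1
  have hlt : ∀ ω, K (U ω) B < ∞ := fun ω => measure_lt_top _ _
  have hm : AEMeasurable (fun ω => K (U ω) B) (P.restrict A) :=
    ((K.measurable_coe hB).comp hU').aemeasurable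
  rw [integral_toReal hm (ae_of_all _ hlt)] at e1
  have e3 : ∫ ω in A, B.indicator (1 : E → ℝ) (V ω) ∂P = ((P.restrict A) (V ⁻¹' B)).toReal := by
    rw [← Measure.real, ← integral_indicator_one (hV hB)]
    rfl
  rw [e3] at e1
  refine ((ENNReal.toReal_eq_toReal_iff' ?_ (measure_ne_top _ _)).1 e1).symm
  refine ne_top_of_le_ne_top (b := P.restrict A Set.univ) (measure_ne_top _ _) ?_
  calc ∫⁻ ω in A, K (U ω) B ∂P ≤ ∫⁻ _ in A, 1 ∂P := lintegral_mono fun ω => prob_le_one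
    _ = _ := by simp

theorem condExp_comp_eq_integral_kernel [IsMarkovKernel K] (h𝒢 : 𝒢 ≤ mΩ)
    (hU : Measurable[𝒢] U) (hV : Measurable V)
    (h : ∀ f : E → ℝ, Measurable f → (∃ C, ∀ y, |f y| ≤ C) →
      P[fun ω => f (V ω) | 𝒢] =ᵐ[P] fun ω => ∫ y, f y ∂(K (U ω)))
    {g : E → ℝ} (hg : Measurable g) (hgi : Integrable (fun ω => g (V ω)) P) :
    P[fun ω => g (V ω) | 𝒢] =ᵐ[P] fun ω => ∫ y, g y ∂(K (U ω)) := by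
  have hU' : Measurable U := hU.mono h𝒢 le_rfl
  have hGm : StronglyMeasurable fun y => ∫ z, g z ∂(K y) :=
    hg.stronglyMeasurable.integral_kernel
  have key : ∀ A : Set Ω, MeasurableSet[𝒢] A →
      Integrable g (K ∘ₘ (P.restrict A).map U) := by
    intro A hA
    rw [← map_restrict_eq_comp_of_condExp h𝒢 hU hV h hA,
      integrable_map_measure hg.aestronglyMeasurable hV.aemeasurable]
    exact hgi.mono_measure Measure.restrict_le_self
  refine (ae_eq_condExp_of_forall_setIntegral_eq h𝒢 hgi (fun A hA _ => ?_) (fun A hA _ => ?_)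
    ?_).symm
  · have h1 := Measure.integrable_integral_norm_of_integrable_comp (key A hA)
    have h2 : Integrable (fun y => ∫ z, g z ∂(K y)) ((P.restrict A).map U) :=
      h1.mono hGm.aestronglyMeasurable (ae_of_all _ fun y =>
        (norm_integral_le_integral_norm _).trans (le_abs_self _))
    exact (integrable_map_measure hGm.aestronglyMeasurable hU'.aemeasurable).1 h2
  · have h1 := integral_comp_measure (key A hA)
    rw [← map_restrict_eq_comp_of_condExp h𝒢 hU hV h hA,
      integral_map hV.aemeasurable hg.aestronglyMeasurable,
      integral_map hU'.aemeasurable hGm.aestronglyMeasurable] at h1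
    exact h1.symm
  · exact (hGm.comp_measurable hU).aestronglyMeasurable

end MarkovProperty

section Kernels

variable {Ω E : Type*} {mΩ : MeasurableSpace Ω} [MeasurableSpace E] {P : Measure Ω}
  [IsProbabilityMeasure P] {ℱ : Filtration ℝ≥0 mΩ} {X : ℝ≥0 → ℝ≥0 → E → Ω → E}
  {τ : ℕ → ℝ≥0} {Y : ℕ → ℕ → E → Ω → E}

theorem IsMarkovProcess.measurable (hX : IsMarkovProcess P ℱ X) {s t : ℝ≥0} (h : s ≤ t) (x : E) :
    Measurable (X s t x) := (hX.adapted s t x h).mono (ℱ.le t) le_rfl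

theorem IsMarkovChain.measurable (hY : IsMarkovChain P ℱ τ Y) {m n : ℕ} (h : m ≤ n) (x : E) :
    Measurable (Y m n x) := (hY.adapted m n x h).mono (ℱ.le _) le_rfl

/-- The transition kernel `K_t(x, ·)` of the Markov process. -/
def procKernel (hX : IsMarkovProcess P ℱ X) (t : ℝ≥0) : Kernel E E where
  toFun x := P.map (X 0 t x)
  measurable' := by
    refine Measure.measurable_of_measurable_coe _ fun A hA => ?_
    simp_rw [Measure.map_apply (hX.measurable zero_le _) hA]
    exact hX.measurable_transition 0 t A zero_le hA

theorem procKernel_apply (hX : IsMarkovProcess P ℱ X) (t : ℝ≥0) (x : E) :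
    procKernel hX t x = P.map (X 0 t x) := rfl

instance (hX : IsMarkovProcess P ℱ X) (t : ℝ≥0) : IsMarkovKernel (procKernel hX t) :=
  ⟨fun x => Measure.isProbabilityMeasure_map (hX.measurable zero_le x).aemeasurable⟩

open Classical in
/-- The transition kernel `Q_{m,n}(x, ·)` of the Markov chain. -/
def chainKernel (hY : IsMarkovChain P ℱ τ Y) (m n : ℕ) : Kernel E E :=
  if h : m ≤ n then
    { toFun := fun x => P.map (Y m n x)
      measurable' := by
        refine Measure.measurable_of_measurable_coe _ fun A hA => ?_
        simp_rw [Measure.map_apply (hY.measurable h _) hA]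
        exact hY.measurable_transition m n A h hA }
  else Kernel.id

theorem chainKernel_apply (hY : IsMarkovChain P ℱ τ Y) {m n : ℕ} (h : m ≤ n) (x : E) :
    chainKernel hY m n x = P.map (Y m n x) := by
  simp only [chainKernel, dif_pos h]; rfl

instance (hY : IsMarkovChain P ℱ τ Y) (m n : ℕ) : IsMarkovKernel (chainKernel hY m n) := by
  by_cases h : m ≤ n
  · exact ⟨fun x => by
      rw [chainKernel_apply hY h]
      exact Measure.isProbabilityMeasure_map (hY.measurable h x).aemeasurable⟩
  · rw [chainKernel, dif_neg h]; infer_instance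

theorem semigroup_eq_integral (hX : IsMarkovProcess P ℱ X) (t : ℝ≥0) {f : E → ℝ}
    (hf : Measurable f) (x : E) : semigroup P X t f x = ∫ y, f y ∂(procKernel hX t x) := by
  rw [procKernel_apply, integral_map (hX.measurable zero_le x).aemeasurable
    hf.aestronglyMeasurable]
  rfl

theorem chainKernel_self (hY : IsMarkovChain P ℱ τ Y) (m : ℕ) (x : E) :
    chainKernel hY m m x = Measure.dirac x := by
  rw [chainKernel_apply hY le_rfl, Measure.map_congr (hY.initial m x), Measure.map_const,
    measure_univ, one_smul]

theorem procKernel_shift (hX : IsMarkovProcess P ℱ X) {s t : ℝ≥0} (h : s ≤ t) (x : E) :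
    P.map (X s t x) = procKernel hX (t - s) x := hX.homogeneous s t x h

/-- Chapman–Kolmogorov, read off from the Markov property on the whole space together with time
homogeneity. -/
theorem procKernel_add (hX : IsMarkovProcess P ℱ X) (s t : ℝ≥0) (x : E) :
    procKernel hX (s + t) x = procKernel hX t ∘ₘ procKernel hX s x := by
  have hm : Measurable (X 0 (s + t) x) := hX.measurable zero_le x
  have h := map_restrict_eq_comp_of_condExp (P := P) (K := procKernel hX t) (ℱ.le s)
    (hX.adapted 0 s x zero_le) hm (fun f hf hb => by
      refine (hX.markov 0 s (s + t) x zero_le le_self_add f hf hb).trans (ae_of_all _ ?_)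
      intro ω
      dsimp only
      rw [← integral_map (hX.measurable le_self_add _).aemeasurable hf.aestronglyMeasurable,
        procKernel_shift hX le_self_add, add_tsub_cancel_left]) (A := Set.univ)
    MeasurableSet.univ
  rwa [Measure.restrict_univ] at h

theorem chain_markov_kernel (hY : IsMarkovChain P ℱ τ Y) {m k n : ℕ} (hmk : m ≤ k) (hkn : k ≤ n)
    (x : E) (f : E → ℝ) (hf : Measurable f) (hb : ∃ C, ∀ y, |f y| ≤ C) :
    P[fun ω => f (Y m n x ω) | ℱ (grid τ k)] =ᵐ[P]
      fun ω => ∫ y, f y ∂(chainKernel hY k n (Y m k x ω)) := by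
  refine (hY.markov m k n x hmk hkn f hf hb).trans (ae_of_all _ fun ω => ?_)
  dsimp only
  rw [chainKernel_apply hY hkn, integral_map (hY.measurable hkn _).aemeasurable
    hf.aestronglyMeasurable]

theorem chainKernel_comp (hY : IsMarkovChain P ℱ τ Y) {m k n : ℕ} (hmk : m ≤ k) (hkn : k ≤ n)
    (x : E) : chainKernel hY m n x = chainKernel hY k n ∘ₘ chainKernel hY m k x := by
  have h := map_restrict_eq_comp_of_condExp (P := P) (K := chainKernel hY k n) (ℱ.le _)
    (hY.adapted m k x hmk) (hY.measurable (hmk.trans hkn) x)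
    (chain_markov_kernel hY hmk hkn x) (A := Set.univ) MeasurableSet.univ
  rwa [Measure.restrict_univ, ← chainKernel_apply hY hmk, ← chainKernel_apply hY (hmk.trans hkn)]
    at h

theorem condExp_chain (hY : IsMarkovChain P ℱ τ Y) {m k n : ℕ} (hmk : m ≤ k) (hkn : k ≤ n)
    (x : E) {g : E → ℝ} (hg : Measurable g) (hgi : Integrable (fun ω => g (Y m n x ω)) P) :
    P[fun ω => g (Y m n x ω) | ℱ (grid τ k)] =ᵐ[P]
      fun ω => ∫ y, g y ∂(chainKernel hY k n (Y m k x ω)) :=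
  condExp_comp_eq_integral_kernel (ℱ.le _) (hY.adapted m k x hmk)
    (hY.measurable (hmk.trans hkn) x) (chain_markov_kernel hY hmk hkn x) hg hgi

theorem isInvariantProb_iff (hX : IsMarkovProcess P ℱ X) {μ : Measure E} :
    IsInvariantProb P X μ ↔ IsProbabilityMeasure μ ∧ ∀ t, procKernel hX t ∘ₘ μ = μ := by
  have key : ∀ [IsProbabilityMeasure μ] (t : ℝ≥0) (f : E → ℝ), Measurable f →
      (∃ C, ∀ y, |f y| ≤ C) →
      ∫ x, semigroup P X t f x ∂μ = ∫ x, f x ∂(procKernel hX t ∘ₘ μ) := by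
    intro _ t f hf ⟨C, hC⟩
    rw [integral_comp_measure]
    · exact integral_congr_ae (ae_of_all _ fun x => semigroup_eq_integral hX t hf x)
    · exact (integrable_const C).mono' hf.aestronglyMeasurable (ae_of_all _ hC)
  constructor
  · rintro ⟨hp, hi⟩
    refine ⟨hp, fun t => ?_⟩
    ext B hB
    have h1 := hi t (B.indicator 1) (measurable_one.indicator hB) ⟨1, fun y => by
      by_cases hy : y ∈ B <;> simp [hy]⟩
    rw [key t _ (measurable_one.indicator hB) ⟨1, fun y => by
      by_cases hy : y ∈ B <;> simp [hy]⟩, integral_indicator_one hB, integral_indicator_one hB]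
      at h1
    exact (ENNReal.toReal_eq_toReal_iff' (measure_ne_top _ _) (measure_ne_top _ _)).1 h1
  · rintro ⟨hp, hi⟩
    exact ⟨hp, fun t f hf hb => by rw [key t f hf hb, hi t]⟩

end Kernels

/-! ### Weighted Hölder classes and comparison of expectations -/

section Weights

variable {E : Type*} [NormedAddCommGroup E]

/-- The weight `1 + ‖u‖`. -/
def wt (u : E) : ℝ := 1 + ‖u‖

theorem one_le_wt (u : E) : 1 ≤ wt u := le_add_of_nonneg_right (norm_nonneg u)

theorem wt_pos (u : E) : 0 < wt u := zero_lt_one.trans_le (one_le_wt u)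

theorem continuous_wt : Continuous (wt : E → ℝ) := by unfold wt; fun_prop

theorem measurable_wt [MeasurableSpace E] [BorelSpace E] : Measurable (wt : E → ℝ) :=
  continuous_wt.measurable

theorem norm_le_wt (u : E) : ‖u‖ ≤ wt u := by simp [wt]

theorem one_le_wt_rpow (u : E) {a : ℝ} (ha : 0 ≤ a) : 1 ≤ wt u ^ a :=
  Real.one_le_rpow (one_le_wt u) ha

theorem wt_rpow_mono (u : E) {a b : ℝ} (h : a ≤ b) : wt u ^ a ≤ wt u ^ b :=
  Real.rpow_le_rpow_of_exponent_le (one_le_wt u) h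

theorem wt_rpow_nonneg (u : E) (a : ℝ) : 0 ≤ wt u ^ a := Real.rpow_nonneg (wt_pos u).le a

theorem norm_rpow_le_wt_rpow (u : E) {a : ℝ} (ha : 0 ≤ a) : ‖u‖ ^ a ≤ wt u ^ a :=
  Real.rpow_le_rpow (norm_nonneg u) (norm_le_wt u) ha

theorem add_rpow_le_two_rpow {x y a : ℝ} (hx : 0 ≤ x) (hy : 0 ≤ y) (ha : 0 ≤ a) :
    (x + y) ^ a ≤ 2 ^ a * (x ^ a + y ^ a) := by
  wlog h : x ≤ y generalizing x y
  · rw [add_comm x, add_comm (x ^ a)]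
    exact this hy hx (le_of_not_ge h)
  calc (x + y) ^ a ≤ (2 * y) ^ a := Real.rpow_le_rpow (by positivity) (by linarith) ha
    _ = 2 ^ a * y ^ a := Real.mul_rpow (by norm_num) hy
    _ ≤ _ := by
      have := Real.rpow_nonneg hx a
      gcongr
      linarith

theorem rpow_mul_rpow_le {x y a b : ℝ} (hx : 0 < x) (hy : 0 < y) (ha : 0 ≤ a) (hb : 0 ≤ b) :
    x ^ a * y ^ b ≤ x ^ (a + b) + y ^ (a + b) := by
  rcases le_total x y with h | h
  · calc x ^ a * y ^ b ≤ y ^ a * y ^ b := by gcongr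
      _ = y ^ (a + b) := (Real.rpow_add hy a b).symm
      _ ≤ _ := le_add_of_nonneg_left (Real.rpow_nonneg hx.le _)
  · calc x ^ a * y ^ b ≤ x ^ a * x ^ b := by gcongr
      _ = x ^ (a + b) := (Real.rpow_add hx a b).symm
      _ ≤ _ := le_add_of_nonneg_right (Real.rpow_nonneg hy.le _)

theorem wt_add_wt_rpow_le (u v : E) {a : ℝ} (ha : 0 ≤ a) :
    (wt u + wt v) ^ a ≤ 2 ^ a * (wt u ^ a + wt v ^ a) :=
  add_rpow_le_two_rpow (wt_pos u).le (wt_pos v).le ha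

theorem one_le_wt_add (u v : E) : 1 ≤ wt u + wt v := by linarith [one_le_wt u, wt_pos v]

theorem norm_sub_le_wt_add (u v : E) : ‖u - v‖ ≤ wt u + wt v :=
  (norm_sub_le u v).trans (add_le_add (norm_le_wt u) (norm_le_wt v))

theorem one_add_norm_rpow_le (u v : E) {a : ℝ} (ha : 0 ≤ a) :
    1 + ‖u‖ ^ a + ‖v‖ ^ a ≤ 3 * (wt u + wt v) ^ a := by
  have h1 : (1 : ℝ) ≤ (wt u + wt v) ^ a := Real.one_le_rpow (one_le_wt_add u v) ha
  have h2 : ‖u‖ ^ a ≤ (wt u + wt v) ^ a :=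
    Real.rpow_le_rpow (norm_nonneg u) (by linarith [norm_le_wt u, wt_pos v]) ha
  have h3 : ‖v‖ ^ a ≤ (wt u + wt v) ^ a :=
    Real.rpow_le_rpow (norm_nonneg v) (by linarith [norm_le_wt v, wt_pos u]) ha
  linarith

/-- Functions of growth `(1 + ‖u‖)^a` that are locally `γ`-Hölder with the same weight. -/
structure HolderClass [MeasurableSpace E] (a γ K : ℝ) (G : E → ℝ) : Prop where
  measurable : Measurable G
  growth : ∀ u, |G u| ≤ K * wt u ^ a
  holder : ∀ u v, |G u - G v| ≤ K * (min 1 (‖u - v‖ ^ γ) * (wt u + wt v) ^ a)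

variable [MeasurableSpace E]

theorem HolderClass.const_nonneg {a γ K : ℝ} {G : E → ℝ} (h : HolderClass a γ K G) : 0 ≤ K := by
  by_contra hK
  have := (abs_nonneg _).trans (h.growth 0)
  nlinarith [one_le_wt (0 : E), Real.rpow_pos_of_pos (wt_pos (0 : E)) a]

theorem HolderClass.of_exponent_le {a γ γ' K : ℝ} {G : E → ℝ} (h : HolderClass a γ K G)
    (h0 : 0 < γ') (hγ : γ' ≤ γ) : HolderClass a γ' K G := by
  refine ⟨h.measurable, h.growth, fun u v => (h.holder u v).trans ?_⟩
  have hK := h.const_nonneg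
  have hw : 0 ≤ (wt u + wt v) ^ a :=
    Real.rpow_nonneg (zero_le_one.trans (one_le_wt_add u v)) a
  refine mul_le_mul_of_nonneg_left (mul_le_mul_of_nonneg_right ?_ hw) hK
  rcases le_total ‖u - v‖ 1 with h1 | h1
  · refine min_le_min le_rfl ?_
    rcases (norm_nonneg (u - v)).eq_or_lt with h2 | h2
    · rw [← h2, Real.zero_rpow h0.ne', Real.zero_rpow (by linarith)]
    · exact Real.rpow_le_rpow_of_exponent_ge h2 h1 hγ
  · rw [min_eq_left (Real.one_le_rpow h1 h0.le)]
    exact min_le_left _ _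

theorem HolderClass.sub_const {a γ K : ℝ} {G : E → ℝ} (h : HolderClass a γ K G) (ha : 0 ≤ a)
    (c : ℝ) : HolderClass a γ (K + |c|) (fun u => G u - c) := by
  refine ⟨h.measurable.sub_const c, fun u => ?_, fun u v => ?_⟩
  · have h1 := abs_sub (G u) c
    have h2 := one_le_wt_rpow u ha
    nlinarith [h.growth u, abs_nonneg c]
  · rw [sub_sub_sub_cancel_right, add_mul]
    have : 0 ≤ min 1 (‖u - v‖ ^ γ) * (wt u + wt v) ^ a :=
      mul_nonneg (le_min zero_le_one (by positivity))
        (Real.rpow_nonneg (zero_le_one.trans (one_le_wt_add u v)) a)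
    nlinarith [h.holder u v, abs_nonneg c]

theorem MemC.holderClass {p γ : ℝ} (hp : 0 ≤ p) {f : E → ℝ} (h : MemC p γ f) :
    ∃ K, HolderClass (p / 2) γ K f := by
  obtain ⟨A, hA⟩ := h.growth
  obtain ⟨B, hB⟩ := h.holder
  have hA' : ∀ u, |f u| ≤ 2 * |A| * wt u ^ (p / 2) := by
    intro u
    have h1 : |f u| / (1 + ‖u‖ ^ (p / 2)) ≤ A := hA ⟨u, rfl⟩
    have h0 : 0 ≤ ‖u‖ ^ (p / 2) := by positivity
    rw [div_le_iff₀ (by linarith)] at h1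
    have h2 := norm_rpow_le_wt_rpow u (by linarith : 0 ≤ p / 2)
    have h3 := one_le_wt_rpow u (by linarith : 0 ≤ p / 2)
    nlinarith [le_abs_self A, abs_nonneg A]
  have hsqrt : ∀ u v : E, (1 + ‖u‖ ^ p + ‖v‖ ^ p) ^ (1 / 2 : ℝ) ≤ 2 * (wt u + wt v) ^ (p / 2) := by
    intro u v
    have hS : 0 ≤ wt u + wt v := zero_le_one.trans (one_le_wt_add u v)
    -- The constant 3 from `one_add_norm_rpow_le` is relaxed to 4, whose square root is 2.
    calc (1 + ‖u‖ ^ p + ‖v‖ ^ p) ^ (1 / 2 : ℝ) ≤ (4 * (wt u + wt v) ^ p) ^ (1 / 2 : ℝ) := by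
          refine Real.rpow_le_rpow (by positivity) ?_ (by norm_num)
          have := Real.rpow_nonneg hS p
          linarith [one_add_norm_rpow_le u v hp]
      _ = _ := by
          rw [Real.mul_rpow (by norm_num) (Real.rpow_nonneg hS p), ← Real.rpow_mul hS,
            show (4 : ℝ) = 2 ^ (2 : ℝ) by norm_num, ← Real.rpow_mul (by norm_num)]
          norm_num
          congr 1
          ring
  refine ⟨2 * |A| + 2 * |B|, h.measurable, fun u => ?_, fun u v => ?_⟩
  · have := wt_rpow_nonneg u (p / 2)
    nlinarith [hA' u, abs_nonneg B]
  · rcases eq_or_ne u v with rfl | huv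
    · simp only [sub_self, abs_zero]
      have : 0 ≤ (wt u + wt u) ^ (p / 2) :=
        Real.rpow_nonneg (zero_le_one.trans (one_le_wt_add u u)) _
      positivity
    · have h1 : |f u - f v| / quasiDist p γ u v ≤ B := hB ⟨(u, v), huv, rfl⟩
      have hm : 0 < min 1 (‖u - v‖ ^ γ) :=
        lt_min zero_lt_one (Real.rpow_pos_of_pos (norm_pos_iff.2 (sub_ne_zero.2 huv)) γ)
      have hq : 0 < quasiDist p γ u v := mul_pos hm (by positivity)
      rw [div_le_iff₀ hq] at h1
      have h2 : quasiDist p γ u v ≤ min 1 (‖u - v‖ ^ γ) * (2 * (wt u + wt v) ^ (p / 2)) :=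
        mul_le_mul_of_nonneg_left (hsqrt u v) hm.le
      have h3 : 0 ≤ min 1 (‖u - v‖ ^ γ) * (wt u + wt v) ^ (p / 2) :=
        mul_nonneg hm.le (Real.rpow_nonneg (zero_le_one.trans (one_le_wt_add u v)) _)
      nlinarith [le_abs_self B, abs_nonneg B, abs_nonneg A]

end Weights

section Comparison

variable {Ω E : Type*} {mΩ : MeasurableSpace Ω} {P : Measure Ω} [IsProbabilityMeasure P]

theorem integral_rpow_le_rpow_integral {g : Ω → ℝ} (hg : ∀ ω, 0 ≤ g ω) (hgi : Integrable g P)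
    {θ : ℝ} (h0 : 0 ≤ θ) (h1 : θ ≤ 1) :
    Integrable (fun ω => g ω ^ θ) P ∧ ∫ ω, g ω ^ θ ∂P ≤ (∫ ω, g ω ∂P) ^ θ := by
  have hi : Integrable (fun ω => g ω ^ θ) P := by
    refine ((integrable_const (1 : ℝ)).add hgi).mono'
      (hgi.1.aemeasurable.pow_const θ).aestronglyMeasurable (ae_of_all _ fun ω => ?_)
    rw [Real.norm_of_nonneg (Real.rpow_nonneg (hg ω) θ), Pi.add_apply]
    rcases le_total (g ω) 1 with h | h
    · linarith [Real.rpow_le_one (hg ω) h h0, hg ω]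
    · have := Real.rpow_le_rpow_of_exponent_le h h1
      rw [Real.rpow_one] at this
      linarith
  exact ⟨hi, (Real.concaveOn_rpow h0 h1).le_map_integral
    (Real.continuous_rpow_const h0).continuousOn isClosed_Ici (ae_of_all _ hg) hgi hi⟩

variable [NormedAddCommGroup E] [MeasurableSpace E] [BorelSpace E]

/-- Jensen's inequality passes from the moment of order `r` to the one of order `a`, and the growth
exponent scales from `b * r` to `b * a`. As the constant is at least 1, its power `a / r` is bounded
by itself, so one constant serves all `a`. -/
theorem integrable_wt_rpow_of_lintegral_le {ν : Measure E} [IsProbabilityMeasure ν]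
    {r L b z : ℝ} (hr : 0 < r) (hL : 0 ≤ L) (hb : 0 ≤ b) (hz : 0 ≤ z)
    (h : ∫⁻ u, ‖u‖ₑ ^ r ∂ν ≤ ENNReal.ofReal (L * (1 + z ^ (b * r)))) {a : ℝ} (ha : 0 ≤ a)
    (har : a ≤ r) :
    Integrable (fun u => wt u ^ a) ν ∧
      ∫ u, wt u ^ a ∂ν ≤ 2 ^ r * (1 + 2 * L) * (1 + z) ^ (b * a) := by
  set D : ℝ := 2 ^ r * (1 + 2 * L) with hD
  have h2r : (1 : ℝ) ≤ 2 ^ r := Real.one_le_rpow one_le_two hr.le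
  have hD1 : 1 ≤ D := by nlinarith
  have hm : Measurable fun u : E => ‖u‖ ^ r := by fun_prop
  have he : ∀ u : E, ‖‖u‖ ^ r‖ₑ = ‖u‖ₑ ^ r := fun u => by
    rw [Real.enorm_of_nonneg (by positivity), ← ofReal_norm,
      ENNReal.ofReal_rpow_of_nonneg (norm_nonneg u) hr.le]
  have hni : Integrable (fun u : E => ‖u‖ ^ r) ν := by
    refine ⟨hm.aestronglyMeasurable, ?_⟩
    rw [hasFiniteIntegral_iff_enorm]
    simp_rw [he]
    exact h.trans_lt ENNReal.ofReal_lt_top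
  have hz0 : 0 ≤ z ^ (b * r) := Real.rpow_nonneg hz _
  have hnb : ∫ u, ‖u‖ ^ r ∂ν ≤ L * (1 + z ^ (b * r)) := by
    rw [integral_eq_lintegral_of_nonneg_ae (ae_of_all _ fun u => by positivity)
      hm.aestronglyMeasurable]
    refine ENNReal.toReal_le_of_le_ofReal (by positivity) ?_
    refine le_trans (le_of_eq (lintegral_congr fun u => ?_)) h
    rw [← he, Real.enorm_of_nonneg (by positivity)]
  have hpt : ∀ u : E, wt u ^ r ≤ 2 ^ r * (1 + ‖u‖ ^ r) := fun u => by
    simpa [wt] using add_rpow_le_two_rpow zero_le_one (norm_nonneg u) hr.le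
  have hri : Integrable (fun u : E => 2 ^ r * (1 + ‖u‖ ^ r)) ν :=
    ((integrable_const (1 : ℝ)).add hni).const_mul _
  have hwi : Integrable (fun u : E => wt u ^ r) ν :=
    hri.mono' (measurable_wt.pow_const r).aestronglyMeasurable (ae_of_all _ fun u => by
      rw [Real.norm_of_nonneg (wt_rpow_nonneg u r)]; exact hpt u)
  have h1z : 1 ≤ (1 + z) ^ (b * r) := Real.one_le_rpow (by linarith) (by positivity)
  have hwb : ∫ u, wt u ^ r ∂ν ≤ D * (1 + z) ^ (b * r) := by
    calc ∫ u, wt u ^ r ∂ν ≤ ∫ u, 2 ^ r * (1 + ‖u‖ ^ r) ∂ν := integral_mono hwi hri hpt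
      _ = 2 ^ r * (1 + ∫ u, ‖u‖ ^ r ∂ν) := by
          rw [integral_const_mul, integral_add (integrable_const _) hni]; simp
      _ ≤ 2 ^ r * (1 + L * (1 + z ^ (b * r))) := by gcongr
      _ ≤ _ := by
          rw [hD, mul_assoc]
          have : z ^ (b * r) ≤ (1 + z) ^ (b * r) :=
            Real.rpow_le_rpow hz (by linarith) (by positivity)
          gcongr
          nlinarith
  have hθ0 : 0 ≤ a / r := by positivity
  have hθ1 : a / r ≤ 1 := by rw [div_le_one hr]; exact har
  have hJ := integral_rpow_le_rpow_integral (fun u => wt_rpow_nonneg u r) hwi hθ0 hθ1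
  have hpow : ∀ u : E, (wt u ^ r) ^ (a / r) = wt u ^ a := fun u => by
    rw [← Real.rpow_mul (wt_pos u).le, mul_div_cancel₀ _ hr.ne']
  simp_rw [hpow] at hJ
  refine ⟨hJ.1, hJ.2.trans ?_⟩
  calc (∫ u, wt u ^ r ∂ν) ^ (a / r) ≤ (D * (1 + z) ^ (b * r)) ^ (a / r) :=
        Real.rpow_le_rpow (integral_nonneg fun u => wt_rpow_nonneg u r) hwb hθ0
    _ = D ^ (a / r) * (1 + z) ^ (b * a) := by
        rw [Real.mul_rpow (by linarith) (by positivity), ← Real.rpow_mul (by linarith)]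
        congr 2
        field_simp
    _ ≤ D * (1 + z) ^ (b * a) := by
        gcongr
        calc D ^ (a / r) ≤ D ^ (1 : ℝ) := Real.rpow_le_rpow_of_exponent_le hD1 hθ1
          _ = D := Real.rpow_one D

variable [SecondCountableTopology E]

/-- Cauchy–Schwarz separates `‖U - V‖^γ` from the weight. Jensen for the concave power `γ` bounds
the first factor by `δ^γ`, which leaves second moments of the weight. -/
theorem abs_integral_sub_integral_le {U V : Ω → E} (hU : Measurable U) (hV : Measurable V)
    {a γ K δ : ℝ} (ha : 0 ≤ a) (hγ : 0 < γ) (hγ1 : γ ≤ 1) (hδ : 0 ≤ δ) {G : E → ℝ}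
    (hG : HolderClass a γ K G)
    (hUi : Integrable (fun ω => wt (U ω) ^ (2 * a)) P)
    (hVi : Integrable (fun ω => wt (V ω) ^ (2 * a)) P)
    (hUV : eLpNorm (fun ω => U ω - V ω) 2 P ≤ ENNReal.ofReal δ) :
    |∫ ω, G (U ω) ∂P - ∫ ω, G (V ω) ∂P| ≤ K * (δ ^ γ * (2 ^ a *
      √(∫ ω, wt (U ω) ^ (2 * a) ∂P + ∫ ω, wt (V ω) ^ (2 * a) ∂P))) := by
  have hK := hG.const_nonneg
  have hGi : ∀ {Z : Ω → E}, Measurable Z → Integrable (fun ω => wt (Z ω) ^ (2 * a)) P →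
      Integrable (fun ω => G (Z ω)) P := by
    intro Z hZ hZi
    refine (hZi.const_mul K).mono' (hG.measurable.comp hZ).aestronglyMeasurable
      (ae_of_all _ fun ω => (hG.growth _).trans ?_)
    exact mul_le_mul_of_nonneg_left (wt_rpow_mono _ (by linarith)) hK
  rw [← integral_sub (hGi hU hUi) (hGi hV hVi)]
  set D : Ω → ℝ := fun ω => ‖U ω - V ω‖ with hD
  have hDm : Measurable D := (hU.sub hV).norm
  set S : Ω → ℝ := fun ω => wt (U ω) + wt (V ω) with hS
  have hSm : Measurable S := (measurable_wt.comp hU).add (measurable_wt.comp hV)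
  have hS0 : ∀ ω, 0 ≤ S ω := fun ω => zero_le_one.trans (one_le_wt_add _ _)
  have hD2 := integral_abs_rpow_le_of_eLpNorm_le (P := P) (f := D) (s := 2) one_lt_two hδ
    hDm.aestronglyMeasurable (by
      rw [ENNReal.ofReal_ofNat, hD, eLpNorm_norm]; exact hUV)
  have hDabs : ∀ ω, |D ω| = D ω := fun ω => abs_of_nonneg (norm_nonneg _)
  simp_rw [hDabs] at hD2
  obtain ⟨hD2i, hD2b⟩ := hD2
  have hJ := integral_rpow_le_rpow_integral (g := fun ω => D ω ^ (2 : ℝ))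
    (fun ω => Real.rpow_nonneg (norm_nonneg _) 2) hD2i hγ.le hγ1
  have hDp : ∀ ω, (D ω ^ (2 : ℝ)) ^ γ = (D ω ^ γ) ^ (2 : ℝ) := fun ω => by
    rw [← Real.rpow_mul (norm_nonneg _), ← Real.rpow_mul (norm_nonneg _), mul_comm]
  simp_rw [hDp] at hJ
  have hSp : ∀ ω, (S ω ^ a) ^ (2 : ℝ) ≤ 2 ^ (2 * a) *
      (wt (U ω) ^ (2 * a) + wt (V ω) ^ (2 * a)) := fun ω => by
    rw [← Real.rpow_mul (hS0 ω), mul_comm a 2]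
    exact wt_add_wt_rpow_le _ _ (by linarith)
  have hRi : Integrable (fun ω => 2 ^ (2 * a) *
      (wt (U ω) ^ (2 * a) + wt (V ω) ^ (2 * a))) P := (hUi.add hVi).const_mul _
  have hSi : Integrable (fun ω => (S ω ^ a) ^ (2 : ℝ)) P := by
    refine hRi.mono' ((hSm.pow_const a).pow_const 2).aestronglyMeasurable (ae_of_all _ fun ω => ?_)
    rw [Real.norm_of_nonneg (Real.rpow_nonneg (Real.rpow_nonneg (hS0 ω) _) _)]
    exact hSp ω
  have hmem : ∀ {g : Ω → ℝ}, Measurable g → (∀ ω, 0 ≤ g ω) →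
      Integrable (fun ω => g ω ^ (2 : ℝ)) P → MemLp g (ENNReal.ofReal 2) P := by
    intro g hg hg0 hgi
    rw [ENNReal.ofReal_ofNat]
    refine (memLp_two_iff_integrable_sq hg.aestronglyMeasurable).2 ?_
    simpa only [Real.rpow_two] using hgi
  have hDγ := hmem (hDm.pow_const γ) (fun ω => Real.rpow_nonneg (norm_nonneg _) _) hJ.1
  have hSa := hmem (hSm.pow_const a) (fun ω => Real.rpow_nonneg (hS0 ω) _) hSi
  have hCS := integral_mul_le_Lp_mul_Lq_of_nonneg (μ := P) Real.HolderConjugate.two_two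
    (ae_of_all _ fun ω => Real.rpow_nonneg (norm_nonneg (U ω - V ω)) γ)
    (ae_of_all _ fun ω => Real.rpow_nonneg (hS0 ω) a) hDγ hSa
  have hprod : Integrable (fun ω => D ω ^ γ * S ω ^ a) P := by
    rw [ENNReal.ofReal_ofNat] at hDγ hSa
    exact hDγ.integrable_mul hSa
  calc |∫ ω, (G (U ω) - G (V ω)) ∂P| ≤ ∫ ω, K * (D ω ^ γ * S ω ^ a) ∂P := by
        rw [← Real.norm_eq_abs]
        refine norm_integral_le_of_norm_le (hprod.const_mul K) (ae_of_all _ fun ω => ?_)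
        refine (hG.holder _ _).trans (mul_le_mul_of_nonneg_left ?_ hK)
        exact mul_le_mul_of_nonneg_right (min_le_right _ _) (Real.rpow_nonneg (hS0 ω) a)
    _ = K * ∫ ω, D ω ^ γ * S ω ^ a ∂P := integral_const_mul _ _
    _ ≤ K * ((∫ ω, (D ω ^ γ) ^ (2 : ℝ) ∂P) ^ (1 / 2 : ℝ) *
          (∫ ω, (S ω ^ a) ^ (2 : ℝ) ∂P) ^ (1 / 2 : ℝ)) := mul_le_mul_of_nonneg_left hCS hK
    _ ≤ _ := by
        refine mul_le_mul_of_nonneg_left (mul_le_mul ?_ ?_ (Real.rpow_nonneg (integral_nonneg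
          fun ω => Real.rpow_nonneg (Real.rpow_nonneg (hS0 ω) _) _) _) (by positivity)) hK
        · calc (∫ ω, (D ω ^ γ) ^ (2 : ℝ) ∂P) ^ (1 / 2 : ℝ) ≤ ((δ ^ (2 : ℝ)) ^ γ) ^ (1 / 2 : ℝ) := by
                refine Real.rpow_le_rpow (integral_nonneg fun ω => Real.rpow_nonneg
                  (Real.rpow_nonneg (norm_nonneg _) _) _) (hJ.2.trans ?_) (by norm_num)
                exact Real.rpow_le_rpow (integral_nonneg fun ω => Real.rpow_nonneg
                  (norm_nonneg _) _) hD2b hγ.le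
            _ = δ ^ γ := by
                rw [← Real.rpow_mul hδ, ← Real.rpow_mul hδ]
                congr 1; ring
        · rw [Real.sqrt_eq_rpow]
          calc (∫ ω, (S ω ^ a) ^ (2 : ℝ) ∂P) ^ (1 / 2 : ℝ)
              ≤ (2 ^ (2 * a) * (∫ ω, wt (U ω) ^ (2 * a) ∂P +
                ∫ ω, wt (V ω) ^ (2 * a) ∂P)) ^ (1 / 2 : ℝ) := by
                refine Real.rpow_le_rpow (integral_nonneg fun ω => Real.rpow_nonneg
                  (Real.rpow_nonneg (hS0 ω) _) _) ?_ (by norm_num)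
                refine (integral_mono hSi hRi hSp).trans (le_of_eq ?_)
                rw [integral_const_mul, integral_add hUi hVi]
            _ = _ := by
                rw [Real.mul_rpow (by positivity) (add_nonneg
                  (integral_nonneg fun ω => wt_rpow_nonneg _ _)
                  (integral_nonneg fun ω => wt_rpow_nonneg _ _)), ← Real.rpow_mul (by norm_num)]
                congr 2
                ring

end Comparison

/-! ### Estimates for the transition kernels -/

section KernelEstimates

variable {Ω E : Type*} {mΩ : MeasurableSpace Ω} {P : Measure Ω} [IsProbabilityMeasure P]
  [NormedAddCommGroup E] [MeasurableSpace E] [BorelSpace E]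

theorem mul_mul_rpow {x y z : ℝ} (hx : 0 ≤ x) (hy : 0 ≤ y) (hz : 0 ≤ z) (γ : ℝ) :
    (x * (y * z)) ^ γ = x ^ γ * (y ^ γ * z ^ γ) := by
  rw [Real.mul_rpow hx (mul_nonneg hy hz), Real.mul_rpow hy hz]

theorem sqrt_add_le_of_le {A B C x y b a : ℝ} (hC : 0 ≤ C) (hx : 0 < x) (hy : 0 < y) (hb : 0 ≤ b)
    (ha : 0 ≤ a) (hA : A ≤ C * x ^ (b * (2 * a))) (hB : B ≤ C * y ^ (b * (2 * a))) :
    √(A + B) ≤ √(2 * C) * (x + y) ^ (b * a) := by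
  have hS : 0 ≤ x + y := by positivity
  have hba : 0 ≤ b * (2 * a) := by positivity
  have h1 : x ^ (b * (2 * a)) ≤ (x + y) ^ (b * (2 * a)) :=
    Real.rpow_le_rpow hx.le (by linarith) hba
  have h2 : y ^ (b * (2 * a)) ≤ (x + y) ^ (b * (2 * a)) :=
    Real.rpow_le_rpow hy.le (by linarith) hba
  calc √(A + B) ≤ √(2 * C * ((x + y) ^ (b * a)) ^ 2) := by
        refine Real.sqrt_le_sqrt ?_
        rw [← Real.rpow_natCast, ← Real.rpow_mul hS, show b * a * ((2 : ℕ) : ℝ) = b * (2 * a) by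
          push_cast; ring]
        nlinarith [mul_le_mul_of_nonneg_left h1 hC, mul_le_mul_of_nonneg_left h2 hC]
    _ = _ := by
        rw [Real.sqrt_mul (by positivity), Real.sqrt_sq (Real.rpow_nonneg hS _)]

theorem rpow_attractive_le (x y : E) {L β γ : ℝ} (hL : 0 ≤ L) (hβ : 0 ≤ β) (hγ : 0 ≤ γ) (ρ : ℝ≥0) :
    (L * ‖x - y‖ * (1 + ‖x‖ ^ β + ‖y‖ ^ β) * ρ) ^ γ ≤
      (3 * L) ^ γ * ((ρ : ℝ) ^ γ * (‖x - y‖ ^ γ * (wt x + wt y) ^ (β * γ))) := by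
  have hS : 0 ≤ wt x + wt y := zero_le_one.trans (one_le_wt_add x y)
  calc (L * ‖x - y‖ * (1 + ‖x‖ ^ β + ‖y‖ ^ β) * ρ) ^ γ
      ≤ (L * ‖x - y‖ * (3 * (wt x + wt y) ^ β) * ρ) ^ γ := by
        refine Real.rpow_le_rpow (by positivity) ?_ hγ
        gcongr
        exact one_add_norm_rpow_le x y hβ
    _ = ((3 * L) * (ρ * (‖x - y‖ * (wt x + wt y) ^ β))) ^ γ := by congr 1; ring
    _ = _ := by
        have := Real.rpow_nonneg hS β
        rw [mul_mul_rpow (by positivity) (by positivity) (by positivity),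
          Real.mul_rpow (norm_nonneg _) this, ← Real.rpow_mul hS]

variable [SecondCountableTopology E]

/-- In the resulting weight exponent, `β * γ` comes from the attractiveness bound raised to the
power `γ`, and `b * a` from the moments of the weight. -/
theorem abs_integral_sub_le_of_attractive {U V : Ω → E} (hU : Measurable U) (hV : Measurable V)
    {a γ L β b C : ℝ} (ha : 0 ≤ a) (hγ : 0 < γ) (hγ1 : γ ≤ 1) (hL : 0 ≤ L) (hβ : 0 ≤ β)
    (hb : 0 ≤ b) (hC : 0 ≤ C) {x y : E} {ρ : ℝ≥0}
    (hUi : Integrable (fun ω => wt (U ω) ^ (2 * a)) P)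
    (hVi : Integrable (fun ω => wt (V ω) ^ (2 * a)) P)
    (hUb : ∫ ω, wt (U ω) ^ (2 * a) ∂P ≤ C * wt x ^ (b * (2 * a)))
    (hVb : ∫ ω, wt (V ω) ^ (2 * a) ∂P ≤ C * wt y ^ (b * (2 * a)))
    (hUV : eLpNorm (fun ω => U ω - V ω) 2 P ≤
      ENNReal.ofReal (L * ‖x - y‖ * (1 + ‖x‖ ^ β + ‖y‖ ^ β) * ρ))
    {K : ℝ} {G : E → ℝ} (hG : HolderClass a γ K G) :
    |∫ ω, G (U ω) ∂P - ∫ ω, G (V ω) ∂P| ≤ K * ((3 * L) ^ γ * (2 ^ a * √(2 * C)) *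
      ((ρ : ℝ) ^ γ * (‖x - y‖ ^ γ * (wt x + wt y) ^ (β * γ + b * a)))) := by
  have hS : 0 < wt x + wt y := zero_lt_one.trans_le (one_le_wt_add x y)
  refine (abs_integral_sub_integral_le hU hV ha hγ hγ1 (by positivity) hG hUi hVi hUV).trans
    (mul_le_mul_of_nonneg_left ?_ hG.const_nonneg)
  calc _ ≤ ((3 * L) ^ γ * ((ρ : ℝ) ^ γ * (‖x - y‖ ^ γ * (wt x + wt y) ^ (β * γ)))) *
        (2 ^ a * (√(2 * C) * (wt x + wt y) ^ (b * a))) := by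
        gcongr
        · exact rpow_attractive_le x y hL hβ hγ.le ρ
        · exact sqrt_add_le_of_le hC (wt_pos x) (wt_pos y) hb ha hUb hVb
    _ = _ := by
        rw [Real.rpow_add hS]
        ring

variable {ℱ : Filtration ℝ≥0 mΩ} {X : ℝ≥0 → ℝ≥0 → E → Ω → E} {τ : ℕ → ℝ≥0}
  {Y : ℕ → ℕ → E → Ω → E}

section ProcessEstimates

variable {r r' L₁ γ₁ β L₂ : ℝ} {ρ : ℝ≥0 → ℝ≥0} {l l' L₃ : ℝ}

omit [SecondCountableTopology E] in
theorem ProcessAssumption.moment_wt (hX : IsMarkovProcess P ℱ X)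
    (h₁ : ProcessAssumption P X r r' L₁ γ₁ β L₂ ρ l l' L₃) :
    ∃ C, 0 ≤ C ∧ ∀ a, 0 ≤ a → a ≤ r → ∀ t x,
      Integrable (fun u => wt u ^ a) (procKernel hX t x) ∧
        ∫ u, wt u ^ a ∂(procKernel hX t x) ≤ C * wt x ^ (r' * a) := by
  have hL := h₁.L₁_pos
  refine ⟨2 ^ r * (1 + 2 * L₁), by positivity, fun a ha har t x => ?_⟩
  refine integrable_wt_rpow_of_lintegral_le (by linarith [h₁.two_le_r]) hL.le
    (by linarith [h₁.one_le_r']) (norm_nonneg x) ?_ ha har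
  rw [procKernel_apply, lintegral_map (by fun_prop) (hX.measurable zero_le x)]
  exact h₁.moment x t

theorem ProcessAssumption.holder (hX : IsMarkovProcess P ℱ X)
    (h₁ : ProcessAssumption P X r r' L₁ γ₁ β L₂ ρ l l' L₃) {a γ : ℝ} (ha : 0 ≤ a)
    (har : 2 * a ≤ r) (hγ : 0 < γ) (hγ1 : γ ≤ 1) :
    ∃ C, 0 ≤ C ∧ ∀ K G, HolderClass a γ K G → ∀ t x y,
      |∫ u, G u ∂(procKernel hX t x) - ∫ u, G u ∂(procKernel hX t y)| ≤
        K * (C * ((ρ t : ℝ) ^ γ * (‖x - y‖ ^ γ * (wt x + wt y) ^ (β * γ + r' * a)))) := by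
  obtain ⟨C, hC, hmom⟩ := h₁.moment_wt hX
  have hL := h₁.L₂_pos
  refine ⟨(3 * L₂) ^ γ * (2 ^ a * √(2 * C)), by positivity, fun K G hG t x y => ?_⟩
  have hm : ∀ z, Measurable (X 0 t z) := hX.measurable zero_le
  have hw : Measurable fun u : E => wt u ^ (2 * a) := measurable_wt.pow_const _
  have h := hmom (2 * a) (by linarith) har t
  simp only [procKernel_apply] at h ⊢
  have hi : ∀ z, Integrable (fun ω => wt (X 0 t z ω) ^ (2 * a)) P := fun z =>
    (integrable_map_measure hw.aestronglyMeasurable (hm z).aemeasurable).1 (h z).1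
  have hb : ∀ z, ∫ ω, wt (X 0 t z ω) ^ (2 * a) ∂P ≤ C * wt z ^ (r' * (2 * a)) := fun z => by
    rw [← integral_map (hm z).aemeasurable hw.aestronglyMeasurable]
    exact (h z).2
  rw [integral_map (hm x).aemeasurable hG.measurable.aestronglyMeasurable,
    integral_map (hm y).aemeasurable hG.measurable.aestronglyMeasurable]
  exact abs_integral_sub_le_of_attractive (hm x) (hm y) ha hγ hγ1 hL.le h₁.β_nonneg
    (by linarith [h₁.one_le_r']) hC (hi x) (hi y) (hb x) (hb y) (h₁.attractive x y t) hG

theorem ProcessAssumption.time_regular (hX : IsMarkovProcess P ℱ X)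
    (h₁ : ProcessAssumption P X r r' L₁ γ₁ β L₂ ρ l l' L₃) {a γ : ℝ} (ha : 0 ≤ a)
    (har : 2 * a ≤ r) (hγ : 0 < γ) (hγ1 : γ ≤ 1) :
    ∃ C, 0 ≤ C ∧ ∀ K G, HolderClass a γ K G → ∀ t x,
      |∫ u, G u ∂(procKernel hX t x) - G x| ≤
        K * (C * ((t : ℝ) ^ (l' * γ) * wt x ^ (l * γ + r' * a))) := by
  obtain ⟨C, hC, hmom⟩ := h₁.moment_wt hX
  have hL := h₁.L₃_pos
  have hr' := h₁.one_le_r'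
  refine ⟨(2 * L₃) ^ γ * (2 ^ a * √(C + 1)), by positivity, fun K G hG t x => ?_⟩
  have hm : Measurable (X 0 t x) := hX.measurable zero_le x
  have hw : Measurable fun u : E => wt u ^ (2 * a) := measurable_wt.pow_const _
  have h := hmom (2 * a) (by linarith) har t x
  rw [procKernel_apply] at h ⊢
  rw [integral_map hm.aemeasurable hw.aestronglyMeasurable] at h
  have hi : Integrable (fun ω => wt (X 0 t x ω) ^ (2 * a)) P :=
    (integrable_map_measure hw.aestronglyMeasurable hm.aemeasurable).1 h.1
  rw [integral_map hm.aemeasurable hG.measurable.aestronglyMeasurable]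
  have h0 : G x = ∫ _, G x ∂P := by simp
  rw [h0]
  refine (abs_integral_sub_integral_le hm measurable_const ha hγ hγ1
    (by have := h₁.L₃_pos; positivity) hG hi (integrable_const _) (h₁.regular x t)).trans
    (mul_le_mul_of_nonneg_left ?_ hG.const_nonneg)
  have hl := one_le_wt_rpow x h₁.l_nonneg
  have hd : (L₃ * (1 + ‖x‖ ^ l) * (t : ℝ) ^ l') ^ γ ≤
      (2 * L₃) ^ γ * ((t : ℝ) ^ (l' * γ) * wt x ^ (l * γ)) := by
    calc _ ≤ ((2 * L₃) * ((t : ℝ) ^ l' * wt x ^ l)) ^ γ := by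
          refine Real.rpow_le_rpow (by positivity) ?_ hγ.le
          have := norm_rpow_le_wt_rpow x h₁.l_nonneg
          have ht : 0 ≤ (t : ℝ) ^ l' := by positivity
          calc L₃ * (1 + ‖x‖ ^ l) * (t : ℝ) ^ l' ≤ L₃ * (2 * wt x ^ l) * (t : ℝ) ^ l' := by
                gcongr
                linarith
            _ = _ := by ring
      _ = _ := by
          have := wt_rpow_nonneg x l
          rw [mul_mul_rpow (by positivity) (by positivity) (by positivity),
            ← Real.rpow_mul (by positivity), ← Real.rpow_mul (wt_pos x).le]
  have hs : √(∫ ω, wt (X 0 t x ω) ^ (2 * a) ∂P + ∫ _, wt x ^ (2 * a) ∂P) ≤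
      √(C + 1) * wt x ^ (r' * a) := by
    have h2 : wt x ^ (2 * a) ≤ wt x ^ (r' * (2 * a)) := wt_rpow_mono x (by nlinarith)
    have h3 : ∫ _, wt x ^ (2 * a) ∂P = wt x ^ (2 * a) := by simp
    rw [h3]
    calc _ ≤ √((C + 1) * (wt x ^ (r' * a)) ^ 2) := by
          refine Real.sqrt_le_sqrt ?_
          rw [← Real.rpow_natCast (wt x ^ (r' * a)), ← Real.rpow_mul (wt_pos x).le,
            show r' * a * ((2 : ℕ) : ℝ) = r' * (2 * a) by push_cast; ring]
          linarith [h.2]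
      _ = _ := by rw [Real.sqrt_mul (by positivity), Real.sqrt_sq (wt_rpow_nonneg x _)]
  have hwl := wt_rpow_nonneg x (l * γ)
  calc _ ≤ ((2 * L₃) ^ γ * ((t : ℝ) ^ (l' * γ) * wt x ^ (l * γ))) *
        (2 ^ a * (√(C + 1) * wt x ^ (r' * a))) := by gcongr
    _ = _ := by rw [Real.rpow_add (wt_pos x)]; ring

end ProcessEstimates

section ChainEstimates

variable {q q' L₄ κ L₅ : ℝ} {ρτ : ℝ≥0 → ℝ≥0}

omit [SecondCountableTopology E] in
theorem SchemeAssumption.moment_wt (hY : IsMarkovChain P ℱ τ Y)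
    (h₂ : SchemeAssumption P τ Y q q' L₄ κ L₅ ρτ) :
    ∃ C, 0 ≤ C ∧ ∀ a, 0 ≤ a → a ≤ q → ∀ m n x, m ≤ n →
      Integrable (fun u => wt u ^ a) (chainKernel hY m n x) ∧
        ∫ u, wt u ^ a ∂(chainKernel hY m n x) ≤ C * wt x ^ (q' * a) := by
  have hL := h₂.L₄_pos
  refine ⟨2 ^ q * (1 + 2 * L₄), by positivity, fun a ha haq m n x hmn => ?_⟩
  refine integrable_wt_rpow_of_lintegral_le (by linarith [h₂.two_le_q]) hL.le
    (by linarith [h₂.one_le_q']) (norm_nonneg x) ?_ ha haq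
  rw [chainKernel_apply hY hmn, lintegral_map (by fun_prop) (hY.measurable hmn x)]
  exact h₂.moment x m n hmn

theorem SchemeAssumption.holder (hY : IsMarkovChain P ℱ τ Y)
    (h₂ : SchemeAssumption P τ Y q q' L₄ κ L₅ ρτ) {a γ : ℝ} (ha : 0 ≤ a)
    (haq : 2 * a ≤ q) (hγ : 0 < γ) (hγ1 : γ ≤ 1) :
    ∃ C, 0 ≤ C ∧ ∀ K G, HolderClass a γ K G → ∀ m n x y, m ≤ n →
      |∫ u, G u ∂(chainKernel hY m n x) - ∫ u, G u ∂(chainKernel hY m n y)| ≤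
        K * (C * ((ρτ (grid τ n - grid τ m) : ℝ) ^ γ *
          (‖x - y‖ ^ γ * (wt x + wt y) ^ (κ * γ + q' * a)))) := by
  obtain ⟨C, hC, hmom⟩ := h₂.moment_wt hY
  have hL := h₂.L₅_pos
  refine ⟨(3 * L₅) ^ γ * (2 ^ a * √(2 * C)), by positivity, fun K G hG m n x y hmn => ?_⟩
  have hm : ∀ z, Measurable (Y m n z) := hY.measurable hmn
  have hw : Measurable fun u : E => wt u ^ (2 * a) := measurable_wt.pow_const _
  have h := fun z => hmom (2 * a) (by linarith) haq m n z hmn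
  simp only [chainKernel_apply hY hmn] at h ⊢
  have hi : ∀ z, Integrable (fun ω => wt (Y m n z ω) ^ (2 * a)) P := fun z =>
    (integrable_map_measure hw.aestronglyMeasurable (hm z).aemeasurable).1 (h z).1
  have hb : ∀ z, ∫ ω, wt (Y m n z ω) ^ (2 * a) ∂P ≤ C * wt z ^ (q' * (2 * a)) := fun z => by
    rw [← integral_map (hm z).aemeasurable hw.aestronglyMeasurable]
    exact (h z).2
  rw [integral_map (hm x).aemeasurable hG.measurable.aestronglyMeasurable,
    integral_map (hm y).aemeasurable hG.measurable.aestronglyMeasurable]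
  exact abs_integral_sub_le_of_attractive (hm x) (hm y) ha hγ hγ1 hL.le h₂.κ_nonneg
    (by linarith [h₂.one_le_q']) hC (hi x) (hi y) (hb x) (hb y) (h₂.attractive x y m n hmn) hG

end ChainEstimates

/-- The weight moments stay under the root and their integrability is a hypothesis, because `2 * a`
may exceed `r`. They are made finite later by integrating over `μ`, where invariance replaces the
moment bound on `X`. -/
theorem ErrorAssumption.abs_integral_sub_le (hX : IsMarkovProcess P ℱ X)
    (hY : IsMarkovChain P ℱ τ Y) {r' q' α L₆ : ℝ}
    (h₃ : ErrorAssumption P X τ Y r' q' α L₆) (hr' : 0 ≤ r') {a γ : ℝ} (ha : 0 ≤ a)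
    (hγ : 0 < γ) (hγ1 : γ ≤ 1) :
    ∃ C, 0 ≤ C ∧ ∀ K G, HolderClass a γ K G → ∀ m n x, 1 ≤ m → m ≤ n →
      Integrable (fun u => wt u ^ (2 * a)) (procKernel hX (grid τ n - grid τ m) x) →
      Integrable (fun u => wt u ^ (2 * a)) (chainKernel hY m n x) →
      |∫ u, G u ∂(procKernel hX (grid τ n - grid τ m) x) - ∫ u, G u ∂(chainKernel hY m n x)| ≤
        K * (C * ((τ n : ℝ) ^ (γ * α) * (wt x ^ (max r' q' * γ) *
          √(∫ u, wt u ^ (2 * a) ∂(procKernel hX (grid τ n - grid τ m) x) +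
            ∫ u, wt u ^ (2 * a) ∂(chainKernel hY m n x))))) := by
  have hL := h₃.L₆_pos
  refine ⟨(2 * L₆) ^ γ * 2 ^ a, by positivity, fun K G hG m n x hm hmn hi₁ hi₂ => ?_⟩
  have hgr := grid_mono τ hmn
  have hmX : Measurable (X (grid τ m) (grid τ n) x) := hX.measurable hgr x
  have hmY : Measurable (Y m n x) := hY.measurable hmn x
  have hw : Measurable fun u : E => wt u ^ (2 * a) := measurable_wt.pow_const _
  rw [← procKernel_shift hX hgr, chainKernel_apply hY hmn] at *
  rw [integral_map hmX.aemeasurable hG.measurable.aestronglyMeasurable,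
    integral_map hmY.aemeasurable hG.measurable.aestronglyMeasurable,
    integral_map hmX.aemeasurable hw.aestronglyMeasurable,
    integral_map hmY.aemeasurable hw.aestronglyMeasurable]
  refine (abs_integral_sub_integral_le hmX hmY ha hγ hγ1 (by positivity) hG
    ((integrable_map_measure hw.aestronglyMeasurable hmX.aemeasurable).1 hi₁)
    ((integrable_map_measure hw.aestronglyMeasurable hmY.aemeasurable).1 hi₂)
    (h₃.error x m n hm hmn)).trans (mul_le_mul_of_nonneg_left ?_ hG.const_nonneg)
  have hd0 : 0 ≤ max r' q' := hr'.trans (le_max_left _ _)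
  have hd : (L₆ * (1 + ‖x‖ ^ max r' q') * (τ n : ℝ) ^ α) ^ γ ≤
      (2 * L₆) ^ γ * ((τ n : ℝ) ^ (γ * α) * wt x ^ (max r' q' * γ)) := by
    calc _ ≤ ((2 * L₆) * ((τ n : ℝ) ^ α * wt x ^ max r' q')) ^ γ := by
          refine Real.rpow_le_rpow (by positivity) ?_ hγ.le
          have h1 := norm_rpow_le_wt_rpow x hd0
          have h2 := one_le_wt_rpow x hd0
          calc L₆ * (1 + ‖x‖ ^ max r' q') * (τ n : ℝ) ^ α ≤
              L₆ * (2 * wt x ^ max r' q') * (τ n : ℝ) ^ α := by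
                gcongr
                linarith
            _ = _ := by ring
      _ = _ := by
          have := wt_rpow_nonneg x (max r' q')
          rw [mul_mul_rpow (by positivity) (by positivity) (by positivity),
            ← Real.rpow_mul (by positivity), ← Real.rpow_mul (wt_pos x).le,
            mul_comm α γ]
  calc _ ≤ ((2 * L₆) ^ γ * ((τ n : ℝ) ^ (γ * α) * wt x ^ (max r' q' * γ))) *
        (2 ^ a * √(∫ ω, wt (X (grid τ m) (grid τ n) x ω) ^ (2 * a) ∂P +
          ∫ ω, wt (Y m n x ω) ^ (2 * a) ∂P)) := by gcongr
    _ = _ := by ring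

end KernelEstimates

/-! ### Existence, uniqueness and moments of the invariant measure -/

section WeakLimits

variable {E : Type*} [NormedAddCommGroup E] [MeasurableSpace E]

theorem holderClass_of_lipschitz {g : E → ℝ} (hg : Measurable g) {M C L : ℝ}
    (hM : ∀ u, |g u| ≤ M) (hC : ∀ u v, |g u - g v| ≤ C) (hL : ∀ u v, |g u - g v| ≤ L * ‖u - v‖) :
    HolderClass 0 1 (max M (max C L)) g := by
  refine ⟨hg, fun u => ?_, fun u v => ?_⟩
  · rw [Real.rpow_zero, mul_one]
    exact (hM u).trans (le_max_left _ _)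
  · rw [Real.rpow_zero, mul_one, Real.rpow_one]
    have h1 : C ≤ max M (max C L) := (le_max_left _ _).trans (le_max_right _ _)
    have h2 : L ≤ max M (max C L) := (le_max_right _ _).trans (le_max_right _ _)
    rcases le_total 1 ‖u - v‖ with h | h
    · rw [min_eq_left h, mul_one]
      exact (hC u v).trans h1
    · rw [min_eq_right h]
      exact (hL u v).trans (mul_le_mul_of_nonneg_right h2 (norm_nonneg _))

theorem exists_holderClass_of_lipschitzWith [BorelSpace E] {g : E → ℝ}
    (hb : ∃ C : ℝ, ∀ x y, dist (g x) (g y) ≤ C) (hl : ∃ L, LipschitzWith L g) :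
    ∃ K, HolderClass 0 1 K g := by
  obtain ⟨C, hC⟩ := hb
  obtain ⟨L, hL⟩ := hl
  refine ⟨_, holderClass_of_lipschitz hL.continuous.measurable (M := |g 0| + C) (C := C) (L := L)
    (fun u => ?_) (fun u v => hC u v) (fun u v => ?_)⟩
  · have := hC u 0
    rw [Real.dist_eq] at this
    have h2 := abs_add_le (g u - g 0) (g 0)
    rw [sub_add_cancel] at h2
    linarith
  · rw [← Real.dist_eq, ← dist_eq_norm]
    exact hL.dist_le_mul u v

variable [BorelSpace E]

theorem HolderClass.continuous {a γ K : ℝ} {G : E → ℝ} (hG : HolderClass a γ K G) (hγ : 0 < γ)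
    (ha : 0 ≤ a) : Continuous G := by
  refine continuous_iff_continuousAt.2 fun u => ?_
  rw [ContinuousAt, tendsto_iff_dist_tendsto_zero]
  refine squeeze_zero (fun _ => dist_nonneg) (fun v => ?_)
    (g := fun v => K * (‖v - u‖ ^ γ * (wt v + wt u) ^ a)) ?_
  · rw [Real.dist_eq]
    refine (hG.holder v u).trans (mul_le_mul_of_nonneg_left ?_ hG.const_nonneg)
    exact mul_le_mul_of_nonneg_right (min_le_right _ _)
      (Real.rpow_nonneg (zero_le_one.trans (one_le_wt_add v u)) _)
  · have h : Continuous fun v : E => K * (‖v - u‖ ^ γ * (wt v + wt u) ^ a) := by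
      have h1 : Continuous fun v : E => ‖v - u‖ ^ γ :=
        (Real.continuous_rpow_const hγ.le).comp (by fun_prop)
      have h2 : Continuous fun v : E => (wt v + wt u) ^ a :=
        (Real.continuous_rpow_const ha).comp (continuous_wt.add continuous_const)
      exact continuous_const.mul (h1.mul h2)
    have := h.tendsto u
    simpa [Real.zero_rpow hγ.ne'] using this

theorem HolderClass.integrable_of_zero {γ K : ℝ} {G : E → ℝ} (hG : HolderClass 0 γ K G)
    (ν : Measure E) [IsProbabilityMeasure ν] : Integrable G ν :=
  (integrable_const K).mono' hG.measurable.aestronglyMeasurable (ae_of_all _ fun u => by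
    simpa using hG.growth u)

section Tightness

variable [TopologicalSpace.SeparableSpace E]

/-- Finitely many of the measures are handled together by separability. The later ones are compared
with `ν k` through a Lipschitz function that vanishes on the finite union `A N` of `δ`-balls and
equals 1 off the `2δ`-balls. -/
theorem exists_finite_cover_of_cauchy {ν : ℕ → Measure E} [∀ n, IsProbabilityMeasure (ν n)]
    {ε : ℕ → ℝ} (hε : Tendsto ε atTop (𝓝 0))
    (h : ∀ K g, HolderClass 0 1 K g → ∀ k m, |∫ u, g u ∂(ν (k + m)) - ∫ u, g u ∂(ν k)| ≤ K * ε k)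
    {δ θ : ℝ} (hδ : 0 < δ) (hθ : 0 < θ) :
    ∃ F : Finset E, ∀ n, (ν n).real (⋃ x ∈ F, Metric.closedBall x (2 * δ))ᶜ ≤ θ := by
  classical
  set d := TopologicalSpace.denseSeq E
  set A : ℕ → Set E := fun N => ⋃ i ∈ Finset.range (N + 1), Metric.closedBall (d i) δ with hA
  have hAcl : ∀ N, IsClosed (A N) := fun N =>
    isClosed_biUnion_finset fun i _ => Metric.isClosed_closedBall
  have hAm : ∀ N, MeasurableSet (A N) := fun N => (hAcl N).measurableSet
  have hAmono : Monotone A := by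
    intro M N hMN
    exact Set.biUnion_subset_biUnion_left fun i hi => by
      have := Finset.mem_range.1 hi
      exact Finset.mem_range.2 (by omega)
  have hAU : ⋃ N, A N = Set.univ := by
    refine Set.eq_univ_of_forall fun x => ?_
    obtain ⟨i, hi⟩ := (TopologicalSpace.denseRange_denseSeq E).exists_dist_lt x hδ
    exact Set.mem_iUnion.2 ⟨i, Set.mem_biUnion (Finset.self_mem_range_succ i)
      (Metric.mem_closedBall.2 hi.le)⟩
  have hlim : ∀ n, Tendsto (fun N => (ν n).real (A N)ᶜ) atTop (𝓝 0) := by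
    intro n
    have h1 := tendsto_measure_iUnion_atTop (μ := ν n) hAmono
    rw [hAU, measure_univ] at h1
    have h2 := (ENNReal.tendsto_toReal ENNReal.one_ne_top).comp h1
    have h3 := h2.const_sub 1
    rw [ENNReal.toReal_one, sub_self] at h3
    refine h3.congr fun N => ?_
    rw [probReal_compl_eq_one_sub (hAm N)]
    rfl
  -- The constant of the truncated distance `min 1 (dist(·, A N) / δ)`: its bound, its oscillation
  -- and its Lipschitz constant.
  set K : ℝ := max 1 (max 1 δ⁻¹) with hK
  obtain ⟨k, hk⟩ : ∃ k, K * ε k ≤ θ / 2 := by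
    have h1 := hε.const_mul K
    rw [mul_zero] at h1
    exact (h1.eventually_le_const (by positivity : 0 < θ / 2)).exists
  obtain ⟨N, hN⟩ : ∃ N, ∀ n ∈ Finset.range (k + 1), (ν n).real (A N)ᶜ ≤ θ / 2 := by
    refine Eventually.exists (f := atTop) ?_
    rw [Filter.eventually_all_finset]
    exact fun n _ => (hlim n).eventually_le_const (by positivity)
  refine ⟨(Finset.range (N + 1)).image d, fun n => ?_⟩
  set B : Set E := ⋃ x ∈ (Finset.range (N + 1)).image d, Metric.closedBall x (2 * δ) with hB
  have hAne : (A N).Nonempty :=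
    ⟨d 0, Set.mem_biUnion (Finset.mem_range.2 N.succ_pos) (Metric.mem_closedBall_self hδ.le)⟩
  have hBA : ∀ u ∈ Bᶜ, δ ≤ Metric.infDist u (A N) := by
    intro u hu
    refine (Metric.le_infDist hAne).2 fun y hy => ?_
    by_contra hlt
    refine hu ?_
    simp only [hA, Set.mem_iUnion] at hy
    obtain ⟨i, hi, hy⟩ := hy
    refine Set.mem_biUnion (Finset.mem_coe.2 (Finset.mem_image_of_mem d hi)) ?_
    rw [Metric.mem_closedBall] at hy ⊢
    have := dist_triangle u y (d i)
    linarith [not_le.1 hlt]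
  rcases le_or_gt k n with hkn | hkn
  · set g : E → ℝ := fun u => min 1 (δ⁻¹ * Metric.infDist u (A N)) with hg
    have hg0 : ∀ u, 0 ≤ g u := fun u =>
      le_min zero_le_one (mul_nonneg (by positivity) Metric.infDist_nonneg)
    have hg1 : ∀ u, g u ≤ 1 := fun u => min_le_left _ _
    have hgc : Continuous g := continuous_const.min
      (continuous_const.mul (Metric.continuous_infDist_pt _))
    have hgH : HolderClass 0 1 K g := by
      refine holderClass_of_lipschitz hgc.measurable (fun u => ?_) (fun u v => ?_) fun u v => ?_
      · rw [abs_of_nonneg (hg0 u)]; exact hg1 u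
      · rw [abs_le]; constructor <;> linarith [hg0 u, hg1 u, hg0 v, hg1 v]
      · refine (abs_min_sub_min_le_max _ _ _ _).trans ?_
        rw [sub_self, abs_zero, ← mul_sub, abs_mul, abs_of_pos (inv_pos.2 hδ)]
        refine max_le (by positivity) (mul_le_mul_of_nonneg_left ?_ (by positivity))
        have := (Metric.lipschitz_infDist_pt (A N)).dist_le_mul u v
        rwa [NNReal.coe_one, one_mul, Real.dist_eq, dist_eq_norm] at this
    have hgi : ∀ n, Integrable g (ν n) := fun n => hgH.integrable_of_zero _
    have hgk : ∫ u, g u ∂(ν k) ≤ θ / 2 := by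
      calc ∫ u, g u ∂(ν k) ≤ ∫ u, (A N)ᶜ.indicator 1 u ∂(ν k) := by
            refine integral_mono (hgi k) ((integrable_const (1 : ℝ)).indicator (hAm N).compl)
              fun u => ?_
            by_cases hu : u ∈ A N
            · simp [hg, hu, Metric.infDist_zero_of_mem hu]
            · simp [hu, hg1 u]
        _ = (ν k).real (A N)ᶜ := integral_indicator_one (hAm N).compl
        _ ≤ _ := hN k (Finset.self_mem_range_succ k)
    have hBm : MeasurableSet Bᶜ := (isClosed_biUnion_finset fun i _ =>
      Metric.isClosed_closedBall).measurableSet.compl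
    have hkm := h K g hgH k (n - k)
    rw [Nat.add_sub_cancel' hkn] at hkm
    calc (ν n).real Bᶜ = ∫ u, Bᶜ.indicator 1 u ∂(ν n) := (integral_indicator_one hBm).symm
      _ ≤ ∫ u, g u ∂(ν n) := by
          refine integral_mono ((integrable_const (1 : ℝ)).indicator hBm) (hgi n) fun u => ?_
          by_cases hu : u ∈ Bᶜ
          · rw [Set.indicator_of_mem hu]
            refine le_min le_rfl ?_
            rw [Pi.one_apply, ← inv_mul_cancel₀ hδ.ne']
            exact mul_le_mul_of_nonneg_left (hBA u hu) (by positivity)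
          · rw [Set.indicator_of_notMem hu]
            exact hg0 u
      _ ≤ θ := by linarith [(abs_le.1 hkm).2]
  · refine (measureReal_mono ?_ (measure_ne_top _ _)).trans
      ((hN n (Finset.mem_range.2 (by omega))).trans (by linarith))
    refine Set.compl_subset_compl.2 fun u hu => ?_
    by_contra huB
    have := hBA u huB
    rw [Metric.infDist_zero_of_mem hu] at this
    linarith

/-- Intersecting finite unions of closed balls with radii tending to 0 gives a closed, totally
bounded set. The mass lost at level `j` is at most `θ j`, and these losses sum to less than the
prescribed tolerance. -/
theorem isTightMeasureSet_of_cauchy [CompleteSpace E] {ν : ℕ → Measure E}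
    [∀ n, IsProbabilityMeasure (ν n)]
    {ε : ℕ → ℝ} (hε : Tendsto ε atTop (𝓝 0))
    (h : ∀ K g, HolderClass 0 1 K g → ∀ k m, |∫ u, g u ∂(ν (k + m)) - ∫ u, g u ∂(ν k)| ≤ K * ε k) :
    IsTightMeasureSet (Set.range ν) := by
  rw [isTightMeasureSet_iff_exists_isCompact_measure_compl_le]
  intro η hη
  obtain ⟨θ, hθ, hθsum⟩ := ENNReal.exists_pos_sum_of_countable hη.ne' ℕ
  have hδ : ∀ j : ℕ, (0 : ℝ) < 1 / ((j : ℝ) + 1) := fun j => by positivity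
  choose F hF using fun j : ℕ => exists_finite_cover_of_cauchy hε h (hδ j)
    (NNReal.coe_pos.2 (hθ j))
  set B : ℕ → Set E := fun j => ⋃ x ∈ F j, Metric.closedBall x (2 * (1 / ((j : ℝ) + 1)))
  refine ⟨⋂ j, B j, ?_, ?_⟩
  · have hcl : IsClosed (⋂ j, B j) := isClosed_iInter fun j =>
      isClosed_biUnion_finset fun i _ => Metric.isClosed_closedBall
    refine TotallyBounded.isCompact_of_isClosed ?_ hcl
    refine Metric.totallyBounded_iff.2 fun r hr => ?_
    obtain ⟨j, hj⟩ := exists_nat_one_div_lt (show 0 < r / 2 by linarith)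
    refine ⟨F j, (F j).finite_toSet, (Set.iInter_subset _ j).trans ?_⟩
    refine Set.biUnion_mono subset_rfl fun x _ => Metric.closedBall_subset_ball ?_
    linarith
  · rintro _ ⟨n, rfl⟩
    rw [Set.compl_iInter]
    refine (measure_iUnion_le _).trans (le_trans (ENNReal.tsum_le_tsum fun j => ?_) hθsum.le)
    have := ENNReal.ofReal_le_ofReal (hF j n)
    rwa [ofReal_measureReal, ENNReal.ofReal_coe_nnreal] at this

/-- Prokhorov's theorem yields a convergent subsequence. Against each bounded Lipschitz function the
full sequence is Cauchy, so it has the same limit. -/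
theorem exists_tendsto_of_cauchy [CompleteSpace E] {ν : ℕ → ProbabilityMeasure E}
    {ε : ℕ → ℝ} (hε : Tendsto ε atTop (𝓝 0))
    (h : ∀ K g, HolderClass 0 1 K g → ∀ k m,
      |∫ u, g u ∂(ν (k + m) : Measure E) - ∫ u, g u ∂(ν k : Measure E)| ≤ K * ε k) :
    ∃ μ : ProbabilityMeasure E, Tendsto ν atTop (𝓝 μ) := by
  have htight := isTightMeasureSet_of_cauchy (ν := fun n => (ν n : Measure E)) hε h
  have hcomp := isCompact_closure_of_isTightMeasureSet (S := Set.range ν) (by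
    convert htight using 1
    ext ρ
    simp)
  obtain ⟨μ, -, φ, hφ, hμ⟩ := hcomp.isSeqCompact (fun n => subset_closure (Set.mem_range_self n))
  refine ⟨μ, tendsto_iff_forall_lipschitz_integral_tendsto.2 fun g hb hl => ?_⟩
  have h1 := tendsto_iff_forall_lipschitz_integral_tendsto.1 hμ g hb hl
  obtain ⟨K, hK⟩ := exists_holderClass_of_lipschitzWith hb hl
  refine tendsto_nhds_of_cauchySeq_of_subseq ?_ hφ.tendsto_atTop h1
  have hKε := hε.const_mul K
  rw [mul_zero] at hKε
  refine Metric.cauchySeq_iff'.2 fun r hr => ?_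
  obtain ⟨N, hN⟩ := (hKε.eventually_lt_const hr).exists
  refine ⟨N, fun n hn => ?_⟩
  have h2 := h K g hK N (n - N)
  rw [Nat.add_sub_cancel' hn] at h2
  rw [Real.dist_eq]
  exact h2.trans_lt hN

end Tightness

/-- Fatou's lemma for weak convergence, via the portmanteau inequality on open sets. -/
theorem integrable_wt_rpow_of_tendsto {ν : ℕ → ProbabilityMeasure E}
    {μ : ProbabilityMeasure E}
    (hν : Tendsto ν atTop (𝓝 μ)) {a C : ℝ} (ha : 0 ≤ a)
    (hi : ∀ n, Integrable (fun u => wt u ^ a) (ν n : Measure E))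
    (hC : ∀ n, ∫ u, wt u ^ a ∂(ν n : Measure E) ≤ C) :
    Integrable (fun u => wt u ^ a) (μ : Measure E) := by
  have hc : Continuous fun u : E => wt u ^ a := (Real.continuous_rpow_const ha).comp continuous_wt
  refine ⟨hc.measurable.aestronglyMeasurable, ?_⟩
  rw [hasFiniteIntegral_iff_ofReal (ae_of_all _ fun u => wt_rpow_nonneg u a)]
  refine (lintegral_le_liminf_lintegral_of_forall_isOpen_measure_le_liminf_measure hc
    (fun u => wt_rpow_nonneg u a) (fun G hG =>
      ProbabilityMeasure.le_liminf_measure_open_of_tendsto hν hG)).trans_lt ?_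
  refine lt_of_le_of_lt (b := ENNReal.ofReal C) ?_ ENNReal.ofReal_lt_top
  refine liminf_le_of_frequently_le' (Eventually.frequently (Eventually.of_forall fun n => ?_))
  rw [← ofReal_integral_eq_lintegral_ofReal (hi n) (ae_of_all _ fun u => wt_rpow_nonneg u a)]
  exact ENNReal.ofReal_le_ofReal (hC n)

end WeakLimits

section InvariantMeasure

variable {Ω E : Type*} {mΩ : MeasurableSpace Ω} {P : Measure Ω} [IsProbabilityMeasure P]
  [NormedAddCommGroup E] [MeasurableSpace E] [BorelSpace E]

theorem ProbabilityMeasure.ext_of_holderClass {μ ν : ProbabilityMeasure E}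
    (h : ∀ K g, HolderClass 0 1 K g → ∫ u, g u ∂(μ : Measure E) = ∫ u, g u ∂(ν : Measure E)) :
    μ = ν := by
  have h1 : Tendsto (fun _ : ℕ => μ) atTop (𝓝 ν) := by
    refine tendsto_iff_forall_lipschitz_integral_tendsto.2 fun g hb hl => ?_
    obtain ⟨K, hK⟩ := exists_holderClass_of_lipschitzWith hb hl
    rw [h K g hK]
    exact tendsto_const_nhds
  exact tendsto_nhds_unique tendsto_const_nhds h1

theorem tendsto_probabilityMeasure_of_holderClass {ν : ℕ → ProbabilityMeasure E}
    {μ : ProbabilityMeasure E}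
    (h : ∀ K g, HolderClass 0 1 K g → Tendsto (fun n => ∫ u, g u ∂(ν n : Measure E)) atTop
      (𝓝 (∫ u, g u ∂(μ : Measure E)))) : Tendsto ν atTop (𝓝 μ) := by
  refine tendsto_iff_forall_lipschitz_integral_tendsto.2 fun g hb hl => ?_
  obtain ⟨K, hK⟩ := exists_holderClass_of_lipschitzWith hb hl
  exact h K g hK

theorem tendsto_integral_of_tendsto_probabilityMeasure {ν : ℕ → ProbabilityMeasure E}
    {μ : ProbabilityMeasure E} (h : Tendsto ν atTop (𝓝 μ)) {g : E → ℝ} (hg : Continuous g) {M : ℝ}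
    (hM : ∀ u, |g u| ≤ M) :
    Tendsto (fun n => ∫ u, g u ∂(ν n : Measure E)) atTop (𝓝 (∫ u, g u ∂(μ : Measure E))) :=
  ProbabilityMeasure.tendsto_iff_forall_integral_tendsto.1 h
    (BoundedContinuousFunction.ofNormedAddCommGroup g hg M hM)

theorem abs_integral_le_of_holderClass_zero {γ K : ℝ} {G : E → ℝ} (hG : HolderClass 0 γ K G)
    (ν : Measure E) [IsProbabilityMeasure ν] : |∫ u, G u ∂ν| ≤ K := by
  rw [← Real.norm_eq_abs]
  refine (norm_integral_le_of_norm_le_const (C := K) (ae_of_all _ fun u => ?_)).trans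
    (le_of_eq (by simp))
  simpa using hG.growth u

variable [SecondCountableTopology E] {ℱ : Filtration ℝ≥0 mΩ} {X : ℝ≥0 → ℝ≥0 → E → Ω → E}
  {r r' L₁ γ₁ β L₂ : ℝ} {ρ : ℝ≥0 → ℝ≥0} {l l' L₃ : ℝ}

theorem ProcessAssumption.tendsto_rho
    (h₁ : ProcessAssumption P X r r' L₁ γ₁ β L₂ ρ l l' L₃) :
    Tendsto (fun k : ℕ => (ρ k : ℝ)) atTop (𝓝 0) := by
  rw [← tendsto_add_atTop_iff_nat 1]
  have h := h₁.ρ_summable.tendsto_atTop_zero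
  have h2 := ((Real.continuous_rpow_const (inv_pos.2 h₁.γ₁_pos).le).tendsto 0).comp h
  rw [Real.zero_rpow (inv_pos.2 h₁.γ₁_pos).ne'] at h2
  refine h2.congr fun k => ?_
  rw [Function.comp_apply, Real.rpow_rpow_inv (NNReal.coe_nonneg _) h₁.γ₁_pos.ne']

theorem ProcessAssumption.lipschitz (hX : IsMarkovProcess P ℱ X)
    (h₁ : ProcessAssumption P X r r' L₁ γ₁ β L₂ ρ l l' L₃) :
    ∃ C, 0 ≤ C ∧ ∀ K G, HolderClass 0 1 K G → ∀ t x y,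
      |∫ u, G u ∂(procKernel hX t x) - ∫ u, G u ∂(procKernel hX t y)| ≤
        K * C * ρ t * (‖x - y‖ * (wt x + wt y) ^ β) := by
  obtain ⟨C, hC, h⟩ := h₁.holder hX (a := 0) (γ := 1) le_rfl (by linarith [h₁.two_le_r])
    zero_lt_one le_rfl
  refine ⟨C, hC, fun K G hG t x y => (h K G hG t x y).trans (le_of_eq ?_)⟩
  rw [Real.rpow_one, Real.rpow_one, mul_one, mul_zero, add_zero]
  ring

theorem norm_sub_mul_wt_rpow_le (x y : E) {β : ℝ} (hβ : 0 ≤ β) :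
    ‖x - y‖ * (wt x + wt y) ^ β ≤ 2 ^ (1 + β) * (wt x ^ (1 + β) + wt y ^ (1 + β)) := by
  have hS : 0 < wt x + wt y := zero_lt_one.trans_le (one_le_wt_add x y)
  calc ‖x - y‖ * (wt x + wt y) ^ β ≤ (wt x + wt y) ^ (1 : ℝ) * (wt x + wt y) ^ β := by
        rw [Real.rpow_one]
        gcongr
        exact norm_sub_le_wt_add x y
    _ = (wt x + wt y) ^ (1 + β) := (Real.rpow_add hS _ _).symm
    _ ≤ _ := wt_add_wt_rpow_le x y (by linarith)

/-- The law of `X_t^x` as a bundled probability measure. -/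
def procLaw (hX : IsMarkovProcess P ℱ X) (t : ℝ≥0) (x : E) : ProbabilityMeasure E :=
  ⟨procKernel hX t x, inferInstance⟩

theorem integral_procKernel_add (hX : IsMarkovProcess P ℱ X) (s t : ℝ≥0) (x : E) {g : E → ℝ}
    (hg : Integrable g (procKernel hX (s + t) x)) :
    ∫ u, g u ∂(procKernel hX (s + t) x) =
      ∫ z, ∫ u, g u ∂(procKernel hX t z) ∂(procKernel hX s x) := by
  rw [procKernel_add] at hg ⊢
  exact integral_comp_measure hg

theorem measurable_integral_procKernel (hX : IsMarkovProcess P ℱ X) (t : ℝ≥0) {g : E → ℝ}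
    (hg : Measurable g) : Measurable fun z => ∫ u, g u ∂(procKernel hX t z) :=
  (hg.stronglyMeasurable.integral_kernel (κ := procKernel hX t)).measurable

/-- The laws started at 0 are Cauchy with rate `ρ(k)`, at the price of the moment of order `1 + β ≤
r`. Attractiveness transfers the limit to every starting point. -/
theorem exists_tendsto_procLaw [CompleteSpace E] (hX : IsMarkovProcess P ℱ X)
    (h₁ : ProcessAssumption P X r r' L₁ γ₁ β L₂ ρ l l' L₃) :
    ∃ μ : ProbabilityMeasure E, ∀ x, Tendsto (fun k : ℕ => procLaw hX k x) atTop (𝓝 μ) := by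
  obtain ⟨C, hC, hlip⟩ := h₁.lipschitz hX
  obtain ⟨D, hD, hmom⟩ := h₁.moment_wt hX
  have hβ := h₁.β_nonneg
  have hm := fun t x => hmom (1 + β) (by linarith) (by linarith [h₁.β_le]) t x
  set A : ℝ := C * (2 ^ (1 + β) * (D + 1)) with hA
  have hε : Tendsto (fun k : ℕ => A * (ρ k : ℝ)) atTop (𝓝 0) := by
    simpa using h₁.tendsto_rho.const_mul A
  obtain ⟨μ, hμ⟩ := exists_tendsto_of_cauchy (ν := fun k : ℕ => procLaw hX k (0 : E)) hε (by
    intro K g hg k m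
    have hK := hg.const_nonneg
    change |∫ u, g u ∂(procKernel hX ((k + m : ℕ) : ℝ≥0) 0) - ∫ u, g u ∂(procKernel hX k 0)| ≤ _
    -- The order of composition matters: the process first runs for time `m`, at bounded moment
    -- cost, and the contraction `ρ(k)` acts over the last `k` units.
    rw [show ((k + m : ℕ) : ℝ≥0) = (m : ℝ≥0) + k by push_cast; ring,
      integral_procKernel_add hX _ _ _ (hg.integrable_of_zero _)]
    set c := ∫ u, g u ∂(procKernel hX (k : ℝ≥0) 0) with hc
    have hi : Integrable (fun z => ∫ u, g u ∂(procKernel hX (k : ℝ≥0) z))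
        (procKernel hX (m : ℝ≥0) 0) :=
      (integrable_const K).mono' (measurable_integral_procKernel hX _
        hg.measurable).aestronglyMeasurable
        (ae_of_all _ fun z => abs_integral_le_of_holderClass_zero hg _)
    have hcc : c = ∫ _, c ∂(procKernel hX (m : ℝ≥0) (0 : E)) := by simp
    rw [hcc, ← integral_sub hi (integrable_const c), ← Real.norm_eq_abs]
    have hwi := (hm m 0).1
    have hR : Integrable (fun z : E => K * C * ρ k * (2 ^ (1 + β) * (wt z ^ (1 + β) + 1)))
        (procKernel hX (m : ℝ≥0) 0) :=
      ((hwi.add (integrable_const 1)).const_mul _).const_mul _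
    refine (norm_integral_le_of_norm_le hR (ae_of_all _ fun z => ?_)).trans ?_
    · refine (hlip K g hg k z 0).trans (mul_le_mul_of_nonneg_left ?_ (by positivity))
      have := norm_sub_mul_wt_rpow_le z 0 hβ
      simpa [wt] using this
    · rw [integral_const_mul, integral_const_mul, integral_add hwi (integrable_const _)]
      have h2 := (hm m 0).2
      have h3 : wt (0 : E) = 1 := by simp [wt]
      rw [h3, Real.one_rpow, mul_one] at h2
      have h4 : ∫ _, (1 : ℝ) ∂(procKernel hX (m : ℝ≥0) (0 : E)) = 1 := by simp
      rw [h4, hA]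
      calc _ ≤ K * C * ρ k * (2 ^ (1 + β) * (D + 1)) := by gcongr
        _ = _ := by ring)
  refine ⟨μ, fun x => tendsto_probabilityMeasure_of_holderClass fun K g hg => ?_⟩
  have hg0 : Tendsto (fun k : ℕ => ∫ u, g u ∂(procKernel hX k 0)) atTop
      (𝓝 (∫ u, g u ∂(μ : Measure E))) :=
    tendsto_integral_of_tendsto_probabilityMeasure hμ (hg.continuous zero_lt_one le_rfl) (M := K)
      fun u => by simpa using hg.growth u
  have hdiff : Tendsto (fun k : ℕ => ∫ u, g u ∂(procKernel hX k x) -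
      ∫ u, g u ∂(procKernel hX k 0)) atTop (𝓝 0) := by
    refine squeeze_zero_norm (fun k => hlip K g hg k x 0) ?_
    have := (h₁.tendsto_rho.const_mul (K * C)).mul_const (‖x - 0‖ * (wt x + wt (0 : E)) ^ β)
    simpa using this
  have := hdiff.add hg0
  rw [zero_add] at this
  exact this.congr fun k => sub_add_cancel _ _

theorem tendsto_integral_procKernel (hX : IsMarkovProcess P ℱ X) {μ : ProbabilityMeasure E}
    (hμ : ∀ x, Tendsto (fun k : ℕ => procLaw hX k x) atTop (𝓝 μ)) {K : ℝ} {g : E → ℝ}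
    (hg : HolderClass 0 1 K g) (ν : Measure E) [IsProbabilityMeasure ν] :
    Tendsto (fun k : ℕ => ∫ x, ∫ u, g u ∂(procKernel hX k x) ∂ν) atTop
      (𝓝 (∫ u, g u ∂(μ : Measure E))) := by
  have hc : ∫ u, g u ∂(μ : Measure E) = ∫ _, ∫ u, g u ∂(μ : Measure E) ∂ν := by simp
  rw [hc]
  refine tendsto_integral_of_dominated_convergence (fun _ => K)
    (fun k => (measurable_integral_procKernel hX _ hg.measurable).aestronglyMeasurable)
    (integrable_const K)
    (fun k => ae_of_all _ fun x => abs_integral_le_of_holderClass_zero hg _)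
    (ae_of_all _ fun x => ?_)
  exact tendsto_integral_of_tendsto_probabilityMeasure (hμ x) (hg.continuous zero_lt_one le_rfl)
    (M := K) fun u => by simpa using hg.growth u

/-- Attractiveness makes `z ↦ ∫ g d(procKernel hX t z)` continuous for bounded Lipschitz `g`.
Integrating `g` against the law at time `k + t` and composing the two times in either order gives
two expressions, whose limits are the two sides. -/
theorem comp_eq_of_tendsto_procLaw (hX : IsMarkovProcess P ℱ X)
    (h₁ : ProcessAssumption P X r r' L₁ γ₁ β L₂ ρ l l' L₃) {μ : ProbabilityMeasure E}
    (hμ : ∀ x, Tendsto (fun k : ℕ => procLaw hX k x) atTop (𝓝 μ)) (t : ℝ≥0) :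
    procKernel hX t ∘ₘ (μ : Measure E) = μ := by
  obtain ⟨C, hC, hlip⟩ := h₁.lipschitz hX
  have key : (⟨procKernel hX t ∘ₘ (μ : Measure E), inferInstance⟩ : ProbabilityMeasure E) = μ := by
    refine ProbabilityMeasure.ext_of_holderClass fun K g hg => ?_
    change ∫ u, g u ∂(procKernel hX t ∘ₘ (μ : Measure E)) = _
    rw [integral_comp_measure (hg.integrable_of_zero _)]
    have hcont : Continuous fun z => ∫ u, g u ∂(procKernel hX t z) := by
      refine continuous_iff_continuousAt.2 fun z => ?_
      rw [ContinuousAt, tendsto_iff_dist_tendsto_zero]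
      refine squeeze_zero (fun _ => dist_nonneg) (fun y => hlip K g hg t y z) ?_
      have h : Continuous fun y : E => K * C * ρ t * (‖y - z‖ * (wt y + wt z) ^ β) :=
        continuous_const.mul (Continuous.mul (by fun_prop)
          ((Real.continuous_rpow_const h₁.β_nonneg).comp (continuous_wt.add continuous_const)))
      simpa using h.tendsto z
    have h2 := tendsto_integral_of_tendsto_probabilityMeasure (hμ 0) hcont (M := K)
      fun z => abs_integral_le_of_holderClass_zero hg _
    have h3 := tendsto_integral_procKernel hX hμ hg (procKernel hX t 0)
    refine tendsto_nhds_unique h2 (h3.congr fun k => ?_)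
    change _ = ∫ z, ∫ u, g u ∂(procKernel hX t z) ∂(procKernel hX (k : ℝ≥0) 0)
    rw [← integral_procKernel_add hX _ _ _ (hg.integrable_of_zero _),
      ← integral_procKernel_add hX _ _ _ (hg.integrable_of_zero _), add_comm]
  exact congrArg (fun ν : ProbabilityMeasure E => (ν : Measure E)) key

/-- For invariant `ν` the integral of `g` against `ν` equals the average over `ν` of the values
started at `x`, and these tend to `μ(g)` by dominated convergence. -/
theorem eq_of_comp_eq (hX : IsMarkovProcess P ℱ X) {μ : ProbabilityMeasure E}
    (hμ : ∀ x, Tendsto (fun k : ℕ => procLaw hX k x) atTop (𝓝 μ)) (ν : Measure E)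
    [IsProbabilityMeasure ν] (hν : ∀ t, procKernel hX t ∘ₘ ν = ν) : ν = μ := by
  have key : (⟨ν, inferInstance⟩ : ProbabilityMeasure E) = μ := by
    refine ProbabilityMeasure.ext_of_holderClass fun K g hg => ?_
    have h1 := tendsto_integral_procKernel hX hμ hg ν
    refine tendsto_nhds_unique ?_ h1
    refine tendsto_const_nhds.congr fun k => ?_
    rw [← integral_comp_measure (hg.integrable_of_zero _), hν]
    rfl
  exact congrArg (fun ν : ProbabilityMeasure E => (ν : Measure E)) key

theorem integrable_wt_rpow_invariant_of_le (hX : IsMarkovProcess P ℱ X)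
    (h₁ : ProcessAssumption P X r r' L₁ γ₁ β L₂ ρ l l' L₃) {μ : ProbabilityMeasure E}
    (hμ : ∀ x, Tendsto (fun k : ℕ => procLaw hX k x) atTop (𝓝 μ)) {a : ℝ} (ha : 0 ≤ a)
    (har : a ≤ r) : Integrable (fun u => wt u ^ a) (μ : Measure E) := by
  obtain ⟨D, hD, hmom⟩ := h₁.moment_wt hX
  exact integrable_wt_rpow_of_tendsto (hμ 0) ha (fun n => (hmom a ha har n 0).1)
    (fun n => (hmom a ha har n 0).2)

variable {τ : ℕ → ℝ≥0} {Y : ℕ → ℕ → E → Ω → E} {q q' L₄ κ L₅ : ℝ} {ρτ : ℝ≥0 → ℝ≥0} {α L₆ γ : ℝ}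

/-- Convergence of `ρ` along the grid is not assumed. If `ρ` were bounded below eventually,
finiteness of `∑ τ_i ρ^γ` would force `∑ τ_i < ∞`, which contradicts `t_n → ∞`. -/
theorem exists_subseq_rho_tendsto (hτ : IsStepSequence τ) (hstep : StepConditions τ ρ ρτ γ α l')
    (hγ : 0 < γ) : ∃ φ : ℕ → ℕ, StrictMono φ ∧
      Tendsto (fun n => (ρ (grid τ (1 + φ n) - grid τ 1) : ℝ)) atTop (𝓝 0) := by
  have hfin : ∑' j : ℕ, ((τ (1 + j) * ρ (grid τ (1 + j) - grid τ 1) ^ γ : ℝ≥0) : ℝ≥0∞) ≠ ∞ :=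
    ne_top_of_le_ne_top hstep.sup_rho.ne (le_iSup (fun k : ℕ => ∑' j : ℕ,
      ((τ (k + j) * ρ (grid τ (k + j) - grid τ k) ^ γ : ℝ≥0) : ℝ≥0∞)) 1)
  rw [ENNReal.tsum_coe_ne_top_iff_summable] at hfin
  have hfin' : Summable fun j : ℕ =>
      (τ (1 + j) : ℝ) * (ρ (grid τ (1 + j) - grid τ 1) : ℝ) ^ γ := by
    have := NNReal.summable_coe.2 hfin
    simpa using this
  have hnot : ¬ Summable fun j : ℕ => (τ (1 + j) : ℝ) := by
    intro hs
    have hs' : Summable fun j : ℕ => (τ j : ℝ) := by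
      rw [← summable_nat_add_iff 1]
      simpa only [add_comm 1] using hs
    have h1 := hs'.hasSum.tendsto_sum_nat
    have h2 : Tendsto (fun n => ∑ j ∈ Finset.range (n + 1), (τ j : ℝ)) atTop atTop := by
      have := NNReal.tendsto_coe_atTop.2 hτ.tendsto_grid
      refine this.congr fun n => ?_
      simp [grid]
    exact not_tendsto_nhds_of_tendsto_atTop h2 _ (h1.comp (tendsto_add_atTop_nat 1))
  have hfreq : ∀ n : ℕ, ∃ᶠ k in atTop,
      (ρ (grid τ (1 + k) - grid τ 1) : ℝ) < 1 / ((n : ℝ) + 1) := by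
    intro n hev
    have hev' : ∀ᶠ k in atTop, 1 / ((n : ℝ) + 1) ≤ (ρ (grid τ (1 + k) - grid τ 1) : ℝ) :=
      hev.mono fun k hk => not_lt.1 hk
    set c : ℝ := (1 / ((n : ℝ) + 1)) ^ γ with hc
    have hcpos : 0 < c := by positivity
    refine hnot ((summable_mul_right_iff hcpos.ne').1 ?_)
    refine Summable.of_norm_bounded_eventually_nat hfin' (hev'.mono fun k hk => ?_)
    rw [Real.norm_of_nonneg (by positivity)]
    gcongr
    exact Real.rpow_le_rpow (by positivity) hk hγ.le
  obtain ⟨φ, hφ, hφ'⟩ := extraction_forall_of_frequently hfreq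
  refine ⟨φ, hφ, squeeze_zero (fun n => NNReal.coe_nonneg _) (fun n => (hφ' n).le)
    tendsto_one_div_add_atTop_nhds_zero_nat⟩

/-- Moments of order `q` are available for the scheme, not for `X`. Along the subsequence on which
`ρ` vanishes, the laws of the scheme also converge weakly to `μ`, since the strong error tends to 0,
so their moments pass to the limit. The chain starts at index 1, the first one covered by the error
bound. -/
theorem integrable_wt_rpow_invariant_of_le' (hX : IsMarkovProcess P ℱ X)
    (hY : IsMarkovChain P ℱ τ Y) (hτ : IsStepSequence τ)
    (h₁ : ProcessAssumption P X r r' L₁ γ₁ β L₂ ρ l l' L₃)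
    (h₂ : SchemeAssumption P τ Y q q' L₄ κ L₅ ρτ) (h₃ : ErrorAssumption P X τ Y r' q' α L₆)
    (hstep : StepConditions τ ρ ρτ γ α l') (hγ : 0 < γ) {μ : ProbabilityMeasure E}
    (hμ : ∀ x, Tendsto (fun k : ℕ => procLaw hX k x) atTop (𝓝 μ)) {a : ℝ} (ha : 0 ≤ a)
    (haq : a ≤ q) : Integrable (fun u => wt u ^ a) (μ : Measure E) := by
  obtain ⟨D, hD, hmom⟩ := h₂.moment_wt hY
  obtain ⟨C, hC, hlip⟩ := h₁.lipschitz hX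
  obtain ⟨C', hC', herr⟩ := h₃.abs_integral_sub_le hX hY (by linarith [h₁.one_le_r']) (a := 0)
    (γ := 1) le_rfl zero_lt_one le_rfl
  obtain ⟨φ, hφ, hρφ⟩ := exists_subseq_rho_tendsto hτ hstep hγ
  have hβ := h₁.β_nonneg
  have hinv := comp_eq_of_tendsto_procLaw hX h₁ hμ
  have hmn : ∀ n, 1 ≤ 1 + φ n := fun n => by omega
  refine integrable_wt_rpow_of_tendsto
    (ν := fun n => (⟨chainKernel hY 1 (1 + φ n) 0, inferInstance⟩ : ProbabilityMeasure E))
    (tendsto_probabilityMeasure_of_holderClass fun K g hg => ?_) ha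
    (fun n => (hmom a ha haq 1 _ 0 (hmn n)).1) (fun n => (hmom a ha haq 1 _ 0 (hmn n)).2)
  set T : ℕ → ℝ≥0 := fun n => grid τ (1 + φ n) - grid τ 1 with hT
  have e1 : Tendsto (fun n => ∫ u, g u ∂(procKernel hX (T n) 0) -
      ∫ u, g u ∂(chainKernel hY 1 (1 + φ n) 0)) atTop (𝓝 0) := by
    have h0 : Tendsto (fun n => (τ (1 + φ n) : ℝ) ^ α) atTop (𝓝 0) := by
      have h1 : Tendsto (fun n => (τ (1 + φ n) : ℝ)) atTop (𝓝 0) :=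
        NNReal.tendsto_coe.2 (hτ.tendsto_zero.comp
          (tendsto_atTop_mono (fun n => Nat.le_add_left _ _) hφ.tendsto_atTop))
      have := ((Real.continuous_rpow_const h₃.α_pos.le).tendsto 0).comp h1
      rwa [Real.zero_rpow h₃.α_pos.ne'] at this
    refine squeeze_zero_norm (a := fun n => K * C' * √(1 + 1) * (τ (1 + φ n) : ℝ) ^ α)
      (fun n => ?_) (by simpa using h0.const_mul (K * C' * √(1 + 1)))
    refine (herr K g hg 1 (1 + φ n) 0 le_rfl (hmn n) (by simp) (by simp)).trans (le_of_eq ?_)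
    simp only [wt, norm_zero, add_zero, Real.one_rpow, mul_zero, Real.rpow_zero, one_mul,
      integral_const, probReal_univ, smul_eq_mul, mul_one]
    ring
  have hwi := integrable_wt_rpow_invariant_of_le hX h₁ hμ (a := 1 + β) (by linarith)
    (by linarith [h₁.β_le])
  have e2 : Tendsto (fun n => ∫ u, g u ∂(procKernel hX (T n) 0) - ∫ u, g u ∂(μ : Measure E))
      atTop (𝓝 0) := by
    set A : ℝ := K * C * (2 ^ (1 + β) * ∫ z, (1 + wt z ^ (1 + β)) ∂(μ : Measure E)) with hA
    refine squeeze_zero_norm (a := fun n => A * (ρ (T n) : ℝ)) (fun n => ?_)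
      (by simpa using hρφ.const_mul A)
    have hgm : ∫ u, g u ∂(μ : Measure E) =
        ∫ z, ∫ u, g u ∂(procKernel hX (T n) z) ∂(μ : Measure E) := by
      rw [← integral_comp_measure (hg.integrable_of_zero _), hinv]
    have hc : ∫ u, g u ∂(procKernel hX (T n) 0) =
        ∫ _, ∫ u, g u ∂(procKernel hX (T n) 0) ∂(μ : Measure E) := by simp
    have hi : Integrable (fun z => ∫ u, g u ∂(procKernel hX (T n) z)) (μ : Measure E) :=
      (integrable_const K).mono' (measurable_integral_procKernel hX _
        hg.measurable).aestronglyMeasurable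
        (ae_of_all _ fun z => abs_integral_le_of_holderClass_zero hg _)
    rw [hgm, hc, ← integral_sub (integrable_const _) hi]
    have hR : Integrable (fun z : E => K * C * ρ (T n) * (2 ^ (1 + β) * (1 + wt z ^ (1 + β))))
        (μ : Measure E) := (((integrable_const 1).add hwi).const_mul _).const_mul _
    refine (norm_integral_le_of_norm_le hR (ae_of_all _ fun z => ?_)).trans (le_of_eq ?_)
    · have hK := hg.const_nonneg
      refine (hlip K g hg (T n) 0 z).trans (mul_le_mul_of_nonneg_left ?_ (by positivity))
      have := norm_sub_mul_wt_rpow_le 0 z hβ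
      simpa [wt] using this
    · rw [integral_const_mul, integral_const_mul, hA]
      ring
  have e3 := (e2.sub e1).add_const (∫ u, g u ∂(μ : Measure E))
  simp only [sub_zero, zero_add] at e3
  refine e3.congr fun n => ?_
  change _ = ∫ u, g u ∂(chainKernel hY 1 (1 + φ n) 0)
  ring

end InvariantMeasure

/-! ### Mixing of the scheme towards the invariant measure -/

section Mixing

variable {Ω E : Type*} {mΩ : MeasurableSpace Ω} {P : Measure Ω} [IsProbabilityMeasure P]
  [NormedAddCommGroup E] [MeasurableSpace E] [BorelSpace E]
  {ℱ : Filtration ℝ≥0 mΩ} {X : ℝ≥0 → ℝ≥0 → E → Ω → E} {τ : ℕ → ℝ≥0} {Y : ℕ → ℕ → E → Ω → E}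
  {r r' L₁ γ₁ β L₂ : ℝ} {ρ : ℝ≥0 → ℝ≥0} {l l' L₃ : ℝ} {q q' L₄ κ L₅ : ℝ} {ρτ : ℝ≥0 → ℝ≥0}
  {α L₆ γ : ℝ}

omit [IsProbabilityMeasure P] [NormedAddCommGroup E] [BorelSpace E] in
theorem integrable_integral_of_integrable_comp {K : Kernel E E} {μ : Measure E} {g : E → ℝ}
    (hg : Integrable g (K ∘ₘ μ)) : Integrable (fun x => ∫ y, g y ∂(K x)) μ := by
  rw [Measure.comp_eq_comp_const_apply] at hg
  simpa only [Kernel.const_apply] using hg.integral_comp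

theorem HolderClass.integrable {a K : ℝ} {G : E → ℝ} (hG : HolderClass a γ K G) {ν : Measure E}
    (h : Integrable (fun u => wt u ^ a) ν) : Integrable G ν :=
  (h.const_mul K).mono' hG.measurable.aestronglyMeasurable (ae_of_all _ fun u => hG.growth u)

theorem HolderClass.abs_integral_le {a K : ℝ} {G : E → ℝ} (hG : HolderClass a γ K G)
    {ν : Measure E} (h : Integrable (fun u => wt u ^ a) ν) :
    |∫ u, G u ∂ν| ≤ K * ∫ u, wt u ^ a ∂ν := by
  rw [← integral_const_mul, ← Real.norm_eq_abs]
  exact norm_integral_le_of_norm_le (h.const_mul K) (ae_of_all _ fun u => hG.growth u)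

/-- Truncating the distance at 1 costs an extra `γ` in the weight exponent. This keeps the Hölder
classes stable under the kernels. -/
theorem norm_sub_rpow_mul_le_min (y z : E) {b : ℝ} (hγ : 0 < γ) :
    ‖y - z‖ ^ γ * (wt y + wt z) ^ b ≤ min 1 (‖y - z‖ ^ γ) * (wt y + wt z) ^ (b + γ) := by
  have h1 := one_le_wt_add y z
  have hS : 0 < wt y + wt z := zero_lt_one.trans_le h1
  have hb := Real.rpow_nonneg hS.le b
  rw [Real.rpow_add hS]
  rcases le_total (‖y - z‖ ^ γ) 1 with h | h
  · rw [min_eq_right h]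
    refine mul_le_mul_of_nonneg_left ?_ (by positivity)
    exact le_mul_of_one_le_right hb (Real.one_le_rpow h1 hγ.le)
  · rw [min_eq_left h, one_mul, mul_comm]
    exact mul_le_mul_of_nonneg_left
      (Real.rpow_le_rpow (norm_nonneg _) (norm_sub_le_wt_add y z) hγ.le) hb

theorem norm_sub_rpow_mul_wt_rpow_le (y z : E) {b : ℝ} (hb : 0 ≤ b) (hγ : 0 < γ) :
    ‖y - z‖ ^ γ * (wt y + wt z) ^ b ≤ 2 ^ (b + γ) * (wt y ^ (b + γ) + wt z ^ (b + γ)) :=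
  ((norm_sub_rpow_mul_le_min y z hγ).trans (mul_le_of_le_one_left
    (Real.rpow_nonneg (zero_le_one.trans (one_le_wt_add y z)) _) (min_le_left _ _))).trans
    (wt_add_wt_rpow_le y z (by linarith))

variable [SecondCountableTopology E]

/-- Uniform mixing of the chain towards `μ`, tested on the class of exponent `a`, with rate
`e k i` from time `k` to time `i`. -/
structure MixingBound (hY : IsMarkovChain P ℱ τ Y) (μ : Measure E) (γ a A : ℝ) (e : ℕ → ℕ → ℝ)
    (S : ℝ) : Prop where
  nonneg : ∀ k i, 0 ≤ e k i
  summable : ∀ k, 1 ≤ k → Summable fun j => (τ (k + j) : ℝ) * e k (k + j)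
  tsum_le : ∀ k, 1 ≤ k → ∑' j, (τ (k + j) : ℝ) * e k (k + j) ≤ S
  approx : ∀ K G, HolderClass a γ K G → ∀ k i y, 1 ≤ k → k ≤ i →
    |∫ u, G u ∂(chainKernel hY k i y) - ∫ u, G u ∂μ| ≤ K * (e k i * wt y ^ A)
  holder : ∀ K G, HolderClass a γ K G → ∀ k i y z, 1 ≤ k → k ≤ i →
    |∫ u, G u ∂(chainKernel hY k i y) - ∫ u, G u ∂(chainKernel hY k i z)| ≤
      K * (e k i * (min 1 (‖y - z‖ ^ γ) * (wt y + wt z) ^ A))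
  integrable_left : ∀ m n x, m ≤ n → Integrable (fun u => wt u ^ a) (chainKernel hY m n x)
  integrable_right : ∀ m n x, m ≤ n → Integrable (fun u => wt u ^ A) (chainKernel hY m n x)

/-- The strong error is averaged over `μ`. The factor `F` allows two uses: `F = 1` for mixing, and
the centred test function for the autocovariance. -/
theorem ErrorAssumption.abs_integral_integral_sub_le (hX : IsMarkovProcess P ℱ X)
    (hY : IsMarkovChain P ℱ τ Y) (h₂ : SchemeAssumption P τ Y q q' L₄ κ L₅ ρτ) (hr' : 0 ≤ r')
    (h₃ : ErrorAssumption P X τ Y r' q' α L₆) (hγ : 0 < γ) (hγ1 : γ ≤ 1) {μ : Measure E}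
    [IsProbabilityMeasure μ] (hinv : ∀ t, procKernel hX t ∘ₘ μ = μ)
    (hμ : ∀ a, 0 ≤ a → a ≤ q → Integrable (fun u => wt u ^ a) μ) {a b : ℝ} (ha : 0 ≤ a)
    (hb : 0 ≤ b) (haq : 2 * (q' * a) ≤ q) (hd : 2 * (b + max r' q' * γ) ≤ q) :
    ∃ C, 0 ≤ C ∧ ∀ K G, HolderClass a γ K G → ∀ k i, 1 ≤ k → k ≤ i → ∀ F : E → ℝ, ∀ M,
      0 ≤ M → (∀ u, |F u| ≤ M * wt u ^ b) →
      |∫ y, F y * (∫ u, G u ∂(procKernel hX (grid τ i - grid τ k) y)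
        - ∫ u, G u ∂(chainKernel hY k i y)) ∂μ| ≤ M * (K * (C * (τ i : ℝ) ^ (γ * α))) := by
  have hq' := h₂.one_le_q'
  have ha2 : 2 * a ≤ q := by nlinarith
  have hdq : 0 ≤ max r' q' * γ := mul_nonneg (le_max_of_le_left hr') hγ.le
  obtain ⟨D, hD, hmom⟩ := h₂.moment_wt hY
  obtain ⟨C, hC, herr⟩ := h₃.abs_integral_sub_le hX hY hr' ha hγ hγ1
  set I₁ := ∫ z, wt z ^ (2 * (b + max r' q' * γ)) ∂μ with e₁
  set I₂ := ∫ z, wt z ^ (2 * a) ∂μ with e₂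
  set I₃ := ∫ z, wt z ^ (q' * (2 * a)) ∂μ with e₃
  have hi₁ := hμ (2 * (b + max r' q' * γ)) (by positivity) hd
  have hi₂ := hμ (2 * a) (by positivity) ha2
  have hi₃ := hμ (q' * (2 * a)) (by positivity) (by linarith)
  have hI₁ : 0 ≤ I₁ := integral_nonneg fun z => wt_rpow_nonneg z _
  have hI₂ : 0 ≤ I₂ := integral_nonneg fun z => wt_rpow_nonneg z _
  have hI₃ : 0 ≤ I₃ := integral_nonneg fun z => wt_rpow_nonneg z _
  clear_value I₁ I₂ I₃
  refine ⟨C * (I₁ + (I₂ + D * I₃)), by positivity, fun K G hG k i hk hki F M hM hF => ?_⟩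
  have hK := hG.const_nonneg
  set T := grid τ i - grid τ k
  -- By invariance the moment of order `2 * a` of `X_T` started from `μ` is that of `μ`, although `2
  -- * a ≤ r` is not available. For individual `z` the integrability then holds only `μ`-almost
  -- everywhere.
  have hi₂' : Integrable (fun u => wt u ^ (2 * a)) (procKernel hX T ∘ₘ μ) := by rwa [hinv]
  have hae := Measure.ae_integrable_of_integrable_comp hi₂'
  have hi₄ : Integrable (fun z => ∫ u, wt u ^ (2 * a) ∂(procKernel hX T z)) μ :=
    integrable_integral_of_integrable_comp hi₂'
  have hi₅ : Integrable (fun z => ∫ u, wt u ^ (2 * a) ∂(procKernel hX T z) +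
      D * wt z ^ (q' * (2 * a))) μ := hi₄.add (hi₃.const_mul D)
  have hI₄ : ∫ z, ∫ u, wt u ^ (2 * a) ∂(procKernel hX T z) ∂μ = I₂ := by
    rw [← integral_comp_measure hi₂', hinv, e₂]
  have hR : Integrable (fun z => M * (K * (C * (τ i : ℝ) ^ (γ * α) *
      (wt z ^ (2 * (b + max r' q' * γ)) + (∫ u, wt u ^ (2 * a) ∂(procKernel hX T z) +
        D * wt z ^ (q' * (2 * a))))))) μ :=
    (((hi₁.add hi₅).const_mul _).const_mul _).const_mul _
  rw [← Real.norm_eq_abs]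
  refine (norm_integral_le_of_norm_le hR (hae.mono fun z hz => ?_)).trans (le_of_eq ?_)
  · have hw := hmom (2 * a) (by positivity) ha2 k i z hki
    have hB := herr K G hG k i z hk hki hz hw.1
    rw [Real.norm_eq_abs, abs_mul]
    have hA0 : 0 ≤ ∫ u, wt u ^ (2 * a) ∂(procKernel hX T z) :=
      integral_nonneg fun z => wt_rpow_nonneg z _
    have hB0 : 0 ≤ ∫ u, wt u ^ (2 * a) ∂(chainKernel hY k i z) :=
      integral_nonneg fun z => wt_rpow_nonneg z _
    have hw2 := hw.2
    set A := ∫ u, wt u ^ (2 * a) ∂(procKernel hX T z)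
    set B := ∫ u, wt u ^ (2 * a) ∂(chainKernel hY k i z)
    clear_value A B
    have hwb := wt_rpow_nonneg z b
    calc _ ≤ (M * wt z ^ b) * (K * (C * ((τ i : ℝ) ^ (γ * α) *
          (wt z ^ (max r' q' * γ) * √(A + B))))) := by
          gcongr
          exact hF z
      _ = M * (K * (C * (τ i : ℝ) ^ (γ * α) *
          (wt z ^ (b + max r' q' * γ) * √(A + B)))) := by
          rw [Real.rpow_add (wt_pos z)]
          ring
      -- The product of the weight and the root is split by `2xy ≤ x² + y²`, so that only moments
      -- under `μ` appear.
      _ ≤ _ := by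
          gcongr
          have h1 : (wt z ^ (b + max r' q' * γ)) ^ 2 = wt z ^ (2 * (b + max r' q' * γ)) := by
            rw [← Real.rpow_natCast, ← Real.rpow_mul (wt_pos z).le]
            congr 1
            push_cast
            ring
          have h2 : √(A + B) ^ 2 = A + B := Real.sq_sqrt (by positivity)
          have h3 := two_mul_le_add_sq (wt z ^ (b + max r' q' * γ)) (√(A + B))
          have h4 : 0 ≤ wt z ^ (b + max r' q' * γ) * √(A + B) :=
            mul_nonneg (wt_rpow_nonneg z _) (Real.sqrt_nonneg _)
          linarith
  · rw [integral_const_mul, integral_const_mul, integral_const_mul,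
      integral_add hi₁ hi₅, integral_add hi₄ (hi₃.const_mul D), hI₄,
      integral_const_mul, e₁, e₂, e₃]
    ring

/-- The intermediate quantity is `∫ Q_{k,i} G dμ`. Attractiveness of the scheme compares it with
`Q_{k,i} G(y)`. The strong error compares it with `∫ P_t G dμ`, which is `μ(G)` by invariance. -/
theorem exists_abs_integral_chainKernel_sub_le (hX : IsMarkovProcess P ℱ X)
    (hY : IsMarkovChain P ℱ τ Y) (h₂ : SchemeAssumption P τ Y q q' L₄ κ L₅ ρτ) (hr' : 0 ≤ r')
    (h₃ : ErrorAssumption P X τ Y r' q' α L₆) (hγ : 0 < γ) (hγ1 : γ ≤ 1) {μ : Measure E}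
    [IsProbabilityMeasure μ] (hinv : ∀ t, procKernel hX t ∘ₘ μ = μ)
    (hμ : ∀ a, 0 ≤ a → a ≤ q → Integrable (fun u => wt u ^ a) μ) {a : ℝ} (ha : 0 ≤ a)
    (haq : 2 * (q' * a) ≤ q) (hd : 2 * (max r' q' * γ) ≤ q)
    (hA : κ * γ + q' * a + γ ≤ q) :
    ∃ C, 0 ≤ C ∧ ∀ K G, HolderClass a γ K G → ∀ k i y, 1 ≤ k → k ≤ i →
      |∫ u, G u ∂(chainKernel hY k i y) - ∫ u, G u ∂μ| ≤ K * (C * ((τ i : ℝ) ^ (γ * α) +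
        (ρτ (grid τ i - grid τ k) : ℝ) ^ γ) * wt y ^ (κ * γ + q' * a + γ)) := by
  have hq' := h₂.one_le_q'
  have hκ := h₂.κ_nonneg
  have ha2 : 2 * a ≤ q := by nlinarith
  have haq1 : a ≤ q := by linarith
  have hqa : 0 ≤ q' * a := by positivity
  obtain ⟨D, hD, hmom⟩ := h₂.moment_wt hY
  obtain ⟨C, hC, hhol⟩ := h₂.holder hY ha ha2 hγ hγ1
  obtain ⟨C', hC', herr⟩ := h₃.abs_integral_integral_sub_le hX hY h₂ hr' hγ hγ1 hinv hμ ha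
    (b := 0) le_rfl haq (by simpa using hd)
  set A := κ * γ + q' * a + γ with hA_def
  have hA0 : 0 ≤ A := by positivity
  have hiA := hμ A hA0 hA
  set I := ∫ z, wt z ^ A ∂μ with hI_def
  have hI : 0 ≤ I := integral_nonneg fun z => wt_rpow_nonneg z _
  clear_value I
  refine ⟨C * (2 ^ A * (1 + I)) + C', by positivity, fun K G hG k i y hk hki => ?_⟩
  have hK := hG.const_nonneg
  set T := grid τ i - grid τ k
  have hGi : Integrable G (procKernel hX T ∘ₘ μ) := by
    rw [hinv]
    exact hG.integrable (hμ a ha haq1)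
  have hμG : ∫ u, G u ∂μ = ∫ z, ∫ u, G u ∂(procKernel hX T z) ∂μ := by
    rw [← integral_comp_measure hGi, hinv]
  have hQi : Integrable (fun z => ∫ u, G u ∂(chainKernel hY k i z)) μ := by
    refine ((hμ (q' * a) hqa (by linarith)).const_mul (K * D)).mono'
      (hG.measurable.stronglyMeasurable.integral_kernel (κ := chainKernel hY k i)).aestronglyMeasurable
      (ae_of_all _ fun z => ?_)
    have h := hmom a ha haq1 k i z hki
    refine (hG.abs_integral_le h.1).trans ?_
    rw [mul_assoc]
    exact mul_le_mul_of_nonneg_left h.2 hK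
  have hKi : Integrable (fun z => ∫ u, G u ∂(procKernel hX T z)) μ := integrable_integral_of_integrable_comp hGi
  have e1 : |∫ u, G u ∂(chainKernel hY k i y) - ∫ z, ∫ u, G u ∂(chainKernel hY k i z) ∂μ| ≤
      K * (C * ((ρτ T : ℝ) ^ γ * (2 ^ A * (wt y ^ A + I)))) := by
    have hc : ∫ u, G u ∂(chainKernel hY k i y) =
        ∫ _, ∫ u, G u ∂(chainKernel hY k i y) ∂μ := by simp
    rw [hc, ← integral_sub (integrable_const _) hQi, ← Real.norm_eq_abs]
    have hR : Integrable (fun z => K * (C * ((ρτ T : ℝ) ^ γ * (2 ^ A * (wt y ^ A + wt z ^ A)))))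
        μ := ((((integrable_const _).add hiA).const_mul _).const_mul _ |>.const_mul _).const_mul _
    refine (norm_integral_le_of_norm_le hR (ae_of_all _ fun z => ?_)).trans (le_of_eq ?_)
    · refine (hhol K G hG k i y z hki).trans ?_
      have := norm_sub_rpow_mul_wt_rpow_le y z (b := κ * γ + q' * a) (by positivity) hγ
      exact mul_le_mul_of_nonneg_left (mul_le_mul_of_nonneg_left
        (mul_le_mul_of_nonneg_left this (by positivity)) hC) hK
    · rw [integral_const_mul, integral_const_mul, integral_const_mul, integral_const_mul,
        integral_add (integrable_const _) hiA]
      simp [hI_def]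
  have e2 : |∫ u, G u ∂μ - ∫ z, ∫ u, G u ∂(chainKernel hY k i z) ∂μ| ≤
      K * (C' * (τ i : ℝ) ^ (γ * α)) := by
    rw [hμG, ← integral_sub hKi hQi]
    simpa using herr K G hG k i hk hki (fun _ => 1) 1 zero_le_one (by simp)
  have hw : 1 ≤ wt y ^ A := one_le_wt_rpow y hA0
  have e3 := abs_sub_le (∫ u, G u ∂(chainKernel hY k i y))
    (∫ z, ∫ u, G u ∂(chainKernel hY k i z) ∂μ) (∫ u, G u ∂μ)
  rw [abs_sub_comm (∫ z, ∫ u, G u ∂(chainKernel hY k i z) ∂μ)] at e3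
  refine e3.trans ((add_le_add e1 e2).trans ?_)
  rw [← mul_add]
  refine mul_le_mul_of_nonneg_left ?_ hK
  set x := (ρτ T : ℝ) ^ γ
  set z := (τ i : ℝ) ^ (γ * α)
  have hx : 0 ≤ x := by positivity
  have hz : 0 ≤ z := by positivity
  have h1 : C * (x * (2 ^ A * (wt y ^ A + I))) ≤ C * (2 ^ A * (1 + I)) * x * wt y ^ A := by
    calc _ = C * 2 ^ A * x * (wt y ^ A + I) := by ring
      _ ≤ C * 2 ^ A * x * (wt y ^ A + I * wt y ^ A) := by
        gcongr
        exact le_mul_of_one_le_right hI hw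
      _ = _ := by ring
  have h2 : C' * z ≤ C' * z * wt y ^ A := le_mul_of_one_le_right (by positivity) hw
  have h3 : 0 ≤ C * (2 ^ A * (1 + I)) * z * wt y ^ A := by positivity
  have h4 : 0 ≤ C' * x * wt y ^ A := by positivity
  calc _ ≤ C * (2 ^ A * (1 + I)) * x * wt y ^ A + C' * z * wt y ^ A := add_le_add h1 h2
    _ ≤ _ := by linarith [h3, h4]

omit [SecondCountableTopology E] [NormedAddCommGroup E] [BorelSpace E] [MeasurableSpace E] in
-- The strong-error part sums to a tail of `∑ τ^(1+γα)`, and the attractiveness part is bounded by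
-- the supremum over `k` of the weighted sums of `ρτ^γ`. Uniformity in `k` gives all correctors the
-- same Hölder constant.
theorem StepConditions.exists_sum_bound (hγ : 0 < γ) (hα : 0 < α)
    (hstep : StepConditions τ ρ ρτ γ α l') :
    ∃ S, 0 ≤ S ∧ ∀ k, 1 ≤ k → Summable (fun j => (τ (k + j) : ℝ) *
      ((τ (k + j) : ℝ) ^ (γ * α) + (ρτ (grid τ (k + j) - grid τ k) : ℝ) ^ γ)) ∧
      ∑' j, (τ (k + j) : ℝ) *
        ((τ (k + j) : ℝ) ^ (γ * α) + (ρτ (grid τ (k + j) - grid τ k) : ℝ) ^ γ) ≤ S := by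
  set B := (⨆ k : ℕ, ∑' j : ℕ,
    ((τ (k + j) * ρτ (grid τ (k + j) - grid τ k) ^ γ : ℝ≥0) : ℝ≥0∞)).toNNReal
  set U := ∑' k : ℕ, (τ (k + 1) : ℝ) ^ (1 + γ * α)
  have hU : 0 ≤ U := tsum_nonneg fun k => by positivity
  have hpos : 0 < 1 + γ * α := by positivity
  have hmul : ∀ n, (τ n : ℝ) ^ (1 + γ * α) = τ n * (τ n : ℝ) ^ (γ * α) := by
    intro n
    rcases eq_or_ne (τ n : ℝ) 0 with h | h
    · rw [h, Real.zero_rpow hpos.ne', zero_mul]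
    · rw [Real.rpow_add (lt_of_le_of_ne (NNReal.coe_nonneg _) h.symm), Real.rpow_one]
  refine ⟨U + B, by positivity, fun k hk => ?_⟩
  have hle : ∑' j : ℕ, ((τ (k + j) * ρτ (grid τ (k + j) - grid τ k) ^ γ : ℝ≥0) : ℝ≥0∞) ≤ B := by
    rw [ENNReal.coe_toNNReal hstep.sup_rhoτ.ne]
    exact le_iSup (fun k : ℕ => ∑' j : ℕ,
      ((τ (k + j) * ρτ (grid τ (k + j) - grid τ k) ^ γ : ℝ≥0) : ℝ≥0∞)) k
  have hs : Summable fun j : ℕ => τ (k + j) * ρτ (grid τ (k + j) - grid τ k) ^ γ :=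
    ENNReal.tsum_coe_ne_top_iff_summable.1 (ne_top_of_le_ne_top ENNReal.coe_ne_top hle)
  rw [← ENNReal.coe_tsum hs, ENNReal.coe_le_coe] at hle
  have hs' : Summable fun j : ℕ =>
      (τ (k + j) : ℝ) * (ρτ (grid τ (k + j) - grid τ k) : ℝ) ^ γ := by
    simpa using NNReal.summable_coe.2 hs
  have hle' : ∑' j, (τ (k + j) : ℝ) * (ρτ (grid τ (k + j) - grid τ k) : ℝ) ^ γ ≤ B := by
    have := NNReal.coe_le_coe.2 hle
    rw [NNReal.coe_tsum] at this
    simpa using this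
  have hinj : Function.Injective fun j : ℕ => k - 1 + j := add_right_injective _
  have hτs : Summable fun j : ℕ => (τ (k + j) : ℝ) ^ (1 + γ * α) := by
    refine (hstep.summable_pow.comp_injective hinj).congr fun j => ?_
    simp only [Function.comp_apply]
    rw [show k - 1 + j + 1 = k + j by omega]
  have hτle : ∑' j : ℕ, (τ (k + j) : ℝ) ^ (1 + γ * α) ≤ U := by
    refine le_trans (le_of_eq (tsum_congr fun j => ?_))
      (tsum_comp_le_tsum_of_inj hstep.summable_pow (fun k => by positivity) hinj)
    simp only [Function.comp_apply]
    rw [show k - 1 + j + 1 = k + j by omega]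
  simp only [mul_add, ← hmul]
  exact ⟨hτs.add hs', by rw [hτs.tsum_add hs']; exact add_le_add hτle hle'⟩

theorem exists_mixingBound (hX : IsMarkovProcess P ℱ X)
    (hY : IsMarkovChain P ℱ τ Y) (h₂ : SchemeAssumption P τ Y q q' L₄ κ L₅ ρτ) (hr' : 0 ≤ r')
    (h₃ : ErrorAssumption P X τ Y r' q' α L₆) (hstep : StepConditions τ ρ ρτ γ α l')
    (hγ : 0 < γ) (hγ1 : γ ≤ 1) {μ : Measure E}
    [IsProbabilityMeasure μ] (hinv : ∀ t, procKernel hX t ∘ₘ μ = μ)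
    (hμ : ∀ a, 0 ≤ a → a ≤ q → Integrable (fun u => wt u ^ a) μ) {a : ℝ} (ha : 0 ≤ a)
    (haq : 2 * (q' * a) ≤ q) (hd : 2 * (max r' q' * γ) ≤ q)
    (hA : κ * γ + q' * a + γ ≤ q) :
    ∃ e S, MixingBound hY μ γ a (κ * γ + q' * a + γ) e S := by
  have hq' := h₂.one_le_q'
  have hκ := h₂.κ_nonneg
  have ha2 : 2 * a ≤ q := by nlinarith
  obtain ⟨D, hD, hmom⟩ := h₂.moment_wt hY
  obtain ⟨C, hC, happ⟩ := exists_abs_integral_chainKernel_sub_le hX hY h₂ hr' h₃ hγ hγ1 hinv hμ ha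
    haq hd hA
  obtain ⟨C', hC', hhol⟩ := h₂.holder hY ha ha2 hγ hγ1
  obtain ⟨S, hS, hsum⟩ := hstep.exists_sum_bound hγ h₃.α_pos
  refine ⟨fun k i => (C + C') * ((τ i : ℝ) ^ (γ * α) + (ρτ (grid τ i - grid τ k) : ℝ) ^ γ),
    (C + C') * S, fun k i => by positivity, fun k hk => ?_, fun k hk => ?_,
    fun K G hG k i y hk hki => (happ K G hG k i y hk hki).trans ?_,
    fun K G hG k i y z hk hki => (hhol K G hG k i y z hki).trans ?_,
    fun m n x hmn => (hmom a ha (by linarith) m n x hmn).1,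
    fun m n x hmn => (hmom _ (by positivity) hA m n x hmn).1⟩
  · simpa only [mul_left_comm] using (hsum k hk).1.mul_left (C + C')
  · simp only [mul_left_comm _ (C + C')]
    rw [tsum_mul_left]
    exact mul_le_mul_of_nonneg_left (hsum k hk).2 (by positivity)
  · have hK := hG.const_nonneg
    have := wt_rpow_nonneg y (κ * γ + q' * a + γ)
    gcongr
    linarith
  · have hK := hG.const_nonneg
    have h1 : (ρτ (grid τ i - grid τ k) : ℝ) ^ γ ≤
        (τ i : ℝ) ^ (γ * α) + (ρτ (grid τ i - grid τ k) : ℝ) ^ γ :=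
      le_add_of_nonneg_left (by positivity)
    rw [← mul_assoc C']
    refine mul_le_mul_of_nonneg_left (mul_le_mul ?_ (norm_sub_rpow_mul_le_min y z hγ) ?_ ?_) hK
    · exact mul_le_mul (by linarith) h1 (by positivity) (by positivity)
    · exact mul_nonneg (by positivity)
        (Real.rpow_nonneg (zero_le_one.trans (one_le_wt_add y z)) _)
    · positivity

end Mixing

/-! ### Algebra of weighted Hölder functions -/

section HolderAlgebra

variable {E : Type*} [NormedAddCommGroup E] [MeasurableSpace E] {a b γ K L : ℝ} {F H : E → ℝ}

theorem HolderClass.mul (hF : HolderClass a γ K F) (hH : HolderClass b γ L H) (ha : 0 ≤ a)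
    (hb : 0 ≤ b) : HolderClass (a + b) γ (2 * K * L) (fun u => F u * H u) := by
  have hK := hF.const_nonneg
  have hL := hH.const_nonneg
  refine ⟨hF.measurable.mul hH.measurable, fun u => ?_, fun u v => ?_⟩
  · have h1 := wt_rpow_nonneg u a
    have h2 := wt_rpow_nonneg u b
    rw [abs_mul, Real.rpow_add (wt_pos u)]
    calc |F u| * |H u| ≤ (K * wt u ^ a) * (L * wt u ^ b) :=
          mul_le_mul (hF.growth u) (hH.growth u) (abs_nonneg _) (by positivity)
      _ ≤ 2 * ((K * wt u ^ a) * (L * wt u ^ b)) := by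
          linarith [show 0 ≤ (K * wt u ^ a) * (L * wt u ^ b) by positivity]
      _ = _ := by ring
  · have hS : 0 < wt u + wt v := zero_lt_one.trans_le (one_le_wt_add u v)
    have hle : ∀ {c : ℝ}, 0 ≤ c → ∀ {x : E}, x = u ∨ x = v → wt x ^ c ≤ (wt u + wt v) ^ c := by
      rintro c hc x (rfl | rfl)
      · exact Real.rpow_le_rpow (wt_pos _).le (by linarith [wt_pos v]) hc
      · exact Real.rpow_le_rpow (wt_pos _).le (by linarith [wt_pos u]) hc
    have hSa := Real.rpow_nonneg hS.le a
    have hSb := Real.rpow_nonneg hS.le b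
    have hm : 0 ≤ min 1 (‖u - v‖ ^ γ) := le_min zero_le_one (by positivity)
    have h1 : |F u| ≤ K * (wt u + wt v) ^ a :=
      (hF.growth u).trans (mul_le_mul_of_nonneg_left (hle ha (Or.inl rfl)) hK)
    have h2 : |H v| ≤ L * (wt u + wt v) ^ b :=
      (hH.growth v).trans (mul_le_mul_of_nonneg_left (hle hb (Or.inr rfl)) hL)
    have e : F u * H u - F v * H v = F u * (H u - H v) + (F u - F v) * H v := by ring
    rw [e, Real.rpow_add hS]
    refine (abs_add_le _ _).trans ?_
    rw [abs_mul, abs_mul]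
    have h3 := mul_le_mul h1 (hH.holder u v) (abs_nonneg _) (by positivity)
    have h4 := mul_le_mul (hF.holder u v) h2 (abs_nonneg _) (by positivity)
    refine (add_le_add h3 h4).trans (le_of_eq ?_)
    ring

theorem HolderClass.const_mul (hF : HolderClass a γ K F) (c : ℝ) :
    HolderClass a γ (|c| * K) (fun u => c * F u) := by
  refine ⟨hF.measurable.const_mul c, fun u => ?_, fun u v => ?_⟩
  · rw [abs_mul, mul_assoc]
    exact mul_le_mul_of_nonneg_left (hF.growth u) (abs_nonneg c)
  · rw [← mul_sub, abs_mul, mul_assoc]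
    exact mul_le_mul_of_nonneg_left (hF.holder u v) (abs_nonneg c)

theorem HolderClass.sub (hF : HolderClass a γ K F) (hH : HolderClass a γ L H) :
    HolderClass a γ (K + L) (fun u => F u - H u) := by
  refine ⟨hF.measurable.sub hH.measurable, fun u => ?_, fun u v => ?_⟩
  · rw [add_mul]
    exact (abs_sub _ _).trans (add_le_add (hF.growth u) (hH.growth u))
  · rw [add_mul, sub_sub_sub_comm]
    exact (abs_sub _ _).trans (add_le_add (hF.holder u v) (hH.holder u v))

theorem HolderClass.mono (hF : HolderClass a γ K F) (hab : a ≤ b) (hKL : K ≤ L) :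
    HolderClass b γ L F := by
  have hK := hF.const_nonneg
  refine ⟨hF.measurable, fun u => (hF.growth u).trans ?_, fun u v => (hF.holder u v).trans ?_⟩
  · exact mul_le_mul hKL (wt_rpow_mono u hab) (wt_rpow_nonneg u a) (hK.trans hKL)
  · have hm : 0 ≤ min 1 (‖u - v‖ ^ γ) := le_min zero_le_one (by positivity)
    have hS := one_le_wt_add u v
    exact mul_le_mul hKL (mul_le_mul_of_nonneg_left
      (Real.rpow_le_rpow_of_exponent_le hS hab) hm)
      (mul_nonneg hm (Real.rpow_nonneg (zero_le_one.trans hS) _)) (hK.trans hKL)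

end HolderAlgebra

/-! ### Correctors and the discrete Poisson equation -/

section TailSum

variable {Ω E : Type*} {mΩ : MeasurableSpace Ω} {P : Measure Ω} [IsProbabilityMeasure P]
  [NormedAddCommGroup E] [MeasurableSpace E] [BorelSpace E]
  {ℱ : Filtration ℝ≥0 mΩ} {τ : ℕ → ℝ≥0} {Y : ℕ → ℕ → E → Ω → E} {γ a A S K : ℝ}
  {e : ℕ → ℕ → ℝ} {μ : Measure E} {G : ℕ → E → ℝ}

def tailTerm (hY : IsMarkovChain P ℱ τ Y) (μ : Measure E) (G : ℕ → E → ℝ) (k j : ℕ) (y : E) : ℝ :=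
  τ (k + j) * (∫ u, G (k + j) u ∂(chainKernel hY k (k + j) y) - ∫ u, G (k + j) u ∂μ)

/-- `∑_{i ≥ k} τ_i (Q_{k,i} G_i - μ(G_i))`, the corrector of the family `G`. -/
def tailSum (hY : IsMarkovChain P ℱ τ Y) (μ : Measure E) (G : ℕ → E → ℝ) (k : ℕ) (y : E) : ℝ :=
  ∑' j, tailTerm hY μ G k j y

variable [SecondCountableTopology E] {hY : IsMarkovChain P ℱ τ Y}

theorem MixingBound.abs_tailTerm_le (hB : MixingBound hY μ γ a A e S)
    (hG : ∀ i, 1 ≤ i → HolderClass a γ K (G i)) {k : ℕ} (hk : 1 ≤ k) (j : ℕ) (y : E) :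
    |tailTerm hY μ G k j y| ≤ τ (k + j) * e k (k + j) * (K * wt y ^ A) := by
  have h := hB.approx K _ (hG (k + j) (by omega)) k (k + j) y hk (by omega)
  rw [tailTerm, abs_mul, NNReal.abs_eq]
  refine (mul_le_mul_of_nonneg_left h (NNReal.coe_nonneg _)).trans (le_of_eq ?_)
  ring

theorem MixingBound.summable_abs_tailTerm (hB : MixingBound hY μ γ a A e S)
    (hG : ∀ i, 1 ≤ i → HolderClass a γ K (G i)) {k : ℕ} (hk : 1 ≤ k) (y : E) :
    Summable fun j => |tailTerm hY μ G k j y| :=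
  Summable.of_nonneg_of_le (fun _ => abs_nonneg _) (fun j => hB.abs_tailTerm_le hG hk j y)
    ((hB.summable k hk).mul_right _)

theorem MixingBound.measurable_tailTerm (hG : ∀ i, 1 ≤ i → HolderClass a γ K (G i)) {k : ℕ}
    (hk : 1 ≤ k) (j : ℕ) : Measurable (tailTerm hY μ G k j) :=
  (((hG (k + j) (by omega)).measurable.stronglyMeasurable.integral_kernel
    (κ := chainKernel hY k (k + j))).measurable.sub_const _).const_mul _

/-- Both the size and the Hölder increments of each term carry the factor `τ_i e(k,i)`, whose sum is
at most `S`. The exponent and the constant obtained do not depend on `k`. -/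
theorem MixingBound.holderClass_tailSum (hB : MixingBound hY μ γ a A e S)
    (hG : ∀ i, 1 ≤ i → HolderClass a γ K (G i)) {k : ℕ} (hk : 1 ≤ k) :
    HolderClass A γ (K * S) (tailSum hY μ G k) := by
  have hs := fun y => (hB.summable_abs_tailTerm hG hk y).of_abs
  have hK := (hG 1 le_rfl).const_nonneg
  have hsum := (hB.summable k hk).hasSum
  have hle := hB.tsum_le k hk
  have key : ∀ {x c : ℝ} {t : ℕ → ℝ}, HasSum t x → 0 ≤ c →
      (∀ j, |t j| ≤ τ (k + j) * e k (k + j) * (K * c)) → |x| ≤ K * S * c := by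
    intro x c t ht hc hb
    have h1 : |x| ≤ (∑' j, (τ (k + j) : ℝ) * e k (k + j)) * (K * c) := by
      rw [← ht.tsum_eq]
      exact tsum_of_norm_bounded (f := t) (hsum.mul_right (K * c)) fun j => hb j
    calc |x| ≤ _ := h1
      _ ≤ S * (K * c) := mul_le_mul_of_nonneg_right hle (by positivity)
      _ = _ := by ring
  refine ⟨?_, fun u => ?_, fun u v => ?_⟩
  · refine measurable_of_tendsto_metrizable (f := fun n y => ∑ j ∈ Finset.range n,
      tailTerm hY μ G k j y) (fun n => Finset.measurable_fun_sum _ fun j _ =>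
      MixingBound.measurable_tailTerm hG hk j) (tendsto_pi_nhds.2 fun y => ?_)
    exact (hs y).hasSum.tendsto_sum_nat
  · exact key (hs u).hasSum (wt_rpow_nonneg u A) fun j => hB.abs_tailTerm_le hG hk j u
  · have hm : 0 ≤ min 1 (‖u - v‖ ^ γ) := le_min zero_le_one (by positivity)
    refine key ((hs u).hasSum.sub (hs v).hasSum) (mul_nonneg hm
      (Real.rpow_nonneg (zero_le_one.trans (one_le_wt_add u v)) _)) fun j => ?_
    have h := hB.holder K _ (hG (k + j) (by omega)) k (k + j) u v hk (by omega)
    rw [tailTerm, tailTerm, ← mul_sub, sub_sub_sub_cancel_right, abs_mul, NNReal.abs_eq]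
    refine (mul_le_mul_of_nonneg_left h (NNReal.coe_nonneg _)).trans (le_of_eq ?_)
    ring

theorem MixingBound.tailTerm_succ (hB : MixingBound hY μ γ a A e S)
    (hG : ∀ i, 1 ≤ i → HolderClass a γ K (G i)) (k j : ℕ) (y : E) :
    tailTerm hY μ G k (j + 1) y = ∫ z, tailTerm hY μ G (k + 1) j z ∂(chainKernel hY k (k + 1) y) := by
  have hij : k + (j + 1) = k + 1 + j := by omega
  have hi := (hG (k + 1 + j) (by omega)).integrable
    (hB.integrable_left k (k + 1 + j) y (by omega))
  have hc := chainKernel_comp hY (show k ≤ k + 1 by omega) (show k + 1 ≤ k + 1 + j by omega) y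
  simp only [tailTerm, hij]
  rw [hc] at hi
  rw [hc, integral_comp_measure hi, integral_const_mul, integral_sub
    (integrable_integral_of_integrable_comp hi) (integrable_const _)]
  simp

theorem MixingBound.integrable_tailSum (hB : MixingBound hY μ γ a A e S)
    (hG : ∀ i, 1 ≤ i → HolderClass a γ K (G i)) {k n : ℕ} (hn : 1 ≤ n) (hkn : k ≤ n) (y : E) :
    Integrable (tailSum hY μ G n) (chainKernel hY k n y) :=
  (hB.holderClass_tailSum hG hn).integrable (hB.integrable_right k n y hkn)

/-- Chapman–Kolmogorov writes each later term as a one-step average, and dominated summation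
interchanges sum and integral. Only bounds at `k + 1 ≥ 1` enter, so the case `k = 0`, which the
mixing bound does not cover, is included. -/
theorem MixingBound.hasSum_tailTerm_succ (hB : MixingBound hY μ γ a A e S)
    (hG : ∀ i, 1 ≤ i → HolderClass a γ K (G i)) (k : ℕ) (y : E) :
    HasSum (fun j => tailTerm hY μ G k (j + 1) y)
      (∫ z, tailSum hY μ G (k + 1) z ∂(chainKernel hY k (k + 1) y)) := by
  have hk : 1 ≤ k + 1 := by omega
  simp_rw [hB.tailTerm_succ hG]
  have hw : ∀ j, Integrable (fun z => (τ (k + 1 + j) : ℝ) * e (k + 1) (k + 1 + j) *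
      (K * wt z ^ A)) (chainKernel hY k (k + 1) y) := fun j =>
    ((hB.integrable_right k (k + 1) y (by omega)).const_mul K).const_mul _
  refine hasSum_integral_of_summable_integral_norm (fun j => (hw j).mono'
    (MixingBound.measurable_tailTerm hG hk j).aestronglyMeasurable
    (ae_of_all _ fun z => hB.abs_tailTerm_le hG hk j z)) ?_
  refine Summable.of_nonneg_of_le (fun j => integral_nonneg fun z => norm_nonneg _)
    (fun j => ?_) ((hB.summable (k + 1) hk).mul_right
      (∫ z, K * wt z ^ A ∂(chainKernel hY k (k + 1) y)))
  rw [← integral_const_mul]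
  exact integral_mono_of_nonneg (ae_of_all _ fun z => norm_nonneg _) (hw j)
    (ae_of_all _ fun z => hB.abs_tailTerm_le hG hk j z)

theorem MixingBound.summable_tailTerm (hB : MixingBound hY μ γ a A e S)
    (hG : ∀ i, 1 ≤ i → HolderClass a γ K (G i)) (k : ℕ) (y : E) :
    Summable fun j => tailTerm hY μ G k j y :=
  (summable_nat_add_iff 1).1 (hB.hasSum_tailTerm_succ hG k y).summable

/-- The Poisson equation: the term `i = k` is split off, where the kernel is a Dirac mass. -/
theorem MixingBound.tailSum_eq (hB : MixingBound hY μ γ a A e S)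
    (hG : ∀ i, 1 ≤ i → HolderClass a γ K (G i)) (k : ℕ) (y : E) :
    tailSum hY μ G k y = τ k * (G k y - ∫ u, G k u ∂μ) +
      ∫ z, tailSum hY μ G (k + 1) z ∂(chainKernel hY k (k + 1) y) := by
  rw [tailSum, (hB.summable_tailTerm hG k y).tsum_eq_zero_add,
    (hB.hasSum_tailTerm_succ hG k y).tsum_eq, tailTerm, add_zero, chainKernel_self,
    integral_dirac]

theorem MixingBound.condExp_tailSum (hB : MixingBound hY μ γ a A e S)
    (hG : ∀ i, 1 ≤ i → HolderClass a γ K (G i)) (k : ℕ) (x : E) :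
    P[fun ω => tailSum hY μ G (k + 1) (Y 0 (k + 1) x ω) | ℱ (grid τ k)] =ᵐ[P] fun ω =>
      tailSum hY μ G k (Y 0 k x ω) -
        τ k * (G k (Y 0 k x ω) - ∫ u, G k u ∂μ) := by
  have hk : 1 ≤ k + 1 := by omega
  have hm := (hB.holderClass_tailSum hG hk).measurable
  have hi : Integrable (fun ω => tailSum hY μ G (k + 1) (Y 0 (k + 1) x ω)) P := by
    have := hB.integrable_tailSum hG hk (Nat.zero_le (k + 1)) x
    rw [chainKernel_apply hY (Nat.zero_le _)] at this
    exact this.comp_measurable (hY.measurable (Nat.zero_le _) x)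
  filter_upwards [condExp_chain hY (Nat.zero_le k) (Nat.le_succ k) x hm hi] with ω hω
  rw [hω, hB.tailSum_eq hG k]
  ring

end TailSum

/-! ### The second corrector and the quadratic variation of the chain martingale -/

section QuadraticVariation

variable {Ω E : Type*} {mΩ : MeasurableSpace Ω} {P : Measure Ω} [IsProbabilityMeasure P]
  [NormedAddCommGroup E] [MeasurableSpace E] [BorelSpace E] [SecondCountableTopology E]
  {ℱ : Filtration ℝ≥0 mΩ} {τ : ℕ → ℝ≥0} {Y : ℕ → ℕ → E → Ω → E} {γ a A A' S S' K : ℝ}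
  {e e' : ℕ → ℕ → ℝ} {μ : Measure E} {G : ℕ → E → ℝ} {F : E → ℝ}
  {q q' L₄ κ L₅ : ℝ} {ρτ : ℝ≥0 → ℝ≥0}

/-- The filtration sampled along the grid. -/
def gridFiltration (ℱ : Filtration ℝ≥0 mΩ) (τ : ℕ → ℝ≥0) : Filtration ℕ mΩ where
  seq n := ℱ (grid τ n)
  mono' _ _ h := ℱ.mono (grid_mono τ h)
  le' _ := ℱ.le _

/-- The integrand of the compensator of `M²`. -/
def quadTerm (hY : IsMarkovChain P ℱ τ Y) (μ : Measure E) (F : E → ℝ) (k : ℕ) (y : E) : ℝ :=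
  2 * (F y * tailSum hY μ (fun _ => F) k y) - τ k * (F y * F y)

variable {hY : IsMarkovChain P ℱ τ Y}

/-- At `k = 0` the function `G 0` is not controlled. Since `τ_0 = 0`, the Poisson equation removes
it and leaves the one-step average of the corrector at index 1. -/
theorem MixingBound.measurable_tailSum (hB : MixingBound hY μ γ a A e S)
    (hG : ∀ i, 1 ≤ i → HolderClass a γ K (G i)) (hτ : IsStepSequence τ) (k : ℕ) :
    Measurable (tailSum hY μ G k) := by
  rcases Nat.eq_zero_or_pos k with rfl | hk
  · have h : tailSum hY μ G 0 = fun y => ∫ z, tailSum hY μ G 1 z ∂(chainKernel hY 0 1 y) := by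
      ext y
      rw [hB.tailSum_eq hG 0 y, hτ.zero, NNReal.coe_zero, zero_mul, zero_add]
    rw [h]
    exact ((hB.holderClass_tailSum hG le_rfl).measurable.stronglyMeasurable.integral_kernel
      (κ := chainKernel hY 0 1)).measurable
  · exact (hB.holderClass_tailSum hG hk).measurable

/-- Products add growth exponents, and the bounded steps keep the constant uniform in `k`. The
mixing bound therefore applies again, with `a + A` in place of `a`. -/
theorem MixingBound.holderClass_quadTerm (hB : MixingBound hY μ γ a A e S)
    (hF : HolderClass a γ K F) (hτ : IsStepSequence τ) (ha : 0 ≤ a) (haA : a ≤ A) :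
    ∃ K', ∀ k, 1 ≤ k → HolderClass (a + A) γ K' (quadTerm hY μ F k) := by
  obtain ⟨T, hT, hle⟩ := exists_step_le hτ
  have hK := hF.const_nonneg
  refine ⟨2 * (2 * K * (K * S)) + T * (2 * K * K), fun k hk => ?_⟩
  have h1 := (hF.mul (hB.holderClass_tailSum (G := fun _ => F) (fun _ _ => hF) hk) ha
    (ha.trans haA)).const_mul 2
  have h2 := ((hF.mul hF ha ha).const_mul (τ k : ℝ)).mono (b := a + A) (L := T * (2 * K * K))
    (by linarith) (by rw [NNReal.abs_eq]; exact mul_le_mul_of_nonneg_right (hle k) (by positivity))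
  rw [abs_two] at h1
  exact h1.sub h2

theorem exists_eLpNorm_wt_rpow_le (h₂ : SchemeAssumption P τ Y q q' L₄ κ L₅ ρτ)
    (hY : IsMarkovChain P ℱ τ Y) (x : E) {B s : ℝ} (hB : 0 ≤ B) (hs : 0 < s) (hBs : s * B ≤ q) :
    ∃ D, 0 ≤ D ∧ ∀ n, eLpNorm (fun ω => wt (Y 0 n x ω) ^ B) (ENNReal.ofReal s) P ≤
      ENNReal.ofReal D := by
  obtain ⟨C, hC, hmom⟩ := h₂.moment_wt hY
  have hw := wt_rpow_nonneg x (q' * (s * B))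
  refine ⟨(C * wt x ^ (q' * (s * B))) ^ (1 / s), by positivity, fun n => ?_⟩
  obtain ⟨hi, hle⟩ := hmom (s * B) (by positivity) hBs 0 n x (Nat.zero_le _)
  rw [chainKernel_apply hY (Nat.zero_le _)] at hi hle
  have hYm := hY.measurable (Nat.zero_le n) x
  have hwm : Measurable fun u : E => wt u ^ (s * B) := measurable_wt.pow_const _
  rw [integral_map hYm.aemeasurable hwm.aestronglyMeasurable] at hle
  have hi' : Integrable (fun ω => wt (Y 0 n x ω) ^ (s * B)) P := hi.comp_measurable hYm
  rw [eLpNorm_eq_lintegral_rpow_enorm_toReal (by simp [hs]) ENNReal.ofReal_ne_top,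
    ENNReal.toReal_ofReal hs.le, ← ENNReal.ofReal_rpow_of_nonneg (by positivity) (by positivity)]
  refine ENNReal.rpow_le_rpow ?_ (by positivity)
  refine le_trans (le_of_eq ?_) (ENNReal.ofReal_le_ofReal hle)
  rw [ofReal_integral_eq_lintegral_ofReal hi' (ae_of_all _ fun ω => wt_rpow_nonneg _ _)]
  refine lintegral_congr fun ω => ?_
  rw [Real.enorm_eq_ofReal (wt_rpow_nonneg _ _), ENNReal.ofReal_rpow_of_nonneg
    (wt_rpow_nonneg _ _) hs.le, ← Real.rpow_mul (wt_pos _).le, mul_comm B]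

/-- The abstract theorem is applied with `φ_n(Y_n)` as corrector of `F(Y_n)` and `ψ_n(Y_n)` as
corrector of the quadratic term. The envelope is a power of the weight of `Y_n`: `2 * A`
accommodates `φ²` and `A'` accommodates `ψ`. -/
theorem ae_tendsto_average_sq_increments_tailSum (hτ : IsStepSequence τ)
    (h₂ : SchemeAssumption P τ Y q q' L₄ κ L₅ ρτ)
    (hB : MixingBound hY μ γ a A e S) (hB' : MixingBound hY μ γ (a + A) A' e' S')
    (hF : HolderClass a γ K F) (hF0 : ∫ u, F u ∂μ = 0) (ha : 0 ≤ a) (haA : a ≤ A) {s : ℝ}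
    (h1 : 1 < s) (h2 : s ≤ 2) (hsA : s * (2 * A) ≤ q) (hsA' : s * A' ≤ q) {L : ℝ}
    (hL : Tendsto (fun k => ∫ u, quadTerm hY μ F k u ∂μ) atTop (𝓝 L)) (x : E) :
    ∀ᵐ ω ∂P, Tendsto (fun N : ℕ => 1 / (coarseGrid τ N : ℝ) * ∑ k ∈ Finset.range N,
      (accum (fun j => (τ j : ℝ)) (fun j ω => F (Y 0 j x ω))
          (fun j ω => tailSum hY μ (fun _ => F) j (Y 0 j x ω)) (coarseIndex τ (k + 1)) ω -
        accum (fun j => (τ j : ℝ)) (fun j ω => F (Y 0 j x ω))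
          (fun j ω => tailSum hY μ (fun _ => F) j (Y 0 j x ω)) (coarseIndex τ k) ω) ^ 2)
      atTop (𝓝 L) := by
  obtain ⟨K', hQ⟩ := hB.holderClass_quadTerm hF hτ ha haA
  have hFc : ∀ i, 1 ≤ i → HolderClass a γ K ((fun _ => F) i) := fun _ _ => hF
  have hK := hF.const_nonneg
  have hA : 0 ≤ A := ha.trans haA
  set φ := tailSum hY μ (fun _ => F) with hφ
  set ψ := tailSum hY μ (quadTerm hY μ F) with hψ
  set B := max (2 * A) A' with hBdef
  have hB0 : 0 ≤ B := le_max_of_le_left (by linarith)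
  have hsB : s * B ≤ q := by
    rw [hBdef, mul_max_of_nonneg _ _ (by linarith)]
    exact max_le hsA hsA'
  obtain ⟨D, hD, hwD⟩ := exists_eLpNorm_wt_rpow_le h₂ hY x hB0 (by linarith) hsB
  have hmeas : ∀ n {g : E → ℝ}, Measurable g →
      StronglyMeasurable[gridFiltration ℱ τ n] fun ω => g (Y 0 n x ω) := fun n g hg =>
    (hg.comp (hY.adapted 0 n x (Nat.zero_le n))).stronglyMeasurable
  have hinit := hY.initial 0 x
  -- The last two summands treat the index 0, where the growth bounds are not available but the
  -- chain sits at `x` almost surely.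
  set C := K ^ 2 + (K * S) ^ 2 + |K' * S'| + φ 0 x ^ 2 + |ψ 0 x| with hC
  have hsq : ∀ {c b : ℝ} {g : E → ℝ} (u : E), (∀ u, |g u| ≤ c * wt u ^ b) → b ≤ A →
      g u ^ 2 ≤ c ^ 2 * wt u ^ B := by
    intro c b g u hg hb
    have h3 : (wt u ^ b) ^ 2 ≤ wt u ^ B := by
      rw [← Real.rpow_natCast, ← Real.rpow_mul (wt_pos u).le]
      refine wt_rpow_mono u ?_
      push_cast
      linarith [le_max_left (2 * A) A']
    calc g u ^ 2 ≤ (c * wt u ^ b) ^ 2 := sq_le_sq' (by linarith [neg_abs_le (g u), hg u])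
          ((le_abs_self _).trans (hg u))
      _ = c ^ 2 * (wt u ^ b) ^ 2 := mul_pow _ _ 2
      _ ≤ _ := mul_le_mul_of_nonneg_left h3 (sq_nonneg c)
  have hwB : ∀ u : E, 1 ≤ wt u ^ B := fun u => one_le_wt_rpow u hB0
  refine ae_tendsto_average_sq_increments (𝓕 := gridFiltration ℱ τ)
    (h := fun n ω => ψ n (Y 0 n x ω)) (m := fun k => ∫ u, quadTerm hY μ F k u ∂μ)
    (w := fun n ω => wt (Y 0 n x ω) ^ B) (C := C) (D := D) hτ
    (fun n => hmeas n hF.measurable) (fun n => hmeas n (hB.measurable_tailSum hFc hτ n))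
    (fun n => hmeas n (hB'.measurable_tailSum hQ hτ n)) (fun n => ?_) (fun n => ?_) hL h1 h2
    (by positivity) hD (fun n => ?_) hwD (fun n => ae_of_all _ fun ω => ?_) (fun n => ?_)
    (fun n => ?_)
  · filter_upwards [hB.condExp_tailSum hFc n x] with ω hω
    refine hω.trans ?_
    rw [hF0, sub_zero]
  · filter_upwards [hB'.condExp_tailSum hQ n x] with ω hω
    refine hω.trans ?_
    rw [quadTerm]
    ring
  · exact ((measurable_wt.pow_const B).comp (hY.measurable (Nat.zero_le n) x)).aestronglyMeasurable
  · refine (hsq (Y 0 n x ω) hF.growth haA).trans ?_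
    refine mul_le_mul_of_nonneg_right ?_ (wt_rpow_nonneg _ _)
    rw [hC]
    linarith [sq_nonneg (K * S), abs_nonneg (K' * S'), sq_nonneg (φ 0 x), abs_nonneg (ψ 0 x)]
  · rcases Nat.eq_zero_or_pos n with rfl | hn
    · filter_upwards [hinit] with ω hω
      rw [hω]
      refine le_trans ?_ (le_mul_of_one_le_right (by positivity) (hwB x))
      rw [hC]
      linarith [sq_nonneg (K * S), abs_nonneg (K' * S'), sq_nonneg K, abs_nonneg (ψ 0 x)]
    · refine ae_of_all _ fun ω => ?_
      refine (hsq (Y 0 n x ω) (hB.holderClass_tailSum hFc hn).growth le_rfl).trans ?_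
      refine mul_le_mul_of_nonneg_right ?_ (wt_rpow_nonneg _ _)
      rw [hC]
      linarith [sq_nonneg K, abs_nonneg (K' * S'), sq_nonneg (φ 0 x), abs_nonneg (ψ 0 x)]
  · rcases Nat.eq_zero_or_pos n with rfl | hn
    · filter_upwards [hinit] with ω hω
      rw [hω]
      refine le_trans ?_ (le_mul_of_one_le_right (by positivity) (hwB x))
      rw [hC]
      linarith [sq_nonneg (K * S), abs_nonneg (K' * S'), sq_nonneg K, sq_nonneg (φ 0 x)]
    · refine ae_of_all _ fun ω => ?_
      refine ((hB'.holderClass_tailSum hQ hn).growth _).trans ?_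
      have hle : K' * S' ≤ C := by
        rw [hC]
        linarith [sq_nonneg (K * S), le_abs_self (K' * S'), sq_nonneg K, sq_nonneg (φ 0 x),
          abs_nonneg (ψ 0 x)]
      exact mul_le_mul hle (wt_rpow_mono _ (le_max_right _ _)) (wt_rpow_nonneg _ _)
        (by positivity)

end QuadraticVariation

/-! ### Riemann sums on the nonuniform grid -/

section RiemannSums

variable {τ : ℕ → ℝ≥0}

theorem abs_integral_sub_mul_le {C : ℝ → ℝ} {M θ x y : ℝ} (hx : 0 ≤ x) (hxy : x ≤ y)
    (hM : 0 ≤ M) (hθ : 0 ≤ θ)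
    (hC : ∀ s h, 0 ≤ s → 0 ≤ h → |C (s + h) - C s| ≤ M * h ^ θ)
    (hi : IntegrableOn C (Set.Ioi 0)) :
    |(y - x) * C y - ∫ t in x..y, C t| ≤ (y - x) * (M * (y - x) ^ θ) := by
  have hiI : IntervalIntegrable C volume x y := by
    rw [intervalIntegrable_iff_integrableOn_Ioc_of_le hxy]
    exact hi.mono_set fun t ht => lt_of_le_of_lt hx ht.1
  have h1 : (y - x) * C y = ∫ _ in x..y, C y := by
    rw [intervalIntegral.integral_const, smul_eq_mul]
  rw [h1, ← intervalIntegral.integral_sub intervalIntegrable_const hiI, ← Real.norm_eq_abs]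
  refine (intervalIntegral.norm_integral_le_of_norm_le_const fun t ht => ?_).trans
    (le_of_eq (by rw [abs_of_nonneg (sub_nonneg.2 hxy)]; exact mul_comm _ _))
  rw [Set.uIoc_of_le hxy] at ht
  have h2 := hC t (y - t) (hx.trans ht.1.le) (sub_nonneg.2 ht.2)
  rw [add_sub_cancel] at h2
  refine h2.trans (mul_le_mul_of_nonneg_left (Real.rpow_le_rpow (sub_nonneg.2 ht.2) ?_ hθ) hM)
  linarith [ht.1]

theorem mul_rpow_eq_rpow_one_add {x b : ℝ} (hx : 0 ≤ x) (hb : 0 ≤ b) :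
    x * x ^ b = x ^ (1 + b) := by
  rw [Real.rpow_add_of_nonneg hx zero_le_one hb, Real.rpow_one]

/-- The sum is compared with a right-endpoint Riemann sum of `C` based at `t_j`. The two errors per
cell are `τ^(1+δ)` from replacing `c` by `C` and `τ^(1+θ)` from the modulus of continuity. Both are
summable, so their tails vanish as `j → ∞`. -/
theorem tendsto_sum_grid_integral (hτ : IsStepSequence τ) {C : ℝ → ℝ} {M M' θ δ : ℝ}
    (hM : 0 ≤ M) (hθ : 0 ≤ θ) (hδ : 0 ≤ δ)
    (hC : ∀ s h, 0 ≤ s → 0 ≤ h → |C (s + h) - C s| ≤ M * h ^ θ)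
    (hi : IntegrableOn C (Set.Ioi 0)) (hsθ : Summable fun n => (τ n : ℝ) ^ (1 + θ))
    (hsδ : Summable fun n => (τ n : ℝ) ^ (1 + δ)) {c : ℕ → ℕ → ℝ}
    (hc : ∀ j i, 1 ≤ j → j ≤ i → |c j i - C ((grid τ i : ℝ) - grid τ j)| ≤ M' * (τ i : ℝ) ^ δ)
    {S : ℕ → ℝ} (hS : ∀ j, 1 ≤ j → HasSum (fun i => (τ (j + i) : ℝ) * c j (j + i)) (S j)) :
    Tendsto S atTop (𝓝 (∫ t in Set.Ioi 0, C t)) := by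
  set ε : ℕ → ℝ := fun n => M' * (τ n : ℝ) ^ (1 + δ) + M * (τ n : ℝ) ^ (1 + θ) with hε
  have hεs : Summable ε := (hsδ.mul_left M').add (hsθ.mul_left M)
  have hτ0 : Tendsto (fun n => (τ n : ℝ)) atTop (𝓝 0) := NNReal.tendsto_coe.2 hτ.tendsto_zero
  have hb : ∀ j, 1 ≤ j → |S j - ∫ t in Set.Ioi 0, C t| ≤
      (τ j : ℝ) * |C 0| + M' * (τ j : ℝ) ^ (1 + δ) + ∑' i, ε (i + (j + 1)) := by
    intro j hj
    set g : ℕ → ℝ := fun i => (grid τ (j + i) : ℝ) - grid τ j with hg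
    have hg0 : g 0 = 0 := by simp [hg]
    have hgs : ∀ i, g (i + 1) - g i = τ (j + i + 1) := by
      intro i
      simp only [hg]
      rw [← add_assoc, grid_succ]
      push_cast
      ring
    have hgm : Monotone g := fun i i' h => by
      have : grid τ (j + i) ≤ grid τ (j + i') := grid_mono τ (by omega)
      simp only [hg]
      gcongr
    have hg_nonneg : ∀ i, 0 ≤ g i := fun i => hg0 ▸ hgm (Nat.zero_le i)
    have hgt : Tendsto g atTop atTop := by
      refine tendsto_atTop_add_const_right atTop (-(grid τ j : ℝ)) ?_
      exact (NNReal.tendsto_coe_atTop.2 hτ.tendsto_grid).comp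
        (tendsto_atTop_mono (fun i => Nat.le_add_left i j) tendsto_id)
    have hii : ∀ x y, 0 ≤ x → 0 ≤ y → IntervalIntegrable C volume x y := by
      intro x y hx hy
      rw [intervalIntegrable_iff]
      exact hi.mono_set fun t ht => lt_of_le_of_lt (le_min hx hy) ht.1
    set d : ℕ → ℝ := fun i => (τ (j + i + 1) : ℝ) * c j (j + i + 1) -
      ∫ t in (g i)..(g (i + 1)), C t with hd
    have hdε : ∀ i, |d i| ≤ ε (i + (j + 1)) := by
      intro i
      have h1 := hc j (j + i + 1) hj (by omega)
      have h2 := abs_integral_sub_mul_le (hg_nonneg i) (hgm (Nat.le_succ i)) hM hθ hC hi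
      have h3 : (grid τ (j + i + 1) : ℝ) - grid τ j = g (i + 1) := rfl
      rw [h3] at h1
      rw [Nat.succ_eq_add_one, hgs i] at h2
      have h4 : d i = (τ (j + i + 1) : ℝ) * (c j (j + i + 1) - C (g (i + 1))) +
          (τ (j + i + 1) * C (g (i + 1)) - ∫ t in (g i)..(g (i + 1)), C t) := by
        simp only [hd]
        ring
      have ht := NNReal.coe_nonneg (τ (j + i + 1))
      rw [h4]
      refine (abs_add_le _ _).trans ?_
      rw [abs_mul, NNReal.abs_eq]
      refine (add_le_add (mul_le_mul_of_nonneg_left h1 ht) h2).trans (le_of_eq ?_)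
      simp only [hε]
      rw [show i + (j + 1) = j + i + 1 by omega, ← mul_rpow_eq_rpow_one_add ht hδ,
        ← mul_rpow_eq_rpow_one_add ht hθ]
      ring
    have hεj : Summable fun i => ε (i + (j + 1)) := (summable_nat_add_iff (j + 1)).2 hεs
    have hds : Summable d := hεj.of_norm_bounded hdε
    have hdle : |∑' i, d i| ≤ ∑' i, ε (i + (j + 1)) := 
      tsum_of_norm_bounded (f := d) hεj.hasSum fun i => hdε i
    -- The term `i = 0` has no cell to its left and is kept apart. It tends to 0 together with
    -- `τ_j`.
    have hpart : ∀ N, ∑ i ∈ Finset.range (N + 1), (τ (j + i) : ℝ) * c j (j + i) =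
        τ j * c j j + ∑ i ∈ Finset.range N, d i + ∫ t in (0 : ℝ)..(g N), C t := by
      intro N
      rw [Finset.sum_range_succ', add_zero]
      have h5 : ∫ t in (0 : ℝ)..(g N), C t =
          ∑ i ∈ Finset.range N, ∫ t in (g i)..(g (i + 1)), C t := by
        rw [intervalIntegral.sum_integral_adjacent_intervals
          fun i _ => hii _ _ (hg_nonneg i) (hg_nonneg (i + 1)), hg0]
      rw [h5, add_assoc, ← Finset.sum_add_distrib, add_comm]
      congr 1
      refine Finset.sum_congr rfl fun i _ => ?_
      simp only [hd]
      rw [← add_assoc j i 1]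
      ring
    have hlim : Tendsto (fun N => ∑ i ∈ Finset.range (N + 1), (τ (j + i) : ℝ) * c j (j + i)) atTop
        (𝓝 (τ j * c j j + ∑' i, d i + ∫ t in Set.Ioi 0, C t)) := by
      simp_rw [hpart]
      exact (hds.hasSum.tendsto_sum_nat.const_add _).add
        (intervalIntegral_tendsto_integral_Ioi 0 hi hgt)
    have hSj : S j = τ j * c j j + ∑' i, d i + ∫ t in Set.Ioi 0, C t :=
      tendsto_nhds_unique ((hS j hj).tendsto_sum_nat.comp (tendsto_add_atTop_nat 1)) hlim
    rw [hSj, add_sub_cancel_right]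
    refine (abs_add_le _ _).trans (add_le_add ?_ hdle)
    have h6 := hc j j hj le_rfl
    rw [sub_self] at h6
    have h7 : |c j j| ≤ |C 0| + M' * (τ j : ℝ) ^ δ := by
      have := abs_sub_abs_le_abs_sub (c j j) (C 0)
      linarith
    have ht := NNReal.coe_nonneg (τ j)
    rw [abs_mul, NNReal.abs_eq, ← mul_rpow_eq_rpow_one_add ht hδ]
    refine (mul_le_mul_of_nonneg_left h7 ht).trans (le_of_eq (by ring))
  rw [tendsto_iff_norm_sub_tendsto_zero]
  refine squeeze_zero' (Eventually.of_forall fun _ => norm_nonneg _)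
    ((eventually_ge_atTop 1).mono hb) ?_
  have e1 := hτ0.mul_const |C 0|
  have e2 := (hsδ.tendsto_atTop_zero).const_mul M'
  have e3 := (tendsto_sum_nat_add ε).comp (tendsto_add_atTop_nat 1)
  simpa using (e1.add e2).add e3

/-- Convergence to 0 makes some average with `n ≥ 2` finite. Its summand `j = 1` is then finite and
has positive weight `τ_1`. -/
theorem StepConditions.summable_rpow {ρ ρτ : ℝ≥0 → ℝ≥0} {γ α l' : ℝ} (hτ : IsStepSequence τ)
    (hstep : StepConditions τ ρ ρτ γ α l') : Summable fun n => (τ n : ℝ) ^ (1 + l' * γ) := by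
  obtain ⟨n, hn, hn2⟩ := ((hstep.average.eventually_lt_const ENNReal.zero_lt_top).and
    (eventually_ge_atTop 2)).exists
  have h1 : (∑ j ∈ Finset.range n, (τ j : ℝ≥0∞) *
      ((∑' i : ℕ, ((τ (j + i) ^ (γ * α) * τ (j + i + 1) : ℝ≥0) : ℝ≥0∞)) +
        ∑' i : ℕ, ((τ (j + 1 + i) ^ (1 + l' * γ) : ℝ≥0) : ℝ≥0∞))) ≠ ∞ := by
    intro h
    rw [h, ENNReal.top_div_coe] at hn
    exact lt_irrefl _ hn
  have h2 := ENNReal.sum_ne_top.1 h1 1 (Finset.mem_range.2 (by omega))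
  have hτ1 : (τ 1 : ℝ≥0∞) ≠ 0 := by
    simpa using (hτ.pos 1 le_rfl).ne'
  have h3 : ∑' i : ℕ, ((τ (1 + 1 + i) ^ (1 + l' * γ) : ℝ≥0) : ℝ≥0∞) ≠ ∞ := by
    intro h
    rw [h, add_top, ENNReal.mul_top hτ1] at h2
    exact h2 rfl
  have h4 := NNReal.summable_coe.2 (ENNReal.tsum_coe_ne_top_iff_summable.1 h3)
  rw [← summable_nat_add_iff 2]
  refine h4.congr fun i => ?_
  rw [NNReal.coe_rpow, add_comm (1 + 1) i]

end RiemannSums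

/-! ### Decay, regularity and integrability of the autocovariance -/

section Autocovariance

theorem continuous_of_abs_add_sub_le {u : ℝ≥0 → ℝ} {M θ : ℝ} (hθ : 0 < θ)
    (h : ∀ s t : ℝ≥0, |u (s + t) - u s| ≤ M * (t : ℝ) ^ θ) : Continuous u := by
  have hd : ∀ s t, dist (u t) (u s) ≤ M * dist t s ^ θ := by
    intro s t
    rcases le_total s t with hst | hst
    · have := h s (t - s)
      rwa [add_tsub_cancel_of_le hst, NNReal.coe_sub hst, ← abs_of_nonneg (a := (t : ℝ) - s)
        (sub_nonneg.2 hst), ← NNReal.dist_eq] at this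
    · have := h t (s - t)
      rwa [add_tsub_cancel_of_le hst, NNReal.coe_sub hst, ← abs_of_nonneg (a := (s : ℝ) - t)
        (sub_nonneg.2 hst), ← NNReal.dist_eq, abs_sub_comm, dist_comm] at this
  refine continuous_iff_continuousAt.2 fun s => tendsto_iff_dist_tendsto_zero.2 ?_
  refine squeeze_zero (fun _ => dist_nonneg) (hd s) ?_
  have hc : Continuous fun t : ℝ≥0 => M * dist t s ^ θ :=
    continuous_const.mul ((Real.continuous_rpow_const hθ.le).comp (by fun_prop))
  have := hc.tendsto s
  rwa [dist_self, Real.zero_rpow hθ.ne', mul_zero] at this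

variable {Ω E : Type*} {mΩ : MeasurableSpace Ω} {P : Measure Ω} [IsProbabilityMeasure P]
  [NormedAddCommGroup E] [MeasurableSpace E] [BorelSpace E] [SecondCountableTopology E]
  {ℱ : Filtration ℝ≥0 mΩ} {X : ℝ≥0 → ℝ≥0 → E → Ω → E} {τ : ℕ → ℝ≥0} {Y : ℕ → ℕ → E → Ω → E}
  {r r' L₁ γ₁ β L₂ : ℝ} {ρ : ℝ≥0 → ℝ≥0} {l l' L₃ : ℝ} {q q' L₄ κ L₅ : ℝ} {ρτ : ℝ≥0 → ℝ≥0}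
  {α L₆ γ a K : ℝ} {μ : Measure E} {F : E → ℝ}

/-- As `F` has `μ`-mean zero, invariance allows the average over `z ~ μ` of the values started at
`z` to be subtracted. Attractiveness bounds the difference. -/
theorem ProcessAssumption.exists_abs_integral_le (hX : IsMarkovProcess P ℱ X)
    (h₁ : ProcessAssumption P X r r' L₁ γ₁ β L₂ ρ l l' L₃) [IsProbabilityMeasure μ]
    (hinv : ∀ t, procKernel hX t ∘ₘ μ = μ)
    (hμ : ∀ a, 0 ≤ a → a ≤ r → Integrable (fun u => wt u ^ a) μ) (ha : 0 ≤ a) (har : 2 * a ≤ r)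
    (hη : β * γ₁ + r' * a + γ₁ ≤ r) :
    ∃ C, 0 ≤ C ∧ ∀ K F, HolderClass a γ₁ K F → ∫ u, F u ∂μ = 0 → ∀ t x,
      |∫ u, F u ∂(procKernel hX t x)| ≤
        K * (C * ((ρ t : ℝ) ^ γ₁ * wt x ^ (β * γ₁ + r' * a + γ₁))) := by
  obtain ⟨C, hC, h⟩ := h₁.holder hX ha har h₁.γ₁_pos h₁.γ₁_le_one
  have hβ := h₁.β_nonneg
  have hr' := h₁.one_le_r'
  have hγ := h₁.γ₁_pos
  set b := β * γ₁ + r' * a with hb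
  have hb0 : 0 ≤ b := by positivity
  have hi := hμ (b + γ₁) (by positivity) hη
  set I := ∫ z, wt z ^ (b + γ₁) ∂μ with hI_def
  have hI : 0 ≤ I := integral_nonneg fun z => wt_rpow_nonneg z _
  clear_value I
  refine ⟨C * (2 ^ (b + γ₁) * (1 + I)), by positivity, fun K F hF hF0 t x => ?_⟩
  have hK := hF.const_nonneg
  have hFi : Integrable F (procKernel hX t ∘ₘ μ) := by
    rw [hinv]
    exact hF.integrable (hμ a ha (by linarith))
  have hKi := integrable_integral_of_integrable_comp hFi
  have h0 : ∫ z, ∫ u, F u ∂(procKernel hX t z) ∂μ = 0 := by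
    rw [← integral_comp_measure hFi, hinv, hF0]
  have h1 : ∫ u, F u ∂(procKernel hX t x) =
      ∫ z, (∫ u, F u ∂(procKernel hX t x) - ∫ u, F u ∂(procKernel hX t z)) ∂μ := by
    rw [integral_sub (integrable_const _) hKi, h0]
    simp
  rw [h1, ← Real.norm_eq_abs]
  have hR : Integrable (fun z => K * (C * ((ρ t : ℝ) ^ γ₁ * (2 ^ (b + γ₁) *
      (wt x ^ (b + γ₁) + wt z ^ (b + γ₁)))))) μ :=
    ((((integrable_const _).add hi).const_mul _).const_mul _ |>.const_mul _).const_mul _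
  refine (norm_integral_le_of_norm_le hR (ae_of_all _ fun z => ?_)).trans ?_
  · exact (h K F hF t x z).trans (mul_le_mul_of_nonneg_left (mul_le_mul_of_nonneg_left
      (mul_le_mul_of_nonneg_left (norm_sub_rpow_mul_wt_rpow_le x z hb0 hγ) (by positivity)) hC) hK)
  · rw [integral_const_mul, integral_const_mul, integral_const_mul, integral_const_mul,
      integral_add (integrable_const _) hi, integral_const, probReal_univ, one_smul, ← hI_def]
    refine mul_le_mul_of_nonneg_left ?_ hK
    have hw : 1 ≤ wt x ^ (b + γ₁) := one_le_wt_rpow x (by positivity)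
    calc _ ≤ C * ((ρ t : ℝ) ^ γ₁ * (2 ^ (b + γ₁) * (wt x ^ (b + γ₁) + I * wt x ^ (b + γ₁)))) := by
          gcongr
          exact le_mul_of_one_le_right hI hw
      _ = _ := by ring

theorem ProcessAssumption.exists_abs_integral_add_sub_le (hX : IsMarkovProcess P ℱ X)
    (h₁ : ProcessAssumption P X r r' L₁ γ₁ β L₂ ρ l l' L₃) (ha : 0 ≤ a) (har : 2 * a ≤ r)
    (hγ : 0 < γ) (hγ1 : γ ≤ 1) (hb : l * γ + r' * a ≤ r) :
    ∃ C, 0 ≤ C ∧ ∀ K F, HolderClass a γ K F → ∀ s t x,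
      |∫ u, F u ∂(procKernel hX (s + t) x) - ∫ u, F u ∂(procKernel hX s x)| ≤
        K * (C * ((t : ℝ) ^ (l' * γ) * ∫ u, wt u ^ (l * γ + r' * a) ∂(procKernel hX s x))) := by
  obtain ⟨C, hC, h⟩ := h₁.time_regular hX ha har hγ hγ1
  obtain ⟨D, hD, hmom⟩ := h₁.moment_wt hX
  have hl := h₁.l_nonneg
  have hr' := h₁.one_le_r'
  refine ⟨C, hC, fun K F hF s t x => ?_⟩
  have hFi : ∀ t, Integrable F (procKernel hX t x) := fun t =>
    hF.integrable (hmom a ha (by linarith) t x).1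
  have hwi := (hmom (l * γ + r' * a) (by positivity) hb s x).1
  have hKi : Integrable (fun z => ∫ u, F u ∂(procKernel hX t z)) (procKernel hX s x) := by
    refine integrable_integral_of_integrable_comp (K := procKernel hX t) ?_
    rw [← procKernel_add]
    exact hFi (s + t)
  rw [integral_procKernel_add hX s t x (hFi (s + t)), ← integral_sub hKi (hFi s),
    ← Real.norm_eq_abs, ← integral_const_mul, ← integral_const_mul, ← integral_const_mul]
  exact norm_integral_le_of_norm_le (((hwi.const_mul _).const_mul _).const_mul _)
    (ae_of_all _ fun z => h K F hF t z)

/-- Joint measurability of `X` in time and space is not assumed. Continuity in `t` together with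
measurability in `x` supplies it for `P_t F(x)`, as Fubini requires. -/
theorem ProcessAssumption.continuous_integral_procKernel (hX : IsMarkovProcess P ℱ X)
    (h₁ : ProcessAssumption P X r r' L₁ γ₁ β L₂ ρ l l' L₃) (ha : 0 ≤ a) (har : 2 * a ≤ r)
    (hγ : 0 < γ) (hγ1 : γ ≤ 1) (hb : l * γ + r' * a ≤ r) (hF : HolderClass a γ K F) (x : E) :
    Continuous fun t => ∫ u, F u ∂(procKernel hX t x) := by
  obtain ⟨C, hC, h⟩ := h₁.exists_abs_integral_add_sub_le hX ha har hγ hγ1 hb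
  obtain ⟨D, hD, hmom⟩ := h₁.moment_wt hX
  have hl := h₁.l_nonneg
  have hr' := h₁.one_le_r'
  have hK := hF.const_nonneg
  refine continuous_of_abs_add_sub_le (M := K * (C * (D * wt x ^ (r' * (l * γ + r' * a)))))
    (mul_pos h₁.l'_pos hγ) fun s t => (h K F hF s t x).trans ?_
  have hm := (hmom (l * γ + r' * a) (by positivity) hb s x).2
  calc _ ≤ K * (C * ((t : ℝ) ^ (l' * γ) * (D * wt x ^ (r' * (l * γ + r' * a))))) := by gcongr
    _ = _ := by ring

/-- `μ(F P_t F)`. -/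
def autocov (hX : IsMarkovProcess P ℱ X) (μ : Measure E) (F : E → ℝ) (t : ℝ≥0) : ℝ :=
  ∫ x, F x * ∫ u, F u ∂(procKernel hX t x) ∂μ

theorem HolderClass.integrable_mul_integral {b M : ℝ} (hF : HolderClass a γ K F)
    {H : E → ℝ} (hH : Measurable H) (hHb : ∀ x, |H x| ≤ M * wt x ^ b)
    (hab : Integrable (fun u => wt u ^ (a + b)) μ) :
    Integrable (fun x => F x * H x) μ := by
  have hK := hF.const_nonneg
  refine (hab.const_mul (K * M)).mono' (hF.measurable.mul hH).aestronglyMeasurable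
    (ae_of_all _ fun x => ?_)
  have hw := wt_rpow_nonneg x a
  rw [Real.norm_eq_abs, abs_mul, Real.rpow_add (wt_pos x)]
  calc |F x| * |H x| ≤ (K * wt x ^ a) * (M * wt x ^ b) :=
        mul_le_mul (hF.growth x) (hHb x) (abs_nonneg _) (by positivity)
    _ = _ := by ring

/-- The weights at `x` and at `X_s^x` are separated into a sum before integrating. By invariance
both parts then have the same `μ`-integral, so the bound is uniform in `s`. -/
theorem ProcessAssumption.abs_autocov_add_sub_le (hX : IsMarkovProcess P ℱ X)
    (h₁ : ProcessAssumption P X r r' L₁ γ₁ β L₂ ρ l l' L₃) [IsProbabilityMeasure μ]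
    (hinv : ∀ t, procKernel hX t ∘ₘ μ = μ)
    (hμ : ∀ a, 0 ≤ a → a ≤ r → Integrable (fun u => wt u ^ a) μ) (ha : 0 ≤ a) (har : 2 * a ≤ r)
    (hγ : 0 < γ) (hγ1 : γ ≤ 1) (hb : a + (l * γ + r' * a) ≤ r) (hF : HolderClass a γ K F)
    (hFi : ∀ t, Integrable (fun x => F x * ∫ u, F u ∂(procKernel hX t x)) μ) :
    ∃ M, 0 ≤ M ∧ ∀ s t : ℝ≥0,
      |autocov hX μ F (s + t) - autocov hX μ F s| ≤ M * (t : ℝ) ^ (l' * γ) := by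
  have hl := h₁.l_nonneg
  have hr' := h₁.one_le_r'
  have hK := hF.const_nonneg
  set b := l * γ + r' * a with hb_def
  have hb0 : 0 ≤ b := by positivity
  obtain ⟨C, hC, h⟩ := h₁.exists_abs_integral_add_sub_le hX ha har hγ hγ1
    (hb_def ▸ by linarith : l * γ + r' * a ≤ r)
  obtain ⟨D, hD, hmom⟩ := h₁.moment_wt hX
  have hi := hμ (a + b) (by positivity) hb
  set I := ∫ z, wt z ^ (a + b) ∂μ with hI_def
  have hI : 0 ≤ I := integral_nonneg fun z => wt_rpow_nonneg z _
  clear_value I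
  refine ⟨K * (K * (C * (2 * I))), by positivity, fun s t => ?_⟩
  have hi' : Integrable (fun u => wt u ^ (a + b)) (procKernel hX s ∘ₘ μ) := by rwa [hinv]
  have hi₂ := integrable_integral_of_integrable_comp hi'
  have hI₂ : ∫ x, ∫ u, wt u ^ (a + b) ∂(procKernel hX s x) ∂μ = I := by
    rw [← integral_comp_measure hi', hinv, hI_def]
  have hR : Integrable (fun x => K * (K * (C * ((t : ℝ) ^ (l' * γ) *
      (wt x ^ (a + b) + ∫ u, wt u ^ (a + b) ∂(procKernel hX s x)))))) μ :=
    ((((hi.add hi₂).const_mul _).const_mul _).const_mul _).const_mul _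
  rw [autocov, autocov, ← integral_sub (hFi _) (hFi _), ← Real.norm_eq_abs]
  refine (norm_integral_le_of_norm_le hR (ae_of_all _ fun x => ?_)).trans (le_of_eq ?_)
  · have hm := (hmom (a + b) (by positivity) hb s x).1
    have hm' := (hmom b hb0 (by linarith) s x).1
    have h1 : wt x ^ a * ∫ u, wt u ^ b ∂(procKernel hX s x) ≤
        wt x ^ (a + b) + ∫ u, wt u ^ (a + b) ∂(procKernel hX s x) := by
      have h2 : wt x ^ (a + b) = ∫ _, wt x ^ (a + b) ∂(procKernel hX s x) := by simp
      rw [h2, ← integral_add (integrable_const _) hm, ← integral_const_mul]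
      exact integral_mono (hm'.const_mul _) ((integrable_const _).add hm)
        fun u => rpow_mul_rpow_le (wt_pos x) (wt_pos u) ha hb0
    rw [← mul_sub, Real.norm_eq_abs, abs_mul]
    have hw := wt_rpow_nonneg x a
    calc _ ≤ (K * wt x ^ a) * (K * (C * ((t : ℝ) ^ (l' * γ) *
          ∫ u, wt u ^ b ∂(procKernel hX s x)))) :=
          mul_le_mul (hF.growth x) (h K F hF s t x) (abs_nonneg _) (by positivity)
      _ = K * (K * (C * ((t : ℝ) ^ (l' * γ) *
          (wt x ^ a * ∫ u, wt u ^ b ∂(procKernel hX s x))))) := by ring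
      _ ≤ _ := by gcongr
  · rw [integral_const_mul, integral_const_mul, integral_const_mul, integral_const_mul,
      integral_add hi hi₂, hI₂, ← hI_def]
    ring

theorem ProcessAssumption.integrable_prod (hX : IsMarkovProcess P ℱ X)
    (h₁ : ProcessAssumption P X r r' L₁ γ₁ β L₂ ρ l l' L₃) [IsProbabilityMeasure μ]
    (hcont : ∀ x, Continuous fun t => ∫ u, F u ∂(procKernel hX t x)) {b C : ℝ}
    (hb : ∀ t x, |∫ u, F u ∂(procKernel hX t x)| ≤ C * ((ρ t : ℝ) ^ γ₁ * wt x ^ b))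
    (hF : HolderClass a γ K F) (hab : Integrable (fun u => wt u ^ (a + b)) μ) :
    Integrable (fun z : E × ℝ => F z.1 * ∫ u, F u ∂(procKernel hX z.2.toNNReal z.1))
      (μ.prod (volume.restrict (Set.Ioi 0))) := by
  have hK := hF.const_nonneg
  have hm : Measurable (Function.uncurry fun (t : ℝ≥0) x => ∫ u, F u ∂(procKernel hX t x)) :=
    measurable_uncurry_of_continuous_of_measurable hcont
      fun t => measurable_integral_procKernel hX t hF.measurable
  have hm' : Measurable fun z : E × ℝ => ∫ u, F u ∂(procKernel hX z.2.toNNReal z.1) :=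
    hm.comp ((measurable_snd.real_toNNReal).prodMk measurable_fst)
  refine ((hab.mul_prod h₁.ρ_integrable).const_mul (K * C)).mono'
    ((hF.measurable.comp measurable_fst).mul hm').aestronglyMeasurable (ae_of_all _ fun z => ?_)
  have hw := wt_rpow_nonneg z.1 a
  rw [Real.norm_eq_abs, abs_mul, Real.rpow_add (wt_pos z.1)]
  calc _ ≤ (K * wt z.1 ^ a) * (C * ((ρ z.2.toNNReal : ℝ) ^ γ₁ * wt z.1 ^ b)) :=
        mul_le_mul (hF.growth _) (hb _ _) (abs_nonneg _) (by positivity)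
    _ = _ := by ring

end Autocovariance

/-! ### Identification of the limit variance -/

section LimitVariance

variable {Ω E : Type*} {mΩ : MeasurableSpace Ω} {P : Measure Ω} [IsProbabilityMeasure P]
  [NormedAddCommGroup E] [MeasurableSpace E] [BorelSpace E] [SecondCountableTopology E]
  {ℱ : Filtration ℝ≥0 mΩ} {X : ℝ≥0 → ℝ≥0 → E → Ω → E} {τ : ℕ → ℝ≥0} {Y : ℕ → ℕ → E → Ω → E}
  {r r' L₁ γ₁ β L₂ : ℝ} {ρ : ℝ≥0 → ℝ≥0} {l l' L₃ : ℝ} {q q' L₄ κ L₅ : ℝ} {ρτ : ℝ≥0 → ℝ≥0}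
  {α L₆ γ a A S K : ℝ} {μ : Measure E} {F : E → ℝ} {e : ℕ → ℕ → ℝ} {hY : IsMarkovChain P ℱ τ Y}

theorem MixingBound.hasSum_integral_mul_tailTerm (hB : MixingBound hY μ γ a A e S)
    (hF : HolderClass a γ K F) (hF0 : ∫ u, F u ∂μ = 0)
    (hab : Integrable (fun u => wt u ^ (a + A)) μ) {k : ℕ} (hk : 1 ≤ k) :
    HasSum (fun i => (τ (k + i) : ℝ) * ∫ x, F x * ∫ u, F u ∂(chainKernel hY k (k + i) x) ∂μ)
      (∫ x, F x * tailSum hY μ (fun _ => F) k x ∂μ) := by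
  have hFc : ∀ i, 1 ≤ i → HolderClass a γ K ((fun _ => F) i) := fun _ _ => hF
  have hK := hF.const_nonneg
  have hterm : ∀ i x, tailTerm hY μ (fun _ => F) k i x =
      τ (k + i) * ∫ u, F u ∂(chainKernel hY k (k + i) x) := by
    intro i x
    rw [tailTerm, hF0, sub_zero]
  have hle : ∀ i x, ‖F x * tailTerm hY μ (fun _ => F) k i x‖ ≤
      (τ (k + i) : ℝ) * e k (k + i) * (K * K * wt x ^ (a + A)) := by
    intro i x
    have hw := wt_rpow_nonneg x a
    rw [Real.norm_eq_abs, abs_mul, Real.rpow_add (wt_pos x)]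
    calc _ ≤ (K * wt x ^ a) * (τ (k + i) * e k (k + i) * (K * wt x ^ A)) :=
          mul_le_mul (hF.growth x) (hB.abs_tailTerm_le hFc hk i x) (abs_nonneg _) (by positivity)
      _ = _ := by ring
  have hR : ∀ i, Integrable (fun x => (τ (k + i) : ℝ) * e k (k + i) *
      (K * K * wt x ^ (a + A))) μ := fun i => (hab.const_mul _).const_mul _
  have hi : ∀ i, Integrable (fun x => F x * tailTerm hY μ (fun _ => F) k i x) μ := fun i =>
    (hR i).mono' (hF.measurable.mul
      (MixingBound.measurable_tailTerm hFc hk i)).aestronglyMeasurable (ae_of_all _ (hle i))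
  have h := hasSum_integral_of_summable_integral_norm hi (Summable.of_nonneg_of_le
    (fun i => integral_nonneg fun x => norm_nonneg _) (fun i => ?_)
    ((hB.summable k hk).mul_right (∫ x, K * K * wt x ^ (a + A) ∂μ)))
  · have h' : ∀ i, ∫ x, F x * tailTerm hY μ (fun _ => F) k i x ∂μ =
        (τ (k + i) : ℝ) * ∫ x, F x * ∫ u, F u ∂(chainKernel hY k (k + i) x) ∂μ := by
      intro i
      simp only [hterm]
      rw [← integral_const_mul]
      exact integral_congr_ae (ae_of_all _ fun x => mul_left_comm _ _ _)
    simp only [h', tsum_mul_left] at h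
    exact h
  · rw [← integral_const_mul]
    exact integral_mono_of_nonneg (ae_of_all _ fun x => norm_nonneg _) (hR i)
      (ae_of_all _ (hle i))

theorem SchemeAssumption.integrable_mul_integral_chainKernel
    (h₂ : SchemeAssumption P τ Y q q' L₄ κ L₅ ρτ) (hF : HolderClass a γ K F) (ha : 0 ≤ a)
    (haq : a ≤ q) (hab : Integrable (fun u => wt u ^ (a + q' * a)) μ) {k i : ℕ} (hki : k ≤ i) :
    Integrable (fun x => F x * ∫ u, F u ∂(chainKernel hY k i x)) μ := by
  obtain ⟨D, hD, hmom⟩ := h₂.moment_wt hY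
  refine hF.integrable_mul_integral (M := K * D) (hF.measurable.stronglyMeasurable.integral_kernel
    (κ := chainKernel hY k i)).measurable (fun x => ?_) hab
  have h := hmom a ha haq k i x hki
  rw [mul_assoc]
  exact (hF.abs_integral_le h.1).trans (mul_le_mul_of_nonneg_left h.2 hF.const_nonneg)

/-- The coefficients `μ(F Q_{k,i} F)` are within a multiple of `τ_i^(γα)` of the autocovariance at
`t_i - t_k`, by the strong error averaged over `μ`. The autocovariance is `l'γ`-Hölder, so the
Riemann sum lemma applies. -/
theorem tendsto_integral_mul_tailSum (hX : IsMarkovProcess P ℱ X) (hτ : IsStepSequence τ)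
    (h₁ : ProcessAssumption P X r r' L₁ γ₁ β L₂ ρ l l' L₃)
    (h₂ : SchemeAssumption P τ Y q q' L₄ κ L₅ ρτ)
    (h₃ : ErrorAssumption P X τ Y r' q' α L₆) (hstep : StepConditions τ ρ ρτ γ α l')
    (hγ : 0 < γ) (hγ1 : γ ≤ 1) [IsProbabilityMeasure μ] (hinv : ∀ t, procKernel hX t ∘ₘ μ = μ)
    (hμ : ∀ a, 0 ≤ a → a ≤ r → Integrable (fun u => wt u ^ a) μ)
    (hμ' : ∀ a, 0 ≤ a → a ≤ q → Integrable (fun u => wt u ^ a) μ)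
    (hB : MixingBound hY μ γ a A e S) (ha : 0 ≤ a) (har : 2 * a ≤ r) (haq : 2 * (q' * a) ≤ q)
    (hA : 0 ≤ A) (haA : a + A ≤ q) (hb : a + (l * γ + r' * a) ≤ r)
    (hd : 2 * (a + max r' q' * γ) ≤ q) (hF : HolderClass a γ K F) (hF0 : ∫ u, F u ∂μ = 0)
    (hFi : ∀ t, Integrable (fun x => F x * ∫ u, F u ∂(procKernel hX t x)) μ)
    (hi : IntegrableOn (fun t : ℝ => autocov hX μ F t.toNNReal) (Set.Ioi 0)) :
    Tendsto (fun k => ∫ x, F x * tailSum hY μ (fun _ => F) k x ∂μ) atTop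
      (𝓝 (∫ t in Set.Ioi (0 : ℝ), autocov hX μ F t.toNNReal)) := by
  have hq' := h₂.one_le_q'
  have hqa : 0 ≤ q' * a := by positivity
  have haqa : a ≤ q' * a := le_mul_of_one_le_left ha hq'
  have hK := hF.const_nonneg
  obtain ⟨M, hM, hhol⟩ := h₁.abs_autocov_add_sub_le hX hinv hμ ha har hγ hγ1 hb hF hFi
  obtain ⟨C, hC, herr⟩ := h₃.abs_integral_integral_sub_le hX hY h₂ (by linarith [h₁.one_le_r'])
    hγ hγ1 hinv hμ' ha ha haq hd
  have hsδ : Summable fun n => (τ n : ℝ) ^ (1 + γ * α) :=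
    (summable_nat_add_iff 1).1 hstep.summable_pow
  refine tendsto_sum_grid_integral hτ (M := M) (M' := K * (K * C)) hM
    (mul_pos h₁.l'_pos hγ).le (mul_pos hγ h₃.α_pos).le (fun s t hs ht => ?_) hi
    (hstep.summable_rpow hτ) hsδ
    (c := fun k i => ∫ x, F x * ∫ u, F u ∂(chainKernel hY k i x) ∂μ) (fun k i hk hki => ?_)
    fun k hk => hB.hasSum_integral_mul_tailTerm hF hF0 (hμ' _ (by positivity) haA) hk
  · have := hhol s.toNNReal t.toNNReal
    rwa [← Real.toNNReal_add hs ht, Real.coe_toNNReal t ht] at this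
  · rw [← NNReal.sub_def]
    have hQi := h₂.integrable_mul_integral_chainKernel (hY := hY) hF ha (by linarith)
      (hμ' _ (by positivity) (by linarith)) hki
    have h := herr K F hF k i hk hki F K hK hF.growth
    simp only [mul_sub] at h
    rw [integral_sub (hFi _) hQi] at h
    rw [autocov, abs_sub_comm]
    refine h.trans (le_of_eq ?_)
    ring

theorem tendsto_integral_quadTerm (hτ : IsStepSequence τ) (hB : MixingBound hY μ γ a A e S)
    (hF : HolderClass a γ K F) (haA : Integrable (fun u => wt u ^ (a + A)) μ)
    (haa : Integrable (fun u => wt u ^ (a + a)) μ) {L : ℝ}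
    (h : Tendsto (fun k => ∫ x, F x * tailSum hY μ (fun _ => F) k x ∂μ) atTop (𝓝 L)) :
    Tendsto (fun k => ∫ u, quadTerm hY μ F k u ∂μ) atTop (𝓝 (2 * L)) := by
  have hτ0 : Tendsto (fun n => (τ n : ℝ)) atTop (𝓝 0) := NNReal.tendsto_coe.2 hτ.tendsto_zero
  have h1 := (h.const_mul 2).sub (hτ0.mul_const (∫ x, F x * F x ∂μ))
  rw [zero_mul, sub_zero] at h1
  refine h1.congr' ((eventually_ge_atTop 1).mono fun k hk => ?_)
  have hφ := hB.holderClass_tailSum (G := fun _ => F) (fun _ _ => hF) hk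
  have i1 := hF.integrable_mul_integral hφ.measurable hφ.growth haA
  have i2 := hF.integrable_mul_integral hF.measurable hF.growth haa
  simp only [quadTerm]
  rw [integral_sub (i1.const_mul 2) (i2.const_mul _), integral_const_mul, integral_const_mul]

end LimitVariance

/-! ### The martingale series in terms of the corrector -/

section MartingaleSeries

variable {Ω E : Type*} {mΩ : MeasurableSpace Ω} {P : Measure Ω} [IsProbabilityMeasure P]
  [NormedAddCommGroup E] [MeasurableSpace E] [BorelSpace E] [SecondCountableTopology E]
  {ℱ : Filtration ℝ≥0 mΩ} {τ : ℕ → ℝ≥0} {Y : ℕ → ℕ → E → Ω → E}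
  {γ a A S K K' : ℝ} {μ : Measure E} {f F : E → ℝ} {e : ℕ → ℕ → ℝ}
  {hY : IsMarkovChain P ℱ τ Y}

theorem HolderClass.integrable_chain (hf : HolderClass a γ K f)
    (hB : MixingBound hY μ γ a A e S) (x : E) (i : ℕ) :
    Integrable (fun ω => f (Y 0 i x ω)) P := by
  have := hf.integrable (hB.integrable_left 0 i x (Nat.zero_le i))
  rw [chainKernel_apply hY (Nat.zero_le _)] at this
  exact this.comp_measurable (hY.measurable (Nat.zero_le _) x)

/-- For `i < k` the conditional expectation is the variable itself. For `i ≥ k` it is `Q_{k,i} f` at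
`Y_k` by the Markov property, so the tail of the series is the corrector at `Y_k`. -/
theorem MixingBound.hasSum_martTerm (hB : MixingBound hY μ γ a A e S)
    (hf : HolderClass a γ K f) (hF : HolderClass a γ K' F) (hF0 : ∫ u, F u ∂μ = 0)
    (hfF : ∀ u, F u = f u - ∫ y, f y ∂μ) (x : E) (k : ℕ) :
    ∀ᵐ ω ∂P, HasSum (fun i => martTerm P ℱ τ Y μ f x k i ω)
      (accum (fun j => (τ j : ℝ)) (fun j ω => F (Y 0 j x ω))
        (fun j ω => tailSum hY μ (fun _ => F) j (Y 0 j x ω)) k ω) := by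
  have h1 : ∀ᵐ ω ∂P, ∀ i, k ≤ i → (P[fun ω' => f (Y 0 i x ω') | ℱ (grid τ k)]) ω =
      ∫ y, f y ∂(chainKernel hY k i (Y 0 k x ω)) := by
    rw [ae_all_iff]
    intro i
    by_cases hi : k ≤ i
    · filter_upwards [condExp_chain hY (Nat.zero_le k) hi x hf.measurable
        (hf.integrable_chain hB x i)] with ω hω _ using hω
    · exact ae_of_all _ fun ω h => absurd h hi
  have h2 : ∀ᵐ ω ∂P, ∀ i, i < k → (P[fun ω' => f (Y 0 i x ω') | ℱ (grid τ k)]) ω =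
      f (Y 0 i x ω) := by
    refine ae_of_all _ fun ω i hi => ?_
    have hm : StronglyMeasurable[ℱ (grid τ k)] fun ω => f (Y 0 i x ω) :=
      (hf.measurable.comp ((hY.adapted 0 i x (Nat.zero_le i)).mono (ℱ.mono (grid_mono τ hi.le))
        le_rfl)).stronglyMeasurable
    rw [condExp_of_stronglyMeasurable (ℱ.le _) hm (hf.integrable_chain hB x i)]
  filter_upwards [h1, h2] with ω hω₁ hω₂
  have h3 : ∀ i, martTerm P ℱ τ Y μ f x k (i + k) ω =
      tailTerm hY μ (fun _ => F) k i (Y 0 k x ω) := by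
    intro i
    rw [martTerm, hω₁ (i + k) (by omega), add_comm i k, tailTerm, hF0, sub_zero]
    congr 1
    simp only [hfF]
    rw [integral_sub (hf.integrable (hB.integrable_left k (k + i) _ (by omega)))
      (integrable_const _)]
    simp
  have h4 : ∑ i ∈ Finset.range k, martTerm P ℱ τ Y μ f x k i ω =
      ∑ i ∈ Finset.range k, (τ i : ℝ) * F (Y 0 i x ω) :=
    Finset.sum_congr rfl fun i hi => by
      rw [martTerm, hω₂ i (Finset.mem_range.1 hi), hfF]
  have h5 := (hB.summable_tailTerm (G := fun _ => F) (fun _ _ => hF) k (Y 0 k x ω)).hasSum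
  have h6 := (hasSum_nat_add_iff (f := fun i => martTerm P ℱ τ Y μ f x k i ω) k).1
    (by simpa only [h3] using h5)
  rw [h4, add_comm] at h6
  exact h6

theorem MixingBound.coarseDiff_succ (hB : MixingBound hY μ γ a A e S)
    (hf : HolderClass a γ K f) (hF : HolderClass a γ K' F) (hF0 : ∫ u, F u ∂μ = 0)
    (hfF : ∀ u, F u = f u - ∫ y, f y ∂μ) (x : E) :
    ∀ᵐ ω ∂P, ∀ k, coarseDiff P ℱ τ Y μ f x (k + 1) ω =
      accum (fun j => (τ j : ℝ)) (fun j ω => F (Y 0 j x ω))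
          (fun j ω => tailSum hY μ (fun _ => F) j (Y 0 j x ω)) (coarseIndex τ (k + 1)) ω -
        accum (fun j => (τ j : ℝ)) (fun j ω => F (Y 0 j x ω))
          (fun j ω => tailSum hY μ (fun _ => F) j (Y 0 j x ω)) (coarseIndex τ k) ω := by
  filter_upwards [ae_all_iff.2 (hB.hasSum_martTerm hf hF hF0 hfF x)] with ω hω k
  simp only [coarseDiff, coarseMart, mart, (hω _).tsum_eq]
  ring

end MartingaleSeries

/-- The exponent inequalities used for the correctors, in terms of `a₂ = p/2 + A₁` where
`A₁ = κγ + q'p/2 + γ`. -/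
theorem exponent_bounds {r' q' β κ γ p q d pF : ℝ} {c : ℕ} (hc : 2 ≤ c) (hγ : 0 < γ)
    (hp : 1 ≤ p) (hq' : 1 ≤ q') (hκ : 0 ≤ κ) (hd : d = max (max (1 + β) r') q')
    (hpF : pF = p / 2 + p * q' / 2 + γ * max d κ)
    (hexp₂ : 4 * c * (p * q' / 2 + d * γ) ≤ q) (hexp₅ : 2 * c * (pF * q' / 2 + d * γ) ≤ q) :
    2 * (p / 2 + max r' q' * γ) ≤ q ∧ 2 * (q' * (p / 2)) ≤ q ∧
      2 * (q' * (p / 2 + (κ * γ + q' * (p / 2) + γ))) ≤ q ∧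
      κ * γ + q' * (p / 2 + (κ * γ + q' * (p / 2) + γ)) + γ ≤ q - p ∧
      2 * (κ * γ + q' * (p / 2) + γ) ≤ q - p := by
  have hc' : (2 : ℝ) ≤ c := by exact_mod_cast hc
  have hdm : max r' q' ≤ d := by
    rw [hd]
    exact max_le ((le_max_right _ _).trans (le_max_left _ _)) (le_max_right _ _)
  have hdq : q' ≤ d := (le_max_right r' q').trans hdm
  have hdγ : q' * γ ≤ d * γ := mul_le_mul_of_nonneg_right hdq hγ.le
  have hdγ' : max r' q' * γ ≤ d * γ := mul_le_mul_of_nonneg_right hdm hγ.le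
  have hq'γ : 0 < q' * γ := by positivity
  have hpq : p ≤ p * q' := le_mul_of_one_le_right (by linarith) hq'
  have hκm : γ * κ ≤ γ * max d κ := mul_le_mul_of_nonneg_left (le_max_right _ _) hγ.le
  have hκγ : 0 ≤ γ * κ := by positivity
  have h2 : 8 * (p * q' / 2 + d * γ) ≤ q := by
    refine le_trans ?_ hexp₂
    have : 0 ≤ p * q' / 2 + d * γ := by linarith
    nlinarith
  have hpF0 : 0 ≤ pF * q' := by
    have : 0 ≤ pF := by linarith
    positivity
  have h5 : 4 * (pF * q' / 2 + d * γ) ≤ q := by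
    refine le_trans ?_ hexp₅
    have : 0 ≤ pF * q' / 2 + d * γ := by linarith
    nlinarith
  set a₂ := p / 2 + (κ * γ + q' * (p / 2) + γ) with ha₂
  have h6 : a₂ ≤ pF + γ := by
    rw [hpF, ha₂]
    linarith
  have h7 : q' * a₂ ≤ pF * q' + q' * γ := by
    have := mul_le_mul_of_nonneg_left h6 (by linarith : 0 ≤ q')
    linarith
  have h8 : 0 < a₂ := by
    rw [ha₂]
    nlinarith
  have h9 : a₂ ≤ q' * a₂ := le_mul_of_one_le_left h8.le hq'
  refine ⟨by linarith, by linarith, by linarith, ?_, ?_⟩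
  · have : κ * γ + γ ≤ a₂ - p := by rw [ha₂]; linarith
    linarith
  · have : 2 * (κ * γ + q' * (p / 2) + γ) = 2 * a₂ - p := by rw [ha₂]; ring
    linarith

theorem process_exponent_bounds {r r' β γ₁ γ q' p l : ℝ} (hγ : 0 < γ)
    (hr' : 1 ≤ r') (hl : 0 ≤ l)
    (hexp₁ : p / 2 * (1 + r') + (1 + β) * γ₁ ≤ r)
    (hexp₃ : p / 2 + max ((p / 2 + γ) * max r' q') ((p / 2 + l * γ) * r') ≤ r) :
    p / 2 + (β * γ₁ + r' * (p / 2) + γ₁) ≤ r ∧ p / 2 + (l * γ + r' * (p / 2)) ≤ r := by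
  have h1 := le_max_right ((p / 2 + γ) * max r' q') ((p / 2 + l * γ) * r')
  have h2 : l * γ ≤ l * γ * r' := le_mul_of_one_le_right (by positivity) hr'
  constructor <;> linarith

end NumLIL

end


/-! ### Assembly of the main theorem -/

open NumLIL in
theorem mainTheorem5
    {E : Type*} [NormedAddCommGroup E] [NormedSpace ℝ E] [CompleteSpace E]
    [TopologicalSpace.SeparableSpace E] [MeasurableSpace E] [BorelSpace E]
    {Ω : Type*} {mΩ : MeasurableSpace Ω} (P : Measure Ω) [IsProbabilityMeasure P]
    (ℱ : Filtration ℝ≥0 mΩ)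
    -- the Markov process, the step sizes and the approximation
    (X : ℝ≥0 → ℝ≥0 → E → Ω → E) (hX : NumLIL.IsMarkovProcess P ℱ X)
    (τ : ℕ → ℝ≥0) (hτ : NumLIL.IsStepSequence τ)
    (Y : ℕ → ℕ → E → Ω → E) (hY : NumLIL.IsMarkovChain P ℱ τ Y)
    -- the three assumptions
    (r r' L₁ γ₁ β L₂ : ℝ) (ρ : ℝ≥0 → ℝ≥0) (l l' L₃ : ℝ)
    (h₁ : NumLIL.ProcessAssumption P X r r' L₁ γ₁ β L₂ ρ l l' L₃)
    (q q' L₄ κ L₅ : ℝ) (ρτ : ℝ≥0 → ℝ≥0)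
    (h₂ : NumLIL.SchemeAssumption P τ Y q q' L₄ κ L₅ ρτ)
    (α L₆ : ℝ) (h₃ : NumLIL.ErrorAssumption P X τ Y r' q' α L₆)
    -- the exponents
    (c : ℕ) (hc : 2 ≤ c) (p γ d pF : ℝ)
    (hp : p ∈ Set.Icc 1 (min r q)) (hγ : γ ∈ Set.Icc γ₁ 1)
    (hd : d = max (max (1 + β) r') q')
    (hpF : pF = p / 2 + p * q' / 2 + γ * max d κ)
    (hexp₁ : p / 2 * (1 + r') + (1 + β) * γ₁ ≤ r)
    (hexp₂ : 4 * c * (p * q' / 2 + d * γ) ≤ q)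
    (hexp₃ : p / 2 + max ((p / 2 + γ) * max r' q') ((p / 2 + l * γ) * r') ≤ r)
    (hexp₄ : pF ≤ min r q)
    (hexp₅ : 2 * c * (pF * q' / 2 + d * γ) ≤ q)
    -- the conditions on the step sizes
    (hstep : NumLIL.StepConditions τ ρ ρτ γ α l') :
    -- the unique invariant probability measure of `X`
    ∃ μ : Measure E, NumLIL.IsInvariantProb P X μ ∧
      (∀ ν : Measure E, NumLIL.IsInvariantProb P X ν → ν = μ) ∧
      ∀ (f : E → ℝ), NumLIL.MemC p γ f →
        -- `v` is well defined
        Integrable f μ ∧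
        (∀ t u, Integrable (fun ω => f (X 0 t u ω)) P) ∧
        (∀ u, IntegrableOn
          (fun t : ℝ => NumLIL.semigroup P X t.toNNReal f u - ∫ y, f y ∂μ) (Set.Ioi 0)) ∧
        Integrable (fun u => (f u - ∫ y, f y ∂μ) * NumLIL.corrector P X μ f u) μ ∧
        0 ≤ NumLIL.radicand P X μ f ∧
        ∀ x : E,
          -- the series defining the martingale converge
          (∀ i, Integrable (fun ω => f (Y 0 i x ω)) P) ∧
          (∀ k, ∀ᵐ ω ∂P, Summable fun i => NumLIL.martTerm P ℱ τ Y μ f x k i ω) ∧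
          -- the almost sure limit
          ∀ᵐ ω ∂P, Tendsto (fun N : ℕ => 1 / (NumLIL.coarseGrid τ N : ℝ) *
            ∑ k ∈ Finset.Icc 1 N, |NumLIL.coarseDiff P ℱ τ Y μ f x k ω| ^ 2)
            atTop (𝓝 (NumLIL.limitConst P X μ f ^ 2)) := by
  have : SecondCountableTopology E := UniformSpace.secondCountable_of_separable E
  have hγ₁ := h₁.γ₁_pos
  have hγ0 : 0 < γ := hγ₁.trans_le hγ.1
  have hr' := h₁.one_le_r'
  have hq' := h₂.one_le_q'
  have hκ := h₂.κ_nonneg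
  have hβ := h₁.β_nonneg
  have hl := h₁.l_nonneg
  have hp1 := hp.1
  have hpr : p ≤ r := hp.2.trans (min_le_left _ _)
  have hpq : p ≤ q := hp.2.trans (min_le_right _ _)
  obtain ⟨hx1, hx2, hx3, hx4, hx5⟩ := exponent_bounds hc hγ0 hp1 hq' hκ hd hpF hexp₂ hexp₅
  obtain ⟨hx6, hx7⟩ := process_exponent_bounds hγ0 hr' hl hexp₁ hexp₃
  have hq0 : 0 < q := by linarith
  obtain ⟨μ, hμ⟩ := exists_tendsto_procLaw hX h₁
  have hinv := comp_eq_of_tendsto_procLaw hX h₁ hμ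
  have hμr : ∀ a, 0 ≤ a → a ≤ r → Integrable (fun u => wt u ^ a) (μ : Measure E) :=
    fun a ha har => integrable_wt_rpow_invariant_of_le hX h₁ hμ ha har
  have hμq : ∀ a, 0 ≤ a → a ≤ q → Integrable (fun u => wt u ^ a) (μ : Measure E) :=
    fun a ha haq => integrable_wt_rpow_invariant_of_le' hX hY hτ h₁ h₂ h₃ hstep hγ0 hμ ha haq
  refine ⟨μ, (isInvariantProb_iff hX).2 ⟨inferInstance, hinv⟩, fun ν hν => ?_, fun f hf => ?_⟩
  · obtain ⟨hν1, hν2⟩ := (isInvariantProb_iff hX).1 hν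
    exact eq_of_comp_eq hX hμ ν hν2
  obtain ⟨K, hfK⟩ := hf.holderClass (by linarith)
  set a := p / 2 with ha_def
  have ha : 0 ≤ a := by linarith
  have har : 2 * a ≤ r := by linarith
  set A := κ * γ + q' * a + γ with hA_def
  have hqa : 0 ≤ q' * a := by positivity
  have hA : 0 ≤ A := by positivity
  have haA : a ≤ A := by
    have : a ≤ q' * a := le_mul_of_one_le_left ha hq'
    have : 0 ≤ κ * γ := by positivity
    linarith
  have hr'a : 0 ≤ r' * a := by positivity
  have hβγ : 0 ≤ β * γ₁ := by positivity
  have hlγ : 0 ≤ l * γ := by positivity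
  have hmγ : 0 ≤ max r' q' * γ := mul_nonneg (le_max_of_le_left (by linarith)) hγ0.le
  obtain ⟨e, S, hB⟩ := exists_mixingBound hX hY h₂ (by linarith) h₃ hstep hγ0 hγ.2 hinv hμq ha
    hx2 (by linarith) (by linarith)
  -- The second mixing bound, on the larger class containing the quadratic terms, provides the
  -- second corrector.
  obtain ⟨e', S', hB'⟩ := exists_mixingBound hX hY h₂ (by linarith) h₃ hstep hγ0 hγ.2 hinv hμq
    (a := a + A) (by linarith) hx3 (by linarith) (by linarith)
  have hfi : Integrable f (μ : Measure E) := hfK.integrable (hμr a ha (by linarith))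
  set F : E → ℝ := fun u => f u - ∫ y, f y ∂(μ : Measure E) with hF_def
  have hF := hfK.sub_const ha (∫ y, f y ∂(μ : Measure E))
  have hF0 : ∫ u, F u ∂(μ : Measure E) = 0 := by
    rw [hF_def, integral_sub hfi (integrable_const _)]
    simp
  obtain ⟨D, hD, hmom⟩ := h₁.moment_wt hX
  have hfX : ∀ t u, Integrable f (procKernel hX t u) := fun t u =>
    hfK.integrable (hmom a ha (by linarith) t u).1
  have hsemi : ∀ t u, semigroup P X t f u - ∫ y, f y ∂(μ : Measure E) =
      ∫ y, F y ∂(procKernel hX t u) := by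
    intro t u
    rw [semigroup_eq_integral hX t hf.measurable, hF_def,
      integral_sub (hfX t u) (integrable_const _)]
    simp
  obtain ⟨C, hC, hdecay⟩ := h₁.exists_abs_integral_le hX hinv hμr ha har (by linarith)
  have hdec : ∀ t x, |∫ u, F u ∂(procKernel hX t x)| ≤
      (K + |∫ y, f y ∂(μ : Measure E)|) * C *
        ((ρ t : ℝ) ^ γ₁ * wt x ^ (β * γ₁ + r' * a + γ₁)) := fun t x => by
    rw [mul_assoc]
    -- The Hölder exponent is lowered to `γ₁`, the power at which `ρ` is integrable.
    exact hdecay _ F (hF.of_exponent_le hγ₁ hγ.1) hF0 t x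
  have hcont := fun x => h₁.continuous_integral_procKernel hX ha har hγ0 hγ.2 (by linarith) hF x
  have hprod := h₁.integrable_prod hX hcont hdec hF (hμr _ (by linarith) hx6)
  have hFi : ∀ t, Integrable (fun x => F x * ∫ u, F u ∂(procKernel hX t x)) (μ : Measure E) :=
    fun t => hF.integrable_mul_integral (measurable_integral_procKernel hX t hF.measurable)
      (fun x => (hdec t x).trans_eq (mul_assoc _ _ _).symm) (hμr _ (by linarith) hx6)
  have hcorr : ∀ u, corrector P X μ f u =
      ∫ t in Set.Ioi (0 : ℝ), ∫ y, F y ∂(procKernel hX t.toNNReal u) := fun u => by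
    simp only [corrector, hsemi]
  have hrad : radicand P X μ f =
      2 * ∫ t in Set.Ioi (0 : ℝ), autocov hX μ F t.toNNReal := by
    simp only [radicand, hcorr, autocov]
    -- Fubini turns the radicand into twice the time integral of the autocovariance.
    rw [← integral_integral_swap hprod]
    simp only [integral_const_mul]
    rfl
  have hlim := tendsto_integral_mul_tailSum hX hτ h₁ h₂ h₃ hstep hγ0 hγ.2 hinv hμr hμq hB ha har
    hx2 hA (by linarith) hx7 hx1 hF hF0 hFi hprod.integral_prod_right
  have hquad := tendsto_integral_quadTerm hτ hB hF (hμq _ (by linarith) (by linarith))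
    (hμq _ (by linarith) (by linarith)) hlim
  rw [← hrad] at hquad
  -- The exponent `s = 1 + p/q` spends the gap `p` left by the exponent bounds: `(1 + p/q)(q - p) =
  -- q - p²/q ≤ q`, so weights of order at most `q - p` still have `s`-th moments.
  have hs1 : 1 < 1 + p / q := by
    have : 0 < p / q := by positivity
    linarith
  have hpq' : p / q * q = p := div_mul_cancel₀ p hq0.ne'
  have hpq1 : p / q ≤ 1 := (div_le_one hq0).2 hpq
  have hpq0 : 0 ≤ p / q := by positivity
  have hs3 : ∀ z, z ≤ q - p → (1 + p / q) * z ≤ q := fun z hz => by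
    have h : (1 + p / q) * (q - p) = q - p / q * p := by linear_combination hpq'
    have h' : 0 ≤ p / q * p := by positivity
    exact (mul_le_mul_of_nonneg_left hz (by linarith)).trans (by linarith)
  have hmain := fun x => ae_tendsto_average_sq_increments_tailSum hτ h₂ hB hB' hF hF0 ha haA hs1
    (by linarith) (hs3 _ hx5) (hs3 _ hx4) hquad x
  have hmain' : ∀ x : E, ∀ᵐ ω ∂P, Tendsto (fun N : ℕ => 1 / (coarseGrid τ N : ℝ) *
      ∑ k ∈ Finset.Icc 1 N, |coarseDiff P ℱ τ Y μ f x k ω| ^ 2)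
      atTop (𝓝 (radicand P X μ f)) := by
    intro x
    filter_upwards [hmain x, hB.coarseDiff_succ hfK hF hF0 (fun _ => rfl) x] with ω hω hω'
    refine hω.congr fun N => ?_
    congr 1
    rw [← Finset.Ico_succ_right_eq_Icc, Finset.sum_Ico_eq_sum_range]
    refine Finset.sum_congr (by simp) fun k _ => ?_
    rw [sq_abs, add_comm 1 k, hω' k]
  -- A single path in the almost sure set suffices: along it the radicand is a limit of averages of
  -- squares.
  have hrad0 : 0 ≤ radicand P X μ f := by
    obtain ⟨ω, hω⟩ := (hmain' 0).exists
    exact ge_of_tendsto' hω fun N => by positivity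
  refine ⟨hfi, fun t u => ?_, fun u => ?_, ?_, hrad0, fun x => ⟨hfK.integrable_chain hB x,
    fun k => (hB.hasSum_martTerm hfK hF hF0 (fun _ => rfl) x k).mono fun ω hω => hω.summable, ?_⟩⟩
  · have := hfX t u
    rw [procKernel_apply] at this
    exact this.comp_measurable (hX.measurable zero_le u)
  · simp only [hsemi]
    refine (h₁.ρ_integrable.mul_const _).const_mul _ |>.mono' ?_ (ae_of_all _ fun t => hdec _ u)
    exact ((hcont u).comp continuous_real_toNNReal).aestronglyMeasurable
  · simp only [hcorr]
    have := hprod.integral_prod_left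
    simpa only [integral_const_mul] using this
  · rw [limitConst, Real.sq_sqrt hrad0]
    exact hmain' x
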